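/- **Setting.** Let $T>0$ and let $n,m,k$ be dimensions. All coefficients below are deterministic, measurable and essentially bounded on $[0,T]$: $A_1,A_2$ ($n\times n$), $B_1,B_2,C_1,C_2$ ($n\times m$), $D_1,D_2$ ($n\times k$), $A_3$ ($m\times n$), $B_3,C_3$ ($m\times m$), $D_3$ ($m\times k$), and symmetric $A_4$ ($n\times n$), $B_4,C_4$ ($m\times m$), $D_4$ ($k\times k$); further $F\in\mathbb R^{m\times n}$ and symmetric $G\in\mathbb R^{n\times n}$, $H\in\mathbb R^{m\times m}$. Assume $A_4,B_4,C_4\ge 0$ a.e., $H\ge 0$, $G>0$, and $D_4>0$ a.e. with $D_4^{-1}$ essentially bounded. The argument $t$ is omitted. **The equation for $Q$.** Put $$\tilde A_1=\begin{pmatrix}A_1&-D_1D_4^{-1}D_3^\top\\0&B_3^\top\end{pmatrix},\quad \tilde B_1=\begin{pmatrix}-D_1D_4^{-1}D_1^\top&B_1\\B_1^\top&B_4\end{pmatrix},\quad \tilde C_1=\begin{pmatrix}-D_1D_4^{-1}D_2^\top&C_1\\B_2^\top&0\end{pmatrix},$$ $$\tilde A_2=\begin{pmatrix}A_2&-D_2D_4^{-1}D_3^\top\\0&C_3^\top\end{pmatrix},\quad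 \tilde B_2=\begin{pmatrix}-D_2D_4^{-1}D_1^\top&B_2\\C_1^\top&0\end{pmatrix},\quad \tilde C_2=\begin{pmatrix}-D_2D_4^{-1}D_2^\top&C_2\\C_2^\top&C_4\end{pmatrix},$$ $$\tilde A_3=\begin{pmatrix}A_4&A_3^\top\\A_3&-D_3D_4^{-1}D_3^\top\end{pmatrix},\quad \tilde B_3=\begin{pmatrix}A_1^\top&0\\-D_3D_4^{-1}D_1^\top&B_3\end{pmatrix},\quad \tilde C_3=\begin{pmatrix}A_2^\top&0\\-D_3D_4^{-1}D_2^\top&C_3\end{pmatrix},\quad \tilde F=\begin{pmatrix}G&F^\top\\F&0\end{pmatrix}.$$ The equation for the $(n+m)\times(n+m)$ matrix function $Q$ is $$dQ=-\big[Q\tilde A_1+Q\tilde B_1Q+Q\tilde C_1K+\tilde A_3+\tilde B_3Q+\tilde C_3K\big]dt,\qquad Q(T)=\tilde F,\qquad(\ast)$$ with $K=(I-Q\tilde C_2)^{-1}(Q\tilde A_2+Q\tilde B_2Q)$. A solution on $[0,T]$ is a continuous $Q$ such that $I-Q\tilde C_2$ is invertible a.e., the bracket is integrable, and $(\ast)$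 holds in integrated form. **The approximations.** Put $$\tilde A=\begin{pmatrix}A_1&B_1\\-A_3&-B_3\end{pmatrix},\ \tilde B=\begin{pmatrix}D_1&C_1\\-D_3&-C_3\end{pmatrix},\ \tilde C=\begin{pmatrix}A_2&B_2\\0&0\end{pmatrix},\ \tilde D=\begin{pmatrix}D_2&C_2\\0&I_m\end{pmatrix},\ \tilde{\mathsf Q}=\begin{pmatrix}A_4&0\\0&B_4\end{pmatrix},\ \tilde R=\begin{pmatrix}D_4&0\\0&C_4\end{pmatrix}.$$ For $i=1,2,\dots$ let ${}_i\tilde P=\begin{pmatrix}\tilde P_{1,i}&\tilde P_{2,i}^\top\\\tilde P_{2,i}&\tilde P_{3,i}\end{pmatrix}$ be the positive definite solution (continuous, equation in integrated form) on $[0,T]$ of the Riccati equation $$\dot{\tilde P}+\tilde P\tilde A+\tilde A^\top\tilde P+\tilde C^\top\tilde P\tilde C+\tilde{\mathsf Q}-M_2^\top M_1^{-1}M_2=0,\quad M_1=\tilde R+\tilde D^\top\tilde P\tilde D>0,\quad M_2=\tilde B^\top\tilde P+\tilde D^\top\tilde P\tilde C,$$ $${}_i\tilde P(T)=\begin{pmatrix}G+iF^\top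 F&-iF^\top\\-iF&iI_m\end{pmatrix},$$ and set $P_{1,i}=\tilde P_{1,i}-\tilde P_{2,i}^\top\tilde P_{3,i}^{-1}\tilde P_{2,i}$, $P_{2,i}=-\tilde P_{3,i}^{-1}\tilde P_{2,i}$, $P_{3,i}=\tilde P_{3,i}^{-1}$, $$L_{1,i}=I_m-P_{2,i}C_2+P_{3,i}C_4,\qquad L_{2,i}=I_n-P_{2,i}^\top C_2^\top+(P_{1,i}C_2+P_{2,i}^\top C_4)L_{1,i}^{-1}P_{3,i}C_2^\top.$$ **Statement.** Suppose there is a constant $c$, independent of $i\ge1$ and $t\in[0,T]$, such that for every $i\ge 1$: $P_{1,i}(t)\le cI_n$ and $|P_{2,i}(t)|\le c$ for all $t$, and, for almost every $t$, $L_{1,i}(t)$ and $L_{2,i}(t)$ are invertible with $|L_{1,i}(t)^{-1}|\le c$ and $|L_{2,i}(t)^{-1}|\le c$. (The existence of the solutions ${}_i\tilde P$ is not assumed: these bounds are required of every such solution.) Then $(\ast)$ has a unique solution on $[0,T]$. -/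

import Mathlib

open MeasureTheory

namespace FBLQ

/-- Membership in `L^∞(0,T; ℝ^{p×q})`: every entry is (a.e. strongly) measurable and essentially
bounded on `[0,T]`. -/
def MemLInf {p q : Type*} (T : ℝ) (A : ℝ → Matrix p q ℝ) : Prop :=
  ∀ a b, MemLp (fun t => A t a b) ⊤ (volume.restrict (Set.Icc 0 T))

/-- The norm `√(tr (M Mᵀ))` of a real matrix. -/
noncomputable def matNorm {p q : Type*} [Fintype p] [Fintype q] (M : Matrix p q ℝ) : ℝ :=
  Real.sqrt (Matrix.trace (M * M.transpose))

/-- Deterministic data of the forward-backward linear quadratic control problem with state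
dimensions `n` (forward) and `m` (backward) and control dimension `k`:

`dX = [A₁X + B₁Y + C₁Z + D₁u] dt + [A₂X + B₂Y + C₂Z + D₂u] dB`,
`dY = -[A₃X + B₃Y + C₃Z + D₃u] dt + Z dB`, `Y(T) = F X(T) + ξ`,

with running weights `A₄, B₄, C₄, D₄` on `X, Y, Z, u`, weight `G` on `X(T)` and `H` on `Y(0)`. -/
structure Data (n m k : ℕ) where
  A₁ : ℝ → Matrix (Fin n) (Fin n) ℝ
  B₁ : ℝ → Matrix (Fin n) (Fin m) ℝ
  C₁ : ℝ → Matrix (Fin n) (Fin m) ℝ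
  D₁ : ℝ → Matrix (Fin n) (Fin k) ℝ
  A₂ : ℝ → Matrix (Fin n) (Fin n) ℝ
  B₂ : ℝ → Matrix (Fin n) (Fin m) ℝ
  C₂ : ℝ → Matrix (Fin n) (Fin m) ℝ
  D₂ : ℝ → Matrix (Fin n) (Fin k) ℝ
  A₃ : ℝ → Matrix (Fin m) (Fin n) ℝ
  B₃ : ℝ → Matrix (Fin m) (Fin m) ℝ
  C₃ : ℝ → Matrix (Fin m) (Fin m) ℝ
  D₃ : ℝ → Matrix (Fin m) (Fin k) ℝ
  A₄ : ℝ → Matrix (Fin n) (Fin n) ℝ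
  B₄ : ℝ → Matrix (Fin m) (Fin m) ℝ
  C₄ : ℝ → Matrix (Fin m) (Fin m) ℝ
  D₄ : ℝ → Matrix (Fin k) (Fin k) ℝ
  F : Matrix (Fin m) (Fin n) ℝ
  G : Matrix (Fin n) (Fin n) ℝ
  H : Matrix (Fin m) (Fin m) ℝ

namespace Data

open Matrix

variable {n m k : ℕ} (d : Data n m k)

/-! ### Standing assumptions on the data -/

/-- All coefficients belong to `L^∞(0,T)` and the weights are symmetric. -/
structure Bounded (T : ℝ) : Prop where
  A₁ : MemLInf T d.A₁
  B₁ : MemLInf T d.B₁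
  C₁ : MemLInf T d.C₁
  D₁ : MemLInf T d.D₁
  A₂ : MemLInf T d.A₂
  B₂ : MemLInf T d.B₂
  C₂ : MemLInf T d.C₂
  D₂ : MemLInf T d.D₂
  A₃ : MemLInf T d.A₃
  B₃ : MemLInf T d.B₃
  C₃ : MemLInf T d.C₃
  D₃ : MemLInf T d.D₃
  A₄ : MemLInf T d.A₄
  B₄ : MemLInf T d.B₄
  C₄ : MemLInf T d.C₄
  D₄ : MemLInf T d.D₄
  A₄_symm : ∀ᵐ t ∂(volume.restrict (Set.Icc 0 T)), (d.A₄ t).IsSymm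
  B₄_symm : ∀ᵐ t ∂(volume.restrict (Set.Icc 0 T)), (d.B₄ t).IsSymm
  C₄_symm : ∀ᵐ t ∂(volume.restrict (Set.Icc 0 T)), (d.C₄ t).IsSymm
  D₄_symm : ∀ᵐ t ∂(volume.restrict (Set.Icc 0 T)), (d.D₄ t).IsSymm
  G_symm : d.G.IsSymm
  H_symm : d.H.IsSymm

/-- Positivity of the weights `A₄, B₄, G, H`. -/
structure StateWeightsPos (T : ℝ) : Prop where
  A₄ : ∀ᵐ t ∂(volume.restrict (Set.Icc 0 T)), (d.A₄ t).PosSemidef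
  B₄ : ∀ᵐ t ∂(volume.restrict (Set.Icc 0 T)), (d.B₄ t).PosSemidef
  G : d.G.PosDef
  H : d.H.PosSemidef

/-- Positivity of the weights `C₄, D₄`; the inverse of `D₄` is essentially bounded. -/
structure ControlWeightsPos (T : ℝ) : Prop where
  C₄ : ∀ᵐ t ∂(volume.restrict (Set.Icc 0 T)), (d.C₄ t).PosSemidef
  D₄ : ∀ᵐ t ∂(volume.restrict (Set.Icc 0 T)), (d.D₄ t).PosDef
  D₄_inv : MemLInf T (fun t => (d.D₄ t)⁻¹)

/-! ### The matrix equation for `Q`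

The prefix `t` of a name stands for the tilde; indices are `Fin n ⊕ Fin m`. -/

noncomputable def tA₁ (t : ℝ) : Matrix (Fin n ⊕ Fin m) (Fin n ⊕ Fin m) ℝ :=
  fromBlocks (d.A₁ t) (-(d.D₁ t * (d.D₄ t)⁻¹ * (d.D₃ t)ᵀ))
    0 (d.B₃ t)ᵀ

noncomputable def tB₁ (t : ℝ) : Matrix (Fin n ⊕ Fin m) (Fin n ⊕ Fin m) ℝ :=
  fromBlocks (-(d.D₁ t * (d.D₄ t)⁻¹ * (d.D₁ t)ᵀ)) (d.B₁ t)
    (d.B₁ t)ᵀ (d.B₄ t)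

noncomputable def tC₁ (t : ℝ) : Matrix (Fin n ⊕ Fin m) (Fin n ⊕ Fin m) ℝ :=
  fromBlocks (-(d.D₁ t * (d.D₄ t)⁻¹ * (d.D₂ t)ᵀ)) (d.C₁ t)
    (d.B₂ t)ᵀ 0

noncomputable def tA₂ (t : ℝ) : Matrix (Fin n ⊕ Fin m) (Fin n ⊕ Fin m) ℝ :=
  fromBlocks (d.A₂ t) (-(d.D₂ t * (d.D₄ t)⁻¹ * (d.D₃ t)ᵀ))
    0 (d.C₃ t)ᵀ

noncomputable def tB₂ (t : ℝ) : Matrix (Fin n ⊕ Fin m) (Fin n ⊕ Fin m) ℝ :=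
  fromBlocks (-(d.D₂ t * (d.D₄ t)⁻¹ * (d.D₁ t)ᵀ)) (d.B₂ t)
    (d.C₁ t)ᵀ 0

noncomputable def tC₂ (t : ℝ) : Matrix (Fin n ⊕ Fin m) (Fin n ⊕ Fin m) ℝ :=
  fromBlocks (-(d.D₂ t * (d.D₄ t)⁻¹ * (d.D₂ t)ᵀ)) (d.C₂ t)
    (d.C₂ t)ᵀ (d.C₄ t)

noncomputable def tA₃ (t : ℝ) : Matrix (Fin n ⊕ Fin m) (Fin n ⊕ Fin m) ℝ :=
  fromBlocks (d.A₄ t) (d.A₃ t)ᵀ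
    (d.A₃ t) (-(d.D₃ t * (d.D₄ t)⁻¹ * (d.D₃ t)ᵀ))

noncomputable def tB₃ (t : ℝ) : Matrix (Fin n ⊕ Fin m) (Fin n ⊕ Fin m) ℝ :=
  fromBlocks (d.A₁ t)ᵀ 0
    (-(d.D₃ t * (d.D₄ t)⁻¹ * (d.D₁ t)ᵀ)) (d.B₃ t)

noncomputable def tC₃ (t : ℝ) : Matrix (Fin n ⊕ Fin m) (Fin n ⊕ Fin m) ℝ :=
  fromBlocks (d.A₂ t)ᵀ 0
    (-(d.D₃ t * (d.D₄ t)⁻¹ * (d.D₂ t)ᵀ)) (d.C₃ t)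

def tF : Matrix (Fin n ⊕ Fin m) (Fin n ⊕ Fin m) ℝ :=
  fromBlocks d.G d.Fᵀ d.F 0

/-- `K = (I - Q C̃₂)⁻¹ (Q Ã₂ + Q B̃₂ Q)`, for the value `Q` at time `t`. -/
noncomputable def K (t : ℝ) (Q : Matrix (Fin n ⊕ Fin m) (Fin n ⊕ Fin m) ℝ) :
    Matrix (Fin n ⊕ Fin m) (Fin n ⊕ Fin m) ℝ :=
  (1 - Q * d.tC₂ t)⁻¹ * (Q * d.tA₂ t + Q * d.tB₂ t * Q)

/-- The bracket on the right-hand side of `dQ = -[…] dt`. -/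
noncomputable def qRhs (t : ℝ) (Q : Matrix (Fin n ⊕ Fin m) (Fin n ⊕ Fin m) ℝ) :
    Matrix (Fin n ⊕ Fin m) (Fin n ⊕ Fin m) ℝ :=
  Q * d.tA₁ t + Q * d.tB₁ t * Q + Q * d.tC₁ t * d.K t Q
    + d.tA₃ t + d.tB₃ t * Q + d.tC₃ t * d.K t Q

/-- `Q` is a solution on `[0,T]` of `dQ = -[…] dt`, `Q(T) = F̃`. As the coefficients are only
measurable in time, this is the integrated equation, for a continuous `Q` along which the matrix
`I - Q C̃₂` inverted in `K` is invertible almost everywhere. -/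
structure IsQSolution (T : ℝ) (Q : ℝ → Matrix (Fin n ⊕ Fin m) (Fin n ⊕ Fin m) ℝ) : Prop where
  continuousOn : ContinuousOn Q (Set.Icc 0 T)
  isUnit : ∀ᵐ t ∂(volume.restrict (Set.Icc 0 T)), IsUnit (1 - Q t * d.tC₂ t)
  integrable : ∀ a b, IntervalIntegrable (fun s => d.qRhs s (Q s) a b) volume 0 T
  eqn : ∀ t ∈ Set.Icc 0 T, ∀ a b, Q t a b = d.tF a b + ∫ s in t..T, d.qRhs s (Q s) a b

/-! ### The auxiliary Riccati equations

The state is `(X, Y)`, of index `Fin n ⊕ Fin m`, and the control is `(u, Z)`, of index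
`Fin k ⊕ Fin m`. -/

def rA (t : ℝ) : Matrix (Fin n ⊕ Fin m) (Fin n ⊕ Fin m) ℝ :=
  fromBlocks (d.A₁ t) (d.B₁ t) (-(d.A₃ t)) (-(d.B₃ t))

def rB (t : ℝ) : Matrix (Fin n ⊕ Fin m) (Fin k ⊕ Fin m) ℝ :=
  fromBlocks (d.D₁ t) (d.C₁ t) (-(d.D₃ t)) (-(d.C₃ t))

def rC (t : ℝ) : Matrix (Fin n ⊕ Fin m) (Fin n ⊕ Fin m) ℝ :=
  fromBlocks (d.A₂ t) (d.B₂ t) 0 0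

def rD (t : ℝ) : Matrix (Fin n ⊕ Fin m) (Fin k ⊕ Fin m) ℝ :=
  fromBlocks (d.D₂ t) (d.C₂ t) 0 1

def rQ (t : ℝ) : Matrix (Fin n ⊕ Fin m) (Fin n ⊕ Fin m) ℝ :=
  fromBlocks (d.A₄ t) 0 0 (d.B₄ t)

def rR (t : ℝ) : Matrix (Fin k ⊕ Fin m) (Fin k ⊕ Fin m) ℝ :=
  fromBlocks (d.D₄ t) 0 0 (d.C₄ t)

/-- `M₁ = R̃ + D̃ᵀ P̃ D̃`. -/
def M₁ (t : ℝ) (P : Matrix (Fin n ⊕ Fin m) (Fin n ⊕ Fin m) ℝ) :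
    Matrix (Fin k ⊕ Fin m) (Fin k ⊕ Fin m) ℝ :=
  d.rR t + (d.rD t)ᵀ * P * d.rD t

/-- `M₂ = B̃ᵀ P̃ + D̃ᵀ P̃ C̃`. -/
def M₂ (t : ℝ) (P : Matrix (Fin n ⊕ Fin m) (Fin n ⊕ Fin m) ℝ) :
    Matrix (Fin k ⊕ Fin m) (Fin n ⊕ Fin m) ℝ :=
  (d.rB t)ᵀ * P + (d.rD t)ᵀ * P * d.rC t

/-- `P̃ Ã + Ãᵀ P̃ + C̃ᵀ P̃ C̃ + Q̃ - M₂ᵀ M₁⁻¹ M₂`. -/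
noncomputable def riccatiRhs (t : ℝ) (P : Matrix (Fin n ⊕ Fin m) (Fin n ⊕ Fin m) ℝ) :
    Matrix (Fin n ⊕ Fin m) (Fin n ⊕ Fin m) ℝ :=
  P * d.rA t + (d.rA t)ᵀ * P + (d.rC t)ᵀ * P * d.rC t + d.rQ t
    - (d.M₂ t P)ᵀ * (d.M₁ t P)⁻¹ * d.M₂ t P

/-- The penalized terminal value of the `i`-th Riccati equation. -/
def riccatiTerminal (i : ℕ) : Matrix (Fin n ⊕ Fin m) (Fin n ⊕ Fin m) ℝ :=
  fromBlocks (d.G + (i : ℝ) • (d.Fᵀ * d.F)) (-((i : ℝ) • d.Fᵀ))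
    (-((i : ℝ) • d.F)) ((i : ℝ) • (1 : Matrix (Fin m) (Fin m) ℝ))

/-- `P` is a positive definite solution on `[0,T]` of the `i`-th Riccati equation
`P' + (P Ã + Ãᵀ P + C̃ᵀ P C̃ + Q̃ - M₂ᵀ M₁⁻¹ M₂) = 0`, `M₁ > 0`, with the `i`-th terminal value
(in integrated form). -/
structure IsRiccatiSolution (T : ℝ) (i : ℕ)
    (P : ℝ → Matrix (Fin n ⊕ Fin m) (Fin n ⊕ Fin m) ℝ) : Prop where
  continuousOn : ContinuousOn P (Set.Icc 0 T)
  posDef : ∀ t ∈ Set.Icc 0 T, (P t).PosDef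
  M₁_posDef : ∀ᵐ t ∂(volume.restrict (Set.Icc 0 T)), (d.M₁ t (P t)).PosDef
  integrable : ∀ a b, IntervalIntegrable (fun s => d.riccatiRhs s (P s) a b) volume 0 T
  eqn : ∀ t ∈ Set.Icc 0 T, ∀ a b,
    P t a b = d.riccatiTerminal i a b + ∫ s in t..T, d.riccatiRhs s (P s) a b

end Data

open Matrix

section Transform

variable {n m : ℕ}

/-- `P₁ = P̃₁ - P̃₂ᵀ P̃₃⁻¹ P̃₂`, where `P̃ = [[P̃₁, P̃₂ᵀ], [P̃₂, P̃₃]]`. -/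
noncomputable def P₁ (P : Matrix (Fin n ⊕ Fin m) (Fin n ⊕ Fin m) ℝ) :
    Matrix (Fin n) (Fin n) ℝ :=
  P.toBlocks₁₁ - P.toBlocks₂₁ᵀ * P.toBlocks₂₂⁻¹ * P.toBlocks₂₁

/-- `P₂ = -P̃₃⁻¹ P̃₂`. -/
noncomputable def P₂ (P : Matrix (Fin n ⊕ Fin m) (Fin n ⊕ Fin m) ℝ) :
    Matrix (Fin m) (Fin n) ℝ :=
  -(P.toBlocks₂₂⁻¹ * P.toBlocks₂₁)

/-- `P₃ = P̃₃⁻¹`. -/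
noncomputable def P₃ (P : Matrix (Fin n ⊕ Fin m) (Fin n ⊕ Fin m) ℝ) :
    Matrix (Fin m) (Fin m) ℝ :=
  P.toBlocks₂₂⁻¹

end Transform

namespace Data

variable {n m k : ℕ} (d : Data n m k)

/-- `L₁ = I - P₂ C₂ + P₃ C₄`, with `P₂, P₃` obtained from the value `P = P̃(t)`. -/
noncomputable def L₁ (t : ℝ) (P : Matrix (Fin n ⊕ Fin m) (Fin n ⊕ Fin m) ℝ) :
    Matrix (Fin m) (Fin m) ℝ :=
  1 - P₂ P * d.C₂ t + P₃ P * d.C₄ t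

/-- `L₂ = I - P₂ᵀ C₂ᵀ + (P₁ C₂ + P₂ᵀ C₄) L₁⁻¹ P₃ C₂ᵀ`. -/
noncomputable def L₂ (t : ℝ) (P : Matrix (Fin n ⊕ Fin m) (Fin n ⊕ Fin m) ℝ) :
    Matrix (Fin n) (Fin n) ℝ :=
  1 - (P₂ P)ᵀ * (d.C₂ t)ᵀ
    + (P₁ P * d.C₂ t + (P₂ P)ᵀ * d.C₄ t) * (d.L₁ t P)⁻¹ * P₃ P * (d.C₂ t)ᵀ

/-- The uniform bounds on the approximations: there is a constant `c`, independent of `i ≥ 1` and of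
time, such that for the positive definite solution `P̃` of the `i`-th Riccati equation
`P₁,ᵢ ≤ c I`, `|P₂,ᵢ| ≤ c`, and `L₁,ᵢ, L₂,ᵢ` are invertible with inverses bounded by `c`.
Existence of `P̃` is not part of the condition. -/
def UniformBounds (T : ℝ) : Prop :=
  ∃ c : ℝ, ∀ i : ℕ, 1 ≤ i → ∀ P : ℝ → Matrix (Fin n ⊕ Fin m) (Fin n ⊕ Fin m) ℝ,
    d.IsRiccatiSolution T i P →
      (∀ t ∈ Set.Icc 0 T,
        (c • (1 : Matrix (Fin n) (Fin n) ℝ) - P₁ (P t)).PosSemidef ∧ matNorm (P₂ (P t)) ≤ c) ∧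
      (∀ᵐ t ∂(volume.restrict (Set.Icc 0 T)),
        IsUnit (d.L₁ t (P t)) ∧ matNorm (d.L₁ t (P t))⁻¹ ≤ c ∧
        IsUnit (d.L₂ t (P t)) ∧ matNorm (d.L₂ t (P t))⁻¹ ≤ c)

end Data

end FBLQ

/-!
The equation for `Q` is obtained from the auxiliary Riccati equations by a partial Legendre
transform, and its solution is the limit of the transformed Riccati solutions as the penalty `i`
tends to infinity.

*The Riccati equations are solvable.* The `i`-th one belongs to a linear quadratic problem with
state `(X, Y)` and control `(u, Z)`. The noise acts on `Y` through `Z` alone and `D₄` is uniformly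
positive; hence `p(t) = δ exp(-l (T - t))` times the identity is, for `l` large, a subsolution of
every Lyapunov equation that comes from a feedback control (`Data.lq_coercive`). Policy iteration
therefore gives a decreasing sequence that is bounded below by `p`, and its limit solves the
Riccati equation (`LQ.exists_riccati_solution`). As `δ` and `l` do not depend on `i`
(`exists_coercive_riccatiTerminal`), the bound `P̃ᵢ ≥ p` is uniform in `i` and makes `P₃,ᵢ =
P̃₃,ᵢ⁻¹` uniformly bounded.

*The transform.* If `(p, q) = P̃ (x, y)` then `(p, y) = Q (x, -q)` for `Q = [[P₁, P₂ᵀ], [P₂,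
-P₃]]` (`transformQ`). This exchange of variables turns the Riccati equation into the equation for
`Q` (`transform_riccatiRhs`, `isBackwardIntegral_transformQ`), with terminal value `[[G, Fᵀ], [F,
-1/i]]`.

*Uniform invertibility of `I - Q C̃₂`.* The part `C'` of `C̃₂` without `D₂` is handled by block
elimination, with pivot `L₁` and Schur complement `L₂`, whose inverses are bounded by assumption.
The first diagonal block `V` of the resulting `(I - Q C')⁻¹ Q` has a nonnegative quadratic form
(`gramBlock_nonneg`), so that `D₄ + D₂ᵀ V D₂` is coercive, and the Woodbury identity accounts for
the remaining term `D₂ D₄⁻¹ D₂ᵀ` (`fullInv_mul`).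

*Limit and uniqueness.* The approximations thus stay in a set on which the right-hand side of the
equation is bounded and Lipschitz (`unifLip_qRhs`). Gronwall's inequality makes them a Cauchy
sequence, and by dominated convergence the limit is a solution. A second solution has no a priori
bound on `(I - Q' C̃₂)⁻¹`, but has one while it is close to `Q`; Gronwall's inequality on
successive intervals of a fixed length shows that the two agree (`isQSolution_eqOn`).
-/

namespace FBLQ

open Set Filter Topology

/-! ### Essentially bounded functions and absolutely continuous integrals -/

section EssBdd

variable {E E' E'' : Type*} [NormedAddCommGroup E] [NormedAddCommGroup E'] [NormedAddCommGroup E'']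

/-- Lebesgue measure on the time interval `[0,T]`. -/
noncomputable abbrev timeMeasure (T : ℝ) : Measure ℝ := volume.restrict (Icc 0 T)

/-- `f` is strongly measurable and essentially bounded on `[0,T]`. -/
def EssBdd (T : ℝ) (f : ℝ → E) : Prop :=
  AEStronglyMeasurable f (timeMeasure T) ∧ ∃ C, ∀ᵐ t ∂(timeMeasure T), ‖f t‖ ≤ C

variable {T : ℝ}

theorem EssBdd.exists_bound {f : ℝ → E} (hf : EssBdd T f) :
    ∃ C, 0 ≤ C ∧ ∀ᵐ t ∂(timeMeasure T), ‖f t‖ ≤ C := by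
  obtain ⟨C, hC⟩ := hf.2
  exact ⟨max C 0, le_max_right _ _, hC.mono fun t h => h.trans (le_max_left _ _)⟩

theorem EssBdd.const (c : E) : EssBdd T fun _ => c :=
  ⟨aestronglyMeasurable_const, ‖c‖, by simp⟩

theorem EssBdd.of_continuousOn {f : ℝ → E} (hf : ContinuousOn f (Icc 0 T)) : EssBdd T f := by
  refine ⟨hf.aestronglyMeasurable measurableSet_Icc, ?_⟩
  obtain ⟨C, hC⟩ := isCompact_Icc.exists_bound_of_continuousOn hf
  exact ⟨C, (ae_restrict_iff' measurableSet_Icc).2 (.of_forall hC)⟩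

/-- A continuous map that is bounded on bounded sets preserves essential boundedness. -/
theorem EssBdd.comp {f : ℝ → E} (hf : EssBdd T f) {φ : E → E'} (hφ : Continuous φ)
    (hb : ∃ b : ℝ → ℝ, Monotone b ∧ ∀ x, ‖φ x‖ ≤ b ‖x‖) : EssBdd T fun t => φ (f t) := by
  obtain ⟨C, hC⟩ := hf.2
  obtain ⟨b, hb, h⟩ := hb
  exact ⟨hφ.comp_aestronglyMeasurable hf.1, b C, hC.mono fun t ht => (h _).trans (hb ht)⟩

theorem EssBdd.comp₂ {f : ℝ → E} {g : ℝ → E'} (hf : EssBdd T f) (hg : EssBdd T g)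
    {φ : E → E' → E''} (hφ : Continuous fun p : E × E' => φ p.1 p.2) (c : ℝ)
    (hb : ∀ x y, ‖φ x y‖ ≤ c * ‖x‖ * ‖y‖) : EssBdd T fun t => φ (f t) (g t) := by
  obtain ⟨C, hC0, hC⟩ := hf.exists_bound
  obtain ⟨D, hD0, hD⟩ := hg.exists_bound
  refine ⟨hφ.comp_aestronglyMeasurable (hf.1.prodMk hg.1), |c| * C * D, ?_⟩
  filter_upwards [hC, hD] with t h1 h2
  refine (hb _ _).trans ?_
  have := le_abs_self c
  gcongr

theorem EssBdd.add {f g : ℝ → E} (hf : EssBdd T f) (hg : EssBdd T g) :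
    EssBdd T fun t => f t + g t := by
  obtain ⟨C, hC⟩ := hf.2
  obtain ⟨D, hD⟩ := hg.2
  refine ⟨hf.1.add hg.1, C + D, ?_⟩
  filter_upwards [hC, hD] with t h1 h2
  exact (norm_add_le _ _).trans (add_le_add h1 h2)

theorem EssBdd.neg {f : ℝ → E} (hf : EssBdd T f) : EssBdd T fun t => -f t := by
  obtain ⟨C, hC⟩ := hf.2
  exact ⟨hf.1.neg, C, by simpa using hC⟩

theorem EssBdd.sub {f g : ℝ → E} (hf : EssBdd T f) (hg : EssBdd T g) :
    EssBdd T fun t => f t - g t := by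
  simpa [sub_eq_add_neg] using hf.add hg.neg

theorem EssBdd.congr_ae {f g : ℝ → E} (hf : EssBdd T f) (h : f =ᵐ[timeMeasure T] g) :
    EssBdd T g := by
  obtain ⟨C, hC⟩ := hf.2
  refine ⟨hf.1.congr h, C, ?_⟩
  filter_upwards [h, hC] with t h1 h2
  rwa [← h1]

theorem EssBdd.integrable {f : ℝ → E} (hf : EssBdd T f) : Integrable f (timeMeasure T) := by
  obtain ⟨C, hC⟩ := hf.2
  exact Integrable.of_bound hf.1 C hC

theorem EssBdd.intervalIntegrable {f : ℝ → E} (hf : EssBdd T f) {a b : ℝ} (ha : a ∈ Icc 0 T)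
    (hb : b ∈ Icc 0 T) : IntervalIntegrable f volume a b :=
  IntegrableOn.intervalIntegrable
    (IntegrableOn.mono_set hf.integrable (uIcc_subset_Icc ha hb))

theorem ae_of_ae_timeMeasure {p : ℝ → Prop} (h : ∀ᵐ t ∂(timeMeasure T), p t) {a b : ℝ}
    (ha : a ∈ Icc 0 T) (hb : b ∈ Icc 0 T) : ∀ᵐ t, t ∈ uIoc a b → p t := by
  filter_upwards [(ae_restrict_iff' measurableSet_Icc).1 h] with t ht h'
  exact ht (uIcc_subset_Icc ha hb (uIoc_subset_uIcc h'))

theorem ae_timeMeasure_mem_Icc : ∀ᵐ t ∂(timeMeasure T), t ∈ Icc 0 T :=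
  ae_restrict_mem measurableSet_Icc

theorem ae_timeMeasure_mem_Ioo : ∀ᵐ t ∂(timeMeasure T), t ∈ Ioo 0 T := by
  rw [timeMeasure, ← restrict_Ioo_eq_restrict_Icc]
  exact ae_restrict_mem measurableSet_Ioo

variable [NormedSpace ℝ E]

/-- `P(t) = P(T) + ∫ₜᵀ g` on `[0,T]` with an essentially bounded `g`; that is, `P` is Lipschitz
and solves `P' = -g`. -/
structure IsBackwardIntegral (T : ℝ) (P g : ℝ → E) : Prop where
  essBdd : EssBdd T g
  eqn : ∀ t ∈ Icc 0 T, P t = P T + ∫ s in t..T, g s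

variable {P g : ℝ → E}

theorem IsBackwardIntegral.sub_eq (h : IsBackwardIntegral T P g) (hT : 0 ≤ T) {s t : ℝ}
    (hs : s ∈ Icc 0 T) (ht : t ∈ Icc 0 T) : P s - P t = ∫ r in s..t, g r := by
  have hTm : T ∈ Icc 0 T := ⟨hT, le_rfl⟩
  rw [h.eqn s hs, h.eqn t ht, add_sub_add_left_eq_sub, sub_eq_iff_eq_add,
    intervalIntegral.integral_add_adjacent_intervals (h.essBdd.intervalIntegrable hs ht)
      (h.essBdd.intervalIntegrable ht hTm)]

theorem IsBackwardIntegral.exists_lipschitz (h : IsBackwardIntegral T P g) (hT : 0 ≤ T) :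
    ∃ K, LipschitzOnWith K P (Icc 0 T) := by
  obtain ⟨C, hC0, hC⟩ := h.essBdd.exists_bound
  refine ⟨C.toNNReal, LipschitzOnWith.of_dist_le_mul fun s hs t ht => ?_⟩
  rw [dist_eq_norm, h.sub_eq hT hs ht, Real.coe_toNNReal _ hC0, Real.dist_eq, abs_sub_comm]
  exact intervalIntegral.norm_integral_le_of_norm_le_const_ae (ae_of_ae_timeMeasure hC hs ht)

theorem IsBackwardIntegral.continuousOn (h : IsBackwardIntegral T P g) (hT : 0 ≤ T) :
    ContinuousOn P (Icc 0 T) :=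
  (h.exists_lipschitz hT).choose_spec.continuousOn

theorem IsBackwardIntegral.ae_hasDerivAt [CompleteSpace E] (h : IsBackwardIntegral T P g)
    (hT : 0 ≤ T) : ∀ᵐ t ∂(timeMeasure T), HasDerivAt P (-g t) t := by
  have hTm : T ∈ Icc 0 T := ⟨hT, le_rfl⟩
  have h0 : (0 : ℝ) ∈ Icc 0 T := ⟨le_rfl, hT⟩
  have := (h.essBdd.intervalIntegrable h0 hTm).ae_hasDerivAt_integral
  filter_upwards [ae_restrict_of_ae this, ae_timeMeasure_mem_Ioo] with t ht htm
  rw [uIcc_of_le hT] at ht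
  have h1 := ((ht (Ioo_subset_Icc_self htm) T hTm).const_sub (P T))
  refine h1.congr_of_eventuallyEq ?_
  filter_upwards [Ioo_mem_nhds htm.1 htm.2] with s hs
  rw [h.eqn s (Ioo_subset_Icc_self hs), intervalIntegral.integral_symm, ← sub_eq_add_neg]

/-- A Lipschitz function is recovered from its almost everywhere derivative. -/
theorem IsBackwardIntegral.of_ae_hasDerivAt [CompleteSpace E] (hT : 0 ≤ T) {K : NNReal}
    (hP : LipschitzOnWith K P (Icc 0 T)) (hg : EssBdd T g)
    (hd : ∀ᵐ t ∂(timeMeasure T), HasDerivAt P (-g t) t) : IsBackwardIntegral T P g := by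
  have hTm : T ∈ Icc 0 T := ⟨hT, le_rfl⟩
  refine ⟨hg, ?_⟩
  have hI : IsBackwardIntegral T (fun t => ∫ s in t..T, g s) g := ⟨hg, fun t _ => by simp⟩
  obtain ⟨K', hK'⟩ := hI.exists_lipschitz hT
  have hac := (uIcc_of_le hT ▸ hP : LipschitzOnWith K P (uIcc 0 T)).absolutelyContinuousOnInterval
  have hac' := (uIcc_of_le hT ▸ hK' :
    LipschitzOnWith K' _ (uIcc 0 T)).absolutelyContinuousOnInterval
  obtain ⟨C, hC⟩ := (hac.sub hac').const_of_ae_hasDerivAt_zero (by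
    have h2 := hI.ae_hasDerivAt hT
    rw [uIcc_of_le hT]
    filter_upwards [(ae_restrict_iff' measurableSet_Icc).1 hd,
      (ae_restrict_iff' measurableSet_Icc).1 h2] with t h1 h2 ht
    simpa using (h1 ht).sub (h2 ht))
  rw [uIcc_of_le hT] at hC
  intro t ht
  have e1 := hC t ht
  have e2 := hC T hTm
  simp only [Pi.sub_apply, intervalIntegral.integral_same, sub_zero] at e1 e2
  rw [e2, ← e1, sub_add_cancel]

theorem IsBackwardIntegral.congr_ae {g' : ℝ → E} (h : IsBackwardIntegral T P g) (hT : 0 ≤ T)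
    (hg : g =ᵐ[timeMeasure T] g') : IsBackwardIntegral T P g' := by
  refine ⟨h.essBdd.congr_ae hg, fun t ht => ?_⟩
  rw [h.eqn t ht]
  congr 1
  exact intervalIntegral.integral_congr_ae (ae_of_ae_timeMeasure hg ht ⟨hT, le_rfl⟩)

theorem IsBackwardIntegral.sub {P' g' : ℝ → E} (h : IsBackwardIntegral T P g)
    (h' : IsBackwardIntegral T P' g') (hT : 0 ≤ T) :
    IsBackwardIntegral T (fun t => P t - P' t) (fun t => g t - g' t) := by
  refine ⟨h.essBdd.sub h'.essBdd, fun t ht => ?_⟩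
  have hTm : T ∈ Icc 0 T := ⟨hT, le_rfl⟩
  rw [h.eqn t ht, h'.eqn t ht, intervalIntegral.integral_sub
    (h.essBdd.intervalIntegrable ht hTm) (h'.essBdd.intervalIntegrable ht hTm)]
  abel

/-- Dominated convergence for backward integrals. -/
theorem IsBackwardIntegral.of_tendsto {Pk gk : ℕ → ℝ → E} (hT : 0 ≤ T)
    (h : ∀ k, IsBackwardIntegral T (Pk k) (gk k)) {C : ℝ}
    (hC : ∀ k, ∀ᵐ t ∂(timeMeasure T), ‖gk k t‖ ≤ C)
    (hP : ∀ t ∈ Icc 0 T, Tendsto (fun k => Pk k t) atTop (𝓝 (P t)))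
    (hg : ∀ᵐ t ∂(timeMeasure T), Tendsto (fun k => gk k t) atTop (𝓝 (g t))) :
    IsBackwardIntegral T P g := by
  have hTm : T ∈ Icc 0 T := ⟨hT, le_rfl⟩
  have hgb : ∀ᵐ t ∂(timeMeasure T), ‖g t‖ ≤ C := by
    filter_upwards [hg, ae_all_iff.2 hC] with t h1 h2
    exact le_of_tendsto h1.norm (.of_forall h2)
  refine ⟨⟨aestronglyMeasurable_of_tendsto_ae _ (fun k => (h k).essBdd.1) hg, C, hgb⟩,
    fun t ht => ?_⟩
  refine tendsto_nhds_unique (hP t ht) ?_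
  have h1 : Tendsto (fun k => ∫ s in t..T, gk k s) atTop (𝓝 (∫ s in t..T, g s)) := by
    refine intervalIntegral.tendsto_integral_filter_of_dominated_convergence (fun _ => C)
      (.of_forall fun k => ((h k).essBdd.intervalIntegrable ht hTm).def'.1)
      (.of_forall fun k => ae_of_ae_timeMeasure (hC k) ht hTm) (by simp)
      (ae_of_ae_timeMeasure hg ht hTm)
  exact ((hP T hTm).add h1).congr fun k => ((h k).eqn t ht).symm

end EssBdd

/-! ### Gronwall's inequality and linear equations -/

/-- Gronwall's inequality in integral form, backward in time. -/
theorem le_mul_exp_of_le_add_integral {a b δ K : ℝ} {u : ℝ → ℝ} (hK : 0 ≤ K)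
    (hu : ContinuousOn u (Icc a b))
    (h : ∀ t ∈ Icc a b, u t ≤ δ + K * ∫ s in t..b, u s) :
    ∀ t ∈ Icc a b, u t ≤ δ * Real.exp (K * (b - t)) := by
  intro t ht
  have hab : a ≤ b := ht.1.trans ht.2
  set v := IccExtend hab ((Icc a b).domRestrict u) with hv
  have hvc : Continuous v := (continuousOn_iff_continuous_domRestrict.1 hu).Icc_extend'
  have hvu : ∀ s ∈ Icc a b, v s = u s := fun s hs => by
    rw [hv, IccExtend_of_mem _ _ hs]; rfl
  have hvi : ∀ s ∈ Icc a b, ∫ r in s..b, u r = ∫ r in s..b, v r := fun s hs =>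
    intervalIntegral.integral_congr fun r hr => (hvu r (by
      rw [uIcc_of_le hs.2] at hr; exact ⟨hs.1.trans hr.1, hr.2⟩)).symm
  set W : ℝ → ℝ := fun s => (δ + K * ∫ r in s..b, v r) * Real.exp (K * s) with hW
  have hd : ∀ s, HasDerivAt W (K * Real.exp (K * s) * (δ + K * (∫ r in s..b, v r) - v s)) s := by
    intro s
    have h1 : HasDerivAt (fun s => ∫ r in s..b, v r) (-v s) s :=
      intervalIntegral.integral_hasDerivAt_left (hvc.intervalIntegrable _ _)
        (hvc.stronglyMeasurableAtFilter _ _) hvc.continuousAt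
    have h2 : HasDerivAt (fun s => Real.exp (K * s)) (Real.exp (K * s) * (K * 1)) s :=
      ((hasDerivAt_id s).const_mul K).exp
    refine (((h1.const_mul K).const_add δ).mul h2).congr_deriv ?_
    ring
  have hmono : MonotoneOn W (Icc a b) := by
    refine monotoneOn_of_deriv_nonneg (convex_Icc a b)
      (fun s _ => (hd s).continuousAt.continuousWithinAt)
      (fun s _ => (hd s).differentiableAt.differentiableWithinAt) fun s hs => ?_
    rw [interior_Icc] at hs
    have hs' := Ioo_subset_Icc_self hs
    rw [(hd s).deriv]
    have := h s hs'
    rw [hvi s hs', ← hvu s hs'] at this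
    have : 0 ≤ δ + K * (∫ r in s..b, v r) - v s := by linarith
    positivity
  have h1 := hmono ht ⟨hab, le_rfl⟩ ht.2
  simp only [hW, intervalIntegral.integral_same, mul_zero, add_zero] at h1
  have h2 := h t ht
  rw [hvi t ht] at h2
  have h3 : Real.exp (K * (b - t)) = Real.exp (K * b) * Real.exp (-(K * t)) := by
    rw [← Real.exp_add]; ring_nf
  have h4 : Real.exp (K * t) * Real.exp (-(K * t)) = 1 := by rw [← Real.exp_add]; simp
  calc u t ≤ (δ + K * ∫ r in t..b, v r) * (Real.exp (K * t) * Real.exp (-(K * t))) := by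
        rw [h4, mul_one]; exact h2
    _ = ((δ + K * ∫ r in t..b, v r) * Real.exp (K * t)) * Real.exp (-(K * t)) := by ring
    _ ≤ δ * Real.exp (K * b) * Real.exp (-(K * t)) := by gcongr
    _ = _ := by rw [h3]; ring

/-- Carathéodory's existence theorem, backward in time: for a right-hand side that is measurable in
time and globally Lipschitz in the state, `P' = -F(t, P)`, `P(T) = x` has a solution on `[0,T]`. -/
theorem exists_isBackwardIntegral {E : Type*} [NormedAddCommGroup E] [NormedSpace ℝ E]
    [CompleteSpace E] {T : ℝ} (hT : 0 ≤ T) {F : ℝ → E → E} {K C : ℝ} (hK : 0 ≤ K)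
    (hmeas : ∀ x : ℝ → E, ContinuousOn x (Icc 0 T) →
      AEStronglyMeasurable (fun s => F s (x s)) (timeMeasure T))
    (hlip : ∀ᵐ s ∂(timeMeasure T), ∀ x y, ‖F s x - F s y‖ ≤ K * ‖x - y‖)
    (hzero : ∀ᵐ s ∂(timeMeasure T), ‖F s 0‖ ≤ C) (x : E) :
    ∃ P : ℝ → E, P T = x ∧ IsBackwardIntegral T P fun s => F s (P s) := by
  have hTm : T ∈ Icc 0 T := ⟨hT, le_rfl⟩
  -- The substitution `P(t) = exp (L (T - t)) y(t)` turns the Picard map into a contraction.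
  set L : ℝ := 2 * K + 1 with hL
  have hL0 : 0 < L := by positivity
  let X : C(Icc 0 T, E) → ℝ → E := fun y s => Real.exp (L * (T - s)) • IccExtend hT y s
  have hX : ∀ y, Continuous (X y) := fun y =>
    (by fun_prop : Continuous fun s => Real.exp (L * (T - s))).smul y.continuous.Icc_extend'
  have hg : ∀ y, EssBdd T fun s => F s (X y s) := by
    intro y
    obtain ⟨-, D, hD⟩ := EssBdd.of_continuousOn (T := T) (hX y).continuousOn
    refine ⟨hmeas _ (hX y).continuousOn, K * D + C, ?_⟩
    filter_upwards [hlip, hzero, hD] with s h1 h2 h3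
    have h4 := h1 (X y s) 0
    rw [sub_zero] at h4
    calc ‖F s (X y s)‖ = ‖(F s (X y s) - F s 0) + F s 0‖ := by rw [sub_add_cancel]
      _ ≤ K * ‖X y s‖ + C := (norm_add_le _ _).trans (add_le_add h4 h2)
      _ ≤ _ := by gcongr
  let I : C(Icc 0 T, E) → ℝ → E := fun y t => x + ∫ s in t..T, F s (X y s)
  have hI : ∀ y, IsBackwardIntegral T (I y) fun s => F s (X y s) := fun y =>
    ⟨hg y, fun t _ => by simp [I]⟩
  let Φ : C(Icc 0 T, E) → C(Icc 0 T, E) := fun y =>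
    ⟨fun t => Real.exp (-(L * (T - t))) • I y t,
      (by fun_prop : Continuous fun t : Icc 0 T => Real.exp (-(L * (T - t)))).smul
        (continuousOn_iff_continuous_domRestrict.1 ((hI y).continuousOn hT))⟩
  have hint : ∀ t, ∫ s in t..T, Real.exp (L * (T - s)) = (Real.exp (L * (T - t)) - 1) / L := by
    intro t
    have hd : ∀ s ∈ uIcc t T, HasDerivAt (fun s => -(Real.exp (L * (T - s)) / L))
        (Real.exp (L * (T - s))) s := by
      intro s _
      refine (((((hasDerivAt_id s).const_sub T).const_mul L).exp.div_const L).neg).congr_deriv ?_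
      field_simp
      simp
    rw [intervalIntegral.integral_eq_sub_of_hasDerivAt hd
      (Continuous.intervalIntegrable (by fun_prop) _ _)]
    simp
    ring
  have hΦ : ContractingWith (1 / 2) Φ := by
    refine ⟨by norm_num, LipschitzWith.of_dist_le_mul fun y z => ?_⟩
    refine (ContinuousMap.dist_le (by positivity)).2 fun t => ?_
    have hb : ‖∫ s in (t : ℝ)..T, (F s (X y s) - F s (X z s))‖ ≤
        ∫ s in (t : ℝ)..T, K * dist y z * Real.exp (L * (T - s)) := by
      refine intervalIntegral.norm_integral_le_of_norm_le t.2.2 ?_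
        ((by fun_prop : Continuous fun s => K * dist y z *
          Real.exp (L * (T - s))).intervalIntegrable _ _)
      have := ae_of_ae_timeMeasure hlip t.2 hTm
      rw [uIoc_of_le t.2.2] at this
      filter_upwards [this] with s hs hsm
      refine (hs hsm _ _).trans ?_
      have hsI : s ∈ Icc 0 T := ⟨t.2.1.trans hsm.1.le, hsm.2⟩
      have h1 : ‖X y s - X z s‖ ≤ Real.exp (L * (T - s)) * dist y z := by
        simp only [X]
        rw [← smul_sub, norm_smul, Real.norm_of_nonneg (Real.exp_nonneg _),
          IccExtend_of_mem _ _ hsI, IccExtend_of_mem _ _ hsI, ← dist_eq_norm]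
        gcongr
        exact ContinuousMap.dist_apply_le_dist _
      calc K * ‖X y s - X z s‖ ≤ K * (Real.exp (L * (T - s)) * dist y z) := by gcongr
        _ = _ := by ring
    have he : dist (Φ y t) (Φ z t) = Real.exp (-(L * (T - t))) *
        ‖∫ s in (t : ℝ)..T, (F s (X y s) - F s (X z s))‖ := by
      rw [dist_eq_norm, intervalIntegral.integral_sub ((hg y).intervalIntegrable t.2 hTm)
        ((hg z).intervalIntegrable t.2 hTm)]
      change ‖Real.exp (-(L * (T - t))) • I y t - Real.exp (-(L * (T - t))) • I z t‖ = _
      rw [← smul_sub, norm_smul, Real.norm_of_nonneg (Real.exp_nonneg _)]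
      simp [I]
    rw [he]
    refine (mul_le_mul_of_nonneg_left hb (Real.exp_nonneg _)).trans ?_
    rw [intervalIntegral.integral_const_mul, hint]
    have h1 : Real.exp (-(L * (T - t))) * Real.exp (L * (T - t)) = 1 := by
      rw [← Real.exp_add]; simp
    have h2 := Real.exp_nonneg (-(L * (T - t)))
    have h3 : K / L ≤ 1 / 2 := by rw [div_le_iff₀ hL0]; linarith
    calc _ = K / L * dist y z * (Real.exp (-(L * (T - t))) * Real.exp (L * (T - t))
            - Real.exp (-(L * (T - t)))) := by ring
      _ ≤ 1 / 2 * dist y z * 1 := by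
          rw [h1]
          gcongr
          · have : 0 ≤ T - t := sub_nonneg.2 t.2.2
            have : Real.exp (-(L * (T - t))) ≤ 1 := Real.exp_le_one_iff.2 (by nlinarith)
            linarith
          · linarith
      _ = _ := by simp
  have hfix : Φ (ContractingWith.fixedPoint Φ hΦ) = _ := hΦ.fixedPoint_isFixedPt
  set y := ContractingWith.fixedPoint Φ hΦ
  have hy : ∀ t ∈ Icc 0 T, X y t = I y t := by
    intro t ht
    have h1 : y ⟨t, ht⟩ = Real.exp (-(L * (T - t))) • I y t := by
      conv_lhs => rw [← hfix]
      rfl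
    simp only [X]
    rw [IccExtend_of_mem _ _ ht, h1, smul_smul, ← Real.exp_add]
    simp
  refine ⟨X y, (hy T hTm).trans (by simp [I]), hg y, fun t ht => ?_⟩
  rw [hy t ht, hy T hTm]
  simp [I]

open Matrix
open scoped Matrix.Norms.Operator

/-! ### Real matrices: norms, inverses and positivity -/

section Matrix

variable {ι κ : Type*} [Fintype ι] [Fintype κ]

theorem abs_apply_le_norm (M : Matrix ι κ ℝ) (a : ι) (b : κ) : |M a b| ≤ ‖M‖ := by
  rw [linfty_opNorm_def]
  have h1 : ‖M a b‖₊ ≤ ∑ j, ‖M a j‖₊ :=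
    Finset.single_le_sum (f := fun j => ‖M a j‖₊) (fun _ _ => zero_le) (Finset.mem_univ b)
  have h2 := h1.trans (Finset.le_sup (f := fun i => ∑ j, ‖M i j‖₊) (Finset.mem_univ a))
  exact_mod_cast h2

theorem norm_le_of_abs_apply_le {M : Matrix ι κ ℝ} {c : ℝ} (hc : 0 ≤ c)
    (h : ∀ a b, |M a b| ≤ c) : ‖M‖ ≤ Fintype.card κ * c := by
  lift c to NNReal using hc
  rw [linfty_opNorm_def]
  have : (Finset.univ.sup fun i => ∑ j, ‖M i j‖₊) ≤ Fintype.card κ * c := by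
    refine Finset.sup_le fun i _ => ?_
    calc ∑ j, ‖M i j‖₊ ≤ ∑ _j : κ, c := Finset.sum_le_sum fun j _ => by exact_mod_cast h i j
      _ = _ := by simp
  exact_mod_cast this

theorem abs_dotProduct_le (x y : ι → ℝ) : |x ⬝ᵥ y| ≤ Fintype.card ι * (‖x‖ * ‖y‖) := by
  calc |x ⬝ᵥ y| ≤ ∑ i, |x i * y i| := Finset.abs_sum_le_sum_abs _ _
    _ ≤ ∑ _i : ι, ‖x‖ * ‖y‖ := Finset.sum_le_sum fun i _ => by
        rw [abs_mul]
        exact mul_le_mul (norm_le_pi_norm x i) (norm_le_pi_norm y i) (abs_nonneg _) (norm_nonneg _)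
    _ = _ := by simp

theorem dotProduct_self_nonneg' (x : ι → ℝ) : 0 ≤ x ⬝ᵥ x :=
  Finset.sum_nonneg fun _ _ => mul_self_nonneg _

theorem sq_norm_le_dotProduct_self (x : ι → ℝ) : ‖x‖ ^ 2 ≤ x ⬝ᵥ x := by
  have h0 := dotProduct_self_nonneg' x
  rw [← Real.le_sqrt (norm_nonneg _) h0]
  refine (pi_norm_le_iff_of_nonneg (Real.sqrt_nonneg _)).2 fun i => Real.le_sqrt_of_sq_le ?_
  rw [Real.norm_eq_abs, sq_abs, sq]
  exact Finset.single_le_sum (f := fun j => x j * x j) (fun _ _ => mul_self_nonneg _)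
    (Finset.mem_univ i)

theorem abs_dotProduct_mulVec_le (M : Matrix ι κ ℝ) (x : ι → ℝ) (y : κ → ℝ) :
    |x ⬝ᵥ M *ᵥ y| ≤ Fintype.card ι * (‖M‖ * (‖x‖ * ‖y‖)) := by
  refine (abs_dotProduct_le _ _).trans ?_
  have := linfty_opNorm_mulVec M y
  calc _ ≤ Fintype.card ι * (‖x‖ * (‖M‖ * ‖y‖)) := by gcongr
    _ = _ := by ring

theorem abs_dotProduct_mulVec_self_le (M : Matrix ι ι ℝ) (x : ι → ℝ) :
    |x ⬝ᵥ M *ᵥ x| ≤ Fintype.card ι * ‖M‖ * (x ⬝ᵥ x) := by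
  refine (abs_dotProduct_mulVec_le _ _ _).trans ?_
  have := sq_norm_le_dotProduct_self x
  calc _ = Fintype.card ι * ‖M‖ * ‖x‖ ^ 2 := by ring
    _ ≤ _ := by gcongr

theorem dotProduct_mulVec_transpose (M : Matrix ι κ ℝ) (x : κ → ℝ) (y : ι → ℝ) :
    x ⬝ᵥ Mᵀ *ᵥ y = (M *ᵥ x) ⬝ᵥ y := by
  rw [dotProduct_mulVec, vecMul_transpose]

theorem posSemidef_iff_real {M : Matrix ι ι ℝ} :
    M.PosSemidef ↔ Mᵀ = M ∧ ∀ x, 0 ≤ x ⬝ᵥ M *ᵥ x := by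
  rw [posSemidef_iff_dotProduct_mulVec]
  simp [IsHermitian, conjTranspose_eq_transpose_of_trivial]

theorem posDef_iff_real {M : Matrix ι ι ℝ} :
    M.PosDef ↔ Mᵀ = M ∧ ∀ x, x ≠ 0 → 0 < x ⬝ᵥ M *ᵥ x := by
  rw [posDef_iff_dotProduct_mulVec]
  simp [IsHermitian, conjTranspose_eq_transpose_of_trivial]

theorem norm_le_of_norm_mulVec_le {M : Matrix ι κ ℝ} {C : ℝ} (hC : 0 ≤ C)
    (h : ∀ x, ‖M *ᵥ x‖ ≤ C * ‖x‖) : ‖M‖ ≤ C := by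
  rw [linfty_opNorm_eq_opNorm]
  exact ContinuousLinearMap.opNorm_le_bound _ hC h

variable [DecidableEq ι]

/-- A matrix that is bounded below is invertible, with the corresponding bound on its inverse. -/
theorem isUnit_and_norm_inv_le {M : Matrix ι ι ℝ} {C : ℝ} (hC : 0 ≤ C)
    (h : ∀ x, ‖x‖ ≤ C * ‖M *ᵥ x‖) : IsUnit M ∧ ‖M⁻¹‖ ≤ C := by
  have hu : IsUnit M := by
    rw [← mulVec_injective_iff_isUnit]
    intro x y hxy
    have h1 := h (x - y)
    rw [mulVec_sub, hxy, sub_self, norm_zero, mul_zero] at h1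
    exact sub_eq_zero.1 (norm_le_zero_iff.1 h1)
  refine ⟨hu, norm_le_of_norm_mulVec_le hC fun x => ?_⟩
  have h1 := h (M⁻¹ *ᵥ x)
  rwa [mulVec_mulVec, mul_nonsing_inv _ ((isUnit_iff_isUnit_det _).1 hu), one_mulVec] at h1

/-- The inverse of a matrix with a coercive quadratic form. -/
theorem isUnit_and_norm_inv_le_of_coercive {M : Matrix ι ι ℝ} {δ : ℝ} (hδ : 0 < δ)
    (h : ∀ x, δ * (x ⬝ᵥ x) ≤ x ⬝ᵥ M *ᵥ x) : IsUnit M ∧ ‖M⁻¹‖ ≤ Fintype.card ι / δ := by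
  refine isUnit_and_norm_inv_le (by positivity) fun x => ?_
  rcases (norm_nonneg x).eq_or_lt with h0 | h0
  · rw [← h0]; positivity
  have h1 := (abs_le.1 (abs_dotProduct_le x (M *ᵥ x))).2
  have h2 := sq_norm_le_dotProduct_self x
  have h3 : δ * ‖x‖ ^ 2 ≤ Fintype.card ι * (‖x‖ * ‖M *ᵥ x‖) := by
    have := h x
    have := mul_le_mul_of_nonneg_left h2 hδ.le
    linarith
  have h4 : ‖x‖ * (δ * ‖x‖) ≤ ‖x‖ * (Fintype.card ι * ‖M *ᵥ x‖) := by linarith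
  have h5 := le_of_mul_le_mul_left h4 h0
  rw [div_mul_eq_mul_div, le_div_iff₀ hδ]
  linarith

/-- A positive definite matrix is coercive, with a constant that depends only on a bound for the
quadratic form of its inverse. -/
theorem PosDef.coercive_of_inv_le {M : Matrix ι ι ℝ} (hM : M.PosDef) {β : ℝ} (hβ : 0 < β)
    (h : ∀ x, x ⬝ᵥ M⁻¹ *ᵥ x ≤ β * (x ⬝ᵥ x)) (x : ι → ℝ) :
    β⁻¹ * (x ⬝ᵥ x) ≤ x ⬝ᵥ M *ᵥ x := by
  have hdet := (isUnit_iff_isUnit_det _).1 hM.isUnit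
  obtain ⟨hs, hpos⟩ := posSemidef_iff_real.1 hM.inv.posSemidef
  -- Expand `0 ≤ ⟨Mx - x/β, M⁻¹(Mx - x/β)⟩`.
  have h1 := hpos (M *ᵥ x - β⁻¹ • x)
  have e1 : M⁻¹ *ᵥ (M *ᵥ x) = x := by
    rw [mulVec_mulVec, nonsing_inv_mul _ hdet, one_mulVec]
  have e2 : (M *ᵥ x) ⬝ᵥ M⁻¹ *ᵥ x = x ⬝ᵥ x := by
    conv_lhs => rw [← hs, dotProduct_mulVec_transpose, e1]
  simp only [mulVec_sub, mulVec_smul, e1, sub_dotProduct, dotProduct_sub, smul_dotProduct,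
    dotProduct_smul, smul_eq_mul, e2] at h1
  have e3 : (M *ᵥ x) ⬝ᵥ x = x ⬝ᵥ M *ᵥ x := dotProduct_comm _ _
  rw [e3] at h1
  have h2 := h x
  have h3 : β⁻¹ * (β⁻¹ * (x ⬝ᵥ M⁻¹ *ᵥ x)) ≤ β⁻¹ * (β⁻¹ * (β * (x ⬝ᵥ x))) := by gcongr
  have h4 : β⁻¹ * (β⁻¹ * (β * (x ⬝ᵥ x))) = β⁻¹ * (x ⬝ᵥ x) := by field_simp
  linarith

theorem PosDef.exists_coercive {M : Matrix ι ι ℝ} (hM : M.PosDef) :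
    ∃ δ > 0, ∀ x, δ * (x ⬝ᵥ x) ≤ x ⬝ᵥ M *ᵥ x := by
  refine ⟨(Fintype.card ι * ‖M⁻¹‖ + 1)⁻¹, by positivity,
    PosDef.coercive_of_inv_le hM (by positivity) fun x => ?_⟩
  have h1 := (abs_le.1 (abs_dotProduct_mulVec_self_le M⁻¹ x)).2
  have := dotProduct_self_nonneg' x
  linarith

theorem norm_le_of_posSemidef {M : Matrix ι ι ℝ} (hM : M.PosSemidef) {c : ℝ}
    (h : ∀ x, x ⬝ᵥ M *ᵥ x ≤ c * (x ⬝ᵥ x)) : ‖M‖ ≤ Fintype.card ι * |c| := by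
  obtain ⟨hs, hpos⟩ := posSemidef_iff_real.1 hM
  have hdiag : ∀ a, M a a ≤ |c| := fun a => by
    have := h (Pi.single a 1)
    simp at this
    exact this.trans (le_abs_self c)
  refine norm_le_of_abs_apply_le (abs_nonneg c) fun a b => ?_
  have hab : M b a = M a b := by conv_lhs => rw [← hs, transpose_apply]
  have h1 := hpos (Pi.single a 1 + Pi.single b 1)
  have h2 := hpos (Pi.single a 1 - Pi.single b 1)
  simp [mulVec_add, mulVec_sub, add_dotProduct, sub_dotProduct, hab] at h1 h2
  have := hdiag a
  have := hdiag b
  rw [abs_le]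
  constructor <;> linarith

end Matrix

section EssBddMatrix

variable {ι κ τ σ : Type*} [Fintype ι] [Fintype κ] [Fintype τ] [Fintype σ] {T : ℝ}

theorem EssBdd.apply {A : ℝ → Matrix ι κ ℝ} (hA : EssBdd T A) (a : ι) (b : κ) :
    EssBdd T fun t => A t a b :=
  hA.comp (φ := fun M => M a b) (by fun_prop) ⟨id, monotone_id, fun M => abs_apply_le_norm M a b⟩

theorem essBdd_iff_apply {A : ℝ → Matrix ι κ ℝ} :
    EssBdd T A ↔ ∀ a b, EssBdd T fun t => A t a b := by
  refine ⟨fun h => h.apply, fun h => ⟨?_, ?_⟩⟩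
  · have h1 : AEMeasurable (fun t => fun a b => A t a b) (timeMeasure T) :=
      aemeasurable_pi_lambda _ fun a => aemeasurable_pi_lambda _ fun b => (h a b).1.aemeasurable
    exact h1.aestronglyMeasurable
  · choose C hC0 hC using fun a b => (h a b).exists_bound
    refine ⟨Fintype.card κ * ∑ a, ∑ b, C a b, ?_⟩
    filter_upwards [ae_all_iff.2 fun a => ae_all_iff.2 fun b => hC a b] with t ht
    refine norm_le_of_abs_apply_le
      (Finset.sum_nonneg fun a _ => Finset.sum_nonneg fun b _ => hC0 a b) fun a b => ?_
    calc |A t a b| ≤ C a b := ht a b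
      _ ≤ ∑ b, C a b :=
        Finset.single_le_sum (f := fun b => C a b) (fun b _ => hC0 a b) (Finset.mem_univ b)
      _ ≤ _ := Finset.single_le_sum (f := fun a => ∑ b, C a b)
        (fun a _ => Finset.sum_nonneg fun b _ => hC0 a b) (Finset.mem_univ a)

theorem MemLInf.essBdd {A : ℝ → Matrix ι κ ℝ} (hA : MemLInf T A) : EssBdd T A :=
  essBdd_iff_apply.2 fun a b => by
    refine ⟨(hA a b).1, (eLpNorm (fun t => A t a b) ⊤ (timeMeasure T)).toReal, ?_⟩
    filter_upwards [ae_le_eLpNormEssSup (f := fun t => A t a b) (μ := timeMeasure T)] with t ht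
    rw [← toReal_enorm]
    exact ENNReal.toReal_mono (hA a b).2.ne (by rwa [eLpNorm_exponent_top])

theorem EssBdd.transpose {A : ℝ → Matrix ι κ ℝ} (hA : EssBdd T A) : EssBdd T fun t => (A t)ᵀ :=
  essBdd_iff_apply.2 fun a b => hA.apply b a

theorem EssBdd.mul {A : ℝ → Matrix ι κ ℝ} {B : ℝ → Matrix κ τ ℝ} (hA : EssBdd T A)
    (hB : EssBdd T B) : EssBdd T fun t => A t * B t :=
  hA.comp₂ hB (φ := fun M N => M * N) (by fun_prop) 1 fun M N => by
    simpa using linfty_opNorm_mul M N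

theorem EssBdd.fromBlocks {A : ℝ → Matrix ι τ ℝ} {B : ℝ → Matrix ι σ ℝ} {C : ℝ → Matrix κ τ ℝ}
    {D : ℝ → Matrix κ σ ℝ} (hA : EssBdd T A) (hB : EssBdd T B) (hC : EssBdd T C)
    (hD : EssBdd T D) : EssBdd T fun t => Matrix.fromBlocks (A t) (B t) (C t) (D t) := by
  refine essBdd_iff_apply.2 ?_
  rintro (a | a) (b | b)
  exacts [hA.apply a b, hB.apply a b, hC.apply a b, hD.apply a b]

theorem EssBdd.inv [DecidableEq ι] {A : ℝ → Matrix ι ι ℝ} (hA : EssBdd T A) {C : ℝ}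
    (hC : ∀ᵐ t ∂(timeMeasure T), ‖(A t)⁻¹‖ ≤ C) : EssBdd T fun t => (A t)⁻¹ := by
  refine ⟨?_, C, hC⟩
  have h1 : AEStronglyMeasurable (fun t => ((A t).det)⁻¹) (timeMeasure T) :=
    ((by fun_prop : Continuous fun M : Matrix ι ι ℝ => M.det).comp_aestronglyMeasurable
      hA.1).aemeasurable.inv.aestronglyMeasurable
  have h2 : AEStronglyMeasurable (fun t => (A t).adjugate) (timeMeasure T) :=
    (by fun_prop : Continuous fun M : Matrix ι ι ℝ => M.adjugate).comp_aestronglyMeasurable hA.1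
  have := h1.smul h2
  refine this.congr (.of_forall fun t => ?_)
  simp [inv_def]

end EssBddMatrix

/-! ### Positivity along matrix equations -/

section Positivity

variable {ι : Type*} [Fintype ι] {T : ℝ}

theorem isCompact_dotProduct_self_le_one : IsCompact {v : ι → ℝ | v ⬝ᵥ v ≤ 1} := by
  refine Metric.isCompact_of_isClosed_isBounded ?_ ?_
  · exact isClosed_le (by unfold dotProduct; fun_prop) continuous_const
  · refine (Metric.isBounded_closedBall (x := (0 : ι → ℝ)) (r := 1)).subset fun v hv => ?_
    rw [mem_closedBall_zero_iff]
    have := (sq_norm_le_dotProduct_self v).trans hv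
    nlinarith [norm_nonneg v]

/-- A symmetric solution of `P' = -g` with `P(T) ≥ 0` stays positive semidefinite if, at almost
every time, `g` is bounded below by `-c f` on the eigenvectors of the lowest eigenvalue `-f < 0`
of `P`. Indeed `f(t) = max_{|v| ≤ 1} (-⟨v, P(t) v⟩)` is Lipschitz, and by comparison with a fixed
maximizer its derivative is `⟨v, g v⟩ ≥ -c f`, so that `exp (c t) f(t)` is nondecreasing
and vanishes at `T`. -/
theorem IsBackwardIntegral.posSemidef [DecidableEq ι] {P g : ℝ → Matrix ι ι ℝ}
    (h : IsBackwardIntegral T P g) (hT : 0 ≤ T)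
    (hsymm : ∀ t ∈ Icc 0 T, (P t)ᵀ = P t) (hPT : (P T).PosSemidef) {c : ℝ}
    (hg : ∀ᵐ t ∂(timeMeasure T), ∀ v : ι → ℝ, ∀ f : ℝ, 0 < f →
      (∀ w, -f * (w ⬝ᵥ w) ≤ w ⬝ᵥ P t *ᵥ w) → P t *ᵥ v = -f • v → v ⬝ᵥ v = 1 → -(c * f) ≤ v ⬝ᵥ g t *ᵥ v) :
    ∀ t ∈ Icc 0 T, (P t).PosSemidef := by
  have hTm : T ∈ Icc 0 T := ⟨hT, le_rfl⟩
  have hmax : ∀ t, ∃ v ∈ {v : ι → ℝ | v ⬝ᵥ v ≤ 1},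
      IsMaxOn (fun v => -(v ⬝ᵥ P t *ᵥ v)) {v : ι → ℝ | v ⬝ᵥ v ≤ 1} v := fun t =>
    isCompact_dotProduct_self_le_one.exists_isMaxOn ⟨0, by simp⟩
      (by unfold dotProduct mulVec dotProduct; fun_prop)
  choose v hv1 hvmax using hmax
  set f : ℝ → ℝ := fun t => -(v t ⬝ᵥ P t *ᵥ v t) with hf
  have hfle : ∀ t w, w ⬝ᵥ w ≤ 1 → -(w ⬝ᵥ P t *ᵥ w) ≤ f t := fun t w hw => hvmax t hw
  have hf0 : ∀ t, 0 ≤ f t := fun t => by simpa using hfle t 0 (by simp)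
  have hlow : ∀ t w, -f t * (w ⬝ᵥ w) ≤ w ⬝ᵥ P t *ᵥ w := by
    intro t w
    rcases (dotProduct_self_nonneg' w).eq_or_lt with h0 | h0
    · have : w = 0 := dotProduct_self_eq_zero.1 h0.symm
      simp [this]
    · have hs : 0 < Real.sqrt (w ⬝ᵥ w) := Real.sqrt_pos.2 h0
      have hss := Real.mul_self_sqrt h0.le
      have h1 := hfle t ((Real.sqrt (w ⬝ᵥ w))⁻¹ • w) (by
        simp only [smul_dotProduct, dotProduct_smul, smul_eq_mul]
        rw [← mul_assoc, ← mul_inv, hss, inv_mul_cancel₀ h0.ne'])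
      simp only [mulVec_smul, smul_dotProduct, dotProduct_smul, smul_eq_mul] at h1
      rw [← mul_assoc, ← mul_inv, hss] at h1
      have h2 := mul_le_mul_of_nonneg_right h1 h0.le
      have h3 : -((w ⬝ᵥ w)⁻¹ * (w ⬝ᵥ P t *ᵥ w)) * (w ⬝ᵥ w) = -(w ⬝ᵥ P t *ᵥ w) := by
        field_simp
      linarith
  have hfT : f T = 0 := le_antisymm (by
    have := (posSemidef_iff_real.1 hPT).2 (v T)
    simp only [hf]; linarith) (hf0 T)
  obtain ⟨K, hK⟩ := h.exists_lipschitz hT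
  set N : NNReal := (Fintype.card ι : NNReal)
  have hflip : LipschitzOnWith (N * K) f (Icc 0 T) := by
    refine LipschitzOnWith.of_le_add_mul _ fun s hs t ht => ?_
    have h1 := hfle t (v s) (hv1 s)
    have h2 := (abs_le.1 (abs_dotProduct_mulVec_self_le (P s - P t) (v s))).1
    have h3 := hK.dist_le_mul s hs t ht
    rw [dist_eq_norm] at h3
    rw [sub_mulVec, dotProduct_sub] at h2
    have h4 : Fintype.card ι * ‖P s - P t‖ * (v s ⬝ᵥ v s) ≤
        Fintype.card ι * (K * dist s t) * 1 := by
      have := dotProduct_self_nonneg' (v s)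
      gcongr
      exact hv1 s
    have h5 : f s = -(v s ⬝ᵥ P s *ᵥ v s) := rfl
    have h6 : ((N * K : NNReal) : ℝ) * dist s t = Fintype.card ι * (K * dist s t) * 1 := by
      simp [N, mul_assoc]
    linarith
  have hflip' : LipschitzOnWith (N * K) f (uIcc 0 T) := by rwa [uIcc_of_le hT]
  have hfd := hflip'.absolutelyContinuousOnInterval.ae_differentiableAt
  rw [uIcc_of_le hT] at hfd
  have hderiv : ∀ᵐ t, t ∈ Icc 0 T → DifferentiableAt ℝ f t ∧ -(c * f t) ≤ deriv f t := by
    filter_upwards [hfd, (ae_restrict_iff' measurableSet_Icc).1 (h.ae_hasDerivAt hT),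
      (ae_restrict_iff' measurableSet_Icc).1 hg,
      (ae_restrict_iff' measurableSet_Icc).1 ae_timeMeasure_mem_Ioo] with t h1 h2 h3 h4 ht
    specialize h1 ht; specialize h2 ht; specialize h3 ht; specialize h4 ht
    refine ⟨h1, ?_⟩
    -- If `w` is a maximizer at time `t`, then `f + ⟨w, P w⟩ ≥ 0` with equality at `t`.
    have key : ∀ w, w ⬝ᵥ w ≤ 1 → f t = -(w ⬝ᵥ P t *ᵥ w) → deriv f t = w ⬝ᵥ g t *ᵥ w := by
      intro w hw hwt
      have hlin : HasDerivAt (fun s => w ⬝ᵥ P s *ᵥ w) (w ⬝ᵥ (-g t) *ᵥ w) t := by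
        let φ : Matrix ι ι ℝ →ₗ[ℝ] ℝ :=
          { toFun := fun M => w ⬝ᵥ M *ᵥ w
            map_add' := fun M M' => by rw [add_mulVec, dotProduct_add]
            map_smul' := fun r M => by simp [smul_mulVec] }
        exact (LinearMap.toContinuousLinearMap φ).hasFDerivAt.comp_hasDerivAt t h2
      have hmin : IsLocalMin (fun s => f s + w ⬝ᵥ P s *ᵥ w) t := by
        refine .of_forall fun s => ?_
        have := hfle s w hw
        simp only
        linarith
      have := hmin.hasDerivAt_eq_zero (h1.hasDerivAt.add hlin)
      rw [neg_mulVec, dotProduct_neg] at this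
      linarith
    rcases (hf0 t).eq_or_lt with h0 | h0
    · have := key 0 (by simp) (by simp [← h0])
      rw [this, ← h0]
      simp
    · have hPv : (P t + f t • (1 : Matrix ι ι ℝ)) *ᵥ v t = 0 := by
        have hpsd : (P t + f t • (1 : Matrix ι ι ℝ)).PosSemidef := by
          refine posSemidef_iff_real.2 ⟨by simp [hsymm t ht], fun w => ?_⟩
          have := hlow t w
          simp only [add_mulVec, smul_mulVec, one_mulVec, dotProduct_add, dotProduct_smul,
            smul_eq_mul]
          linarith
        refine (hpsd.dotProduct_mulVec_zero_iff _).1 (le_antisymm ?_ ?_)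
        · have := mul_le_mul_of_nonneg_left (hv1 t) h0.le
          have e : f t = -(v t ⬝ᵥ P t *ᵥ v t) := rfl
          simp only [star_trivial, add_mulVec, smul_mulVec, one_mulVec, dotProduct_add,
            dotProduct_smul, smul_eq_mul]
          linarith
        · exact hpsd.dotProduct_mulVec_nonneg _
      have hPv' : P t *ᵥ v t = -f t • v t := by
        rw [add_mulVec, smul_mulVec, one_mulVec] at hPv
        rw [neg_smul]
        exact eq_neg_of_add_eq_zero_left hPv
      have hvv : v t ⬝ᵥ v t = 1 := by
        have e : f t = -(v t ⬝ᵥ P t *ᵥ v t) := rfl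
        rw [hPv', dotProduct_smul, smul_eq_mul] at e
        have : f t * (v t ⬝ᵥ v t) = f t * 1 := by linarith
        exact mul_left_cancel₀ h0.ne' this
      rw [key (v t) (hv1 t) rfl]
      exact h3 _ _ h0 (hlow t) hPv' hvv
  have hfz : ∀ t ∈ Icc 0 T, f t = 0 := by
    intro t ht
    have hac : AbsolutelyContinuousOnInterval (fun s => Real.exp (c * s) * f s) t T := by
      have h1 : AbsolutelyContinuousOnInterval f t T :=
        hflip'.absolutelyContinuousOnInterval.mono
          (by rw [uIcc_of_le hT, uIcc_of_le ht.2]; exact Icc_subset_Icc_left ht.1)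
      have h2 : AbsolutelyContinuousOnInterval (fun s => Real.exp (c * s)) t T :=
        ContDiffOn.absolutelyContinuousOnInterval (by fun_prop)
      exact h2.mul h1
    have h1 := hac.integral_deriv_eq_sub
    have h2 : 0 ≤ ∫ s in t..T, deriv (fun s => Real.exp (c * s) * f s) s := by
      rw [intervalIntegral.integral_of_le ht.2]
      refine setIntegral_nonneg_of_ae_restrict ?_
      refine (ae_restrict_iff' measurableSet_Ioc).2 ?_
      filter_upwards [hderiv] with s hs hsm
      obtain ⟨h3, h4⟩ := hs ⟨ht.1.trans hsm.1.le, hsm.2⟩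
      have h5 : HasDerivAt (fun s => Real.exp (c * s)) (Real.exp (c * s) * (c * 1)) s :=
        ((hasDerivAt_id s).const_mul c).exp
      have h6 : deriv (fun s => Real.exp (c * s) * f s) s =
          Real.exp (c * s) * (c * f s + deriv f s) := by
        rw [HasDerivAt.deriv (h5.fun_mul h3.hasDerivAt)]
        ring
      simp only [Pi.zero_apply]
      rw [h6]
      exact mul_nonneg (Real.exp_nonneg _) (by linarith)
    rw [h1, hfT, mul_zero, zero_sub] at h2
    have h7 := Real.exp_pos (c * t)
    refine le_antisymm ?_ (hf0 t)
    by_contra! hlt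
    have := mul_pos h7 hlt
    linarith
  intro t ht
  refine posSemidef_iff_real.2 ⟨hsymm t ht, fun w => ?_⟩
  have := hlow t w
  rwa [hfz t ht, neg_zero, zero_mul] at this

end Positivity

/-! ### Linear matrix equations of Lyapunov type -/

section BackwardMaps

variable {E E' : Type*} [NormedAddCommGroup E] [NormedSpace ℝ E] [CompleteSpace E]
  [NormedAddCommGroup E'] [NormedSpace ℝ E'] [CompleteSpace E'] {T : ℝ} {P g : ℝ → E}

theorem IsBackwardIntegral.map [FiniteDimensional ℝ E] (h : IsBackwardIntegral T P g)
    (hT : 0 ≤ T) (φ : E →ₗ[ℝ] E') :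
    IsBackwardIntegral T (fun t => φ (P t)) (fun t => φ (g t)) := by
  let ψ : E →L[ℝ] E' := LinearMap.toContinuousLinearMap φ
  have hb : EssBdd T fun t => ψ (g t) := by
    obtain ⟨C, hC⟩ := h.essBdd.2
    refine ⟨ψ.continuous.comp_aestronglyMeasurable h.essBdd.1, ‖ψ‖ * C, hC.mono fun t ht => ?_⟩
    exact (ψ.le_opNorm _).trans (by gcongr)
  refine ⟨hb, fun t ht => ?_⟩
  change ψ (P t) = ψ (P T) + ∫ s in t..T, ψ (g s)
  rw [h.eqn t ht, map_add, ContinuousLinearMap.intervalIntegral_comp_comm]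
  exact h.essBdd.intervalIntegrable ht ⟨hT, le_rfl⟩

omit [CompleteSpace E] in
/-- Continuous dependence on the terminal value, for `‖P'‖ ≤ K ‖P‖`. -/
theorem IsBackwardIntegral.norm_le (h : IsBackwardIntegral T P g) (hT : 0 ≤ T) {K : ℝ}
    (hK : 0 ≤ K) (hg : ∀ᵐ t ∂(timeMeasure T), ‖g t‖ ≤ K * ‖P t‖) :
    ∀ t ∈ Icc 0 T, ‖P t‖ ≤ ‖P T‖ * Real.exp (K * T) := by
  have hTm : T ∈ Icc 0 T := ⟨hT, le_rfl⟩
  have hc := (h.continuousOn hT).norm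
  intro t ht
  refine (le_mul_exp_of_le_add_integral hK hc (δ := ‖P T‖) ?_ t ht).trans ?_
  · intro t ht
    rw [h.eqn t ht]
    refine (norm_add_le _ _).trans ?_
    gcongr
    rw [← intervalIntegral.integral_const_mul]
    have h1 := ae_of_ae_timeMeasure hg ht hTm
    rw [uIoc_of_le ht.2] at h1
    refine intervalIntegral.norm_integral_le_of_norm_le ht.2 h1 ?_
    refine ContinuousOn.intervalIntegrable ?_
    rw [uIcc_of_le ht.2]
    exact continuousOn_const.mul (hc.mono (Icc_subset_Icc_left ht.1))
  · have := ht.1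
    gcongr
    linarith

end BackwardMaps

theorem IsBackwardIntegral.transpose {ι κ : Type*} [Fintype ι] [Fintype κ] {T : ℝ}
    {P g : ℝ → Matrix ι κ ℝ} (h : IsBackwardIntegral T P g) (hT : 0 ≤ T) :
    IsBackwardIntegral T (fun t => (P t)ᵀ) (fun t => (g t)ᵀ) :=
  h.map hT (Matrix.transposeLinearEquiv ι κ ℝ ℝ).toLinearMap

section Lyapunov

variable {ι : Type*} [Fintype ι] {T : ℝ}

/-- The right-hand side `P A + Aᵀ P + Cᵀ P C + S` of a Lyapunov equation. -/
def lyapunovRhs (A C S P : Matrix ι ι ℝ) : Matrix ι ι ℝ :=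
  P * A + Aᵀ * P + Cᵀ * P * C + S

theorem lyapunovRhs_sub (A C S S' P P' : Matrix ι ι ℝ) :
    lyapunovRhs A C S P - lyapunovRhs A C S' P' = lyapunovRhs A C (S - S') (P - P') := by
  simp only [lyapunovRhs]
  noncomm_ring

theorem norm_lyapunovRhs_zero_le (A C P : Matrix ι ι ℝ) :
    ‖lyapunovRhs A C 0 P‖ ≤ (‖A‖ + ‖Aᵀ‖ + ‖Cᵀ‖ * ‖C‖) * ‖P‖ := by
  rw [lyapunovRhs, add_zero]
  have h1 := linfty_opNorm_mul P A
  have h2 := linfty_opNorm_mul Aᵀ P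
  have h3 := (linfty_opNorm_mul (Cᵀ * P) C).trans
    (mul_le_mul_of_nonneg_right (linfty_opNorm_mul Cᵀ P) (norm_nonneg _))
  calc _ ≤ ‖P * A‖ + ‖Aᵀ * P‖ + ‖Cᵀ * P * C‖ := norm_add₃_le
    _ ≤ ‖P‖ * ‖A‖ + ‖Aᵀ‖ * ‖P‖ + ‖Cᵀ‖ * ‖P‖ * ‖C‖ := by gcongr
    _ = _ := by ring

theorem transpose_lyapunovRhs (A C S P : Matrix ι ι ℝ) :
    (lyapunovRhs A C S P)ᵀ = lyapunovRhs A C Sᵀ Pᵀ := by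
  simp only [lyapunovRhs, transpose_add, transpose_mul, transpose_transpose, ← Matrix.mul_assoc]
  abel

theorem dotProduct_lyapunovRhs {A C S P : Matrix ι ι ℝ} (hP : Pᵀ = P) (v : ι → ℝ) :
    v ⬝ᵥ lyapunovRhs A C S P *ᵥ v =
      2 * ((A *ᵥ v) ⬝ᵥ P *ᵥ v) + (C *ᵥ v) ⬝ᵥ P *ᵥ (C *ᵥ v) + v ⬝ᵥ S *ᵥ v := by
  have h1 : v ⬝ᵥ (P * A) *ᵥ v = (A *ᵥ v) ⬝ᵥ P *ᵥ v := by
    rw [← mulVec_mulVec]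
    conv_lhs => rw [← hP, dotProduct_mulVec_transpose, dotProduct_comm]
  simp only [lyapunovRhs, add_mulVec, dotProduct_add, h1]
  simp only [← mulVec_mulVec, dotProduct_mulVec_transpose]
  ring

variable {A C S : ℝ → Matrix ι ι ℝ}

theorem EssBdd.lyapunovRhs {P : ℝ → Matrix ι ι ℝ} (hA : EssBdd T A) (hC : EssBdd T C)
    (hS : EssBdd T S) (hP : EssBdd T P) :
    EssBdd T fun t => lyapunovRhs (A t) (C t) (S t) (P t) :=
  (((hP.mul hA).add (hA.transpose.mul hP)).add ((hC.transpose.mul hP).mul hC)).add hS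

theorem exists_norm_lyapunovRhs_le (hA : EssBdd T A) (hC : EssBdd T C) :
    ∃ K, 0 ≤ K ∧ ∀ᵐ t ∂(timeMeasure T), ∀ P, ‖lyapunovRhs (A t) (C t) 0 P‖ ≤ K * ‖P‖ := by
  obtain ⟨a, ha0, ha⟩ := hA.exists_bound
  obtain ⟨a', ha0', ha'⟩ := hA.transpose.exists_bound
  obtain ⟨c, hc0, hc⟩ := hC.exists_bound
  obtain ⟨c', hc0', hc'⟩ := hC.transpose.exists_bound
  refine ⟨a + a' + c' * c, by positivity, ?_⟩
  filter_upwards [ha, ha', hc, hc'] with t h1 h2 h3 h4 P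
  refine (norm_lyapunovRhs_zero_le _ _ _).trans ?_
  gcongr

theorem exists_lyapunov_solution (hT : 0 ≤ T) (hA : EssBdd T A) (hC : EssBdd T C)
    (hS : EssBdd T S) (hSs : ∀ᵐ t ∂(timeMeasure T), (S t)ᵀ = S t) {PT : Matrix ι ι ℝ}
    (hPT : PTᵀ = PT) :
    ∃ P : ℝ → Matrix ι ι ℝ, P T = PT ∧
      IsBackwardIntegral T P (fun t => lyapunovRhs (A t) (C t) (S t) (P t)) ∧
      ∀ t ∈ Icc 0 T, (P t)ᵀ = P t := by
  obtain ⟨K, hK0, hK⟩ := exists_norm_lyapunovRhs_le hA hC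
  obtain ⟨s, -, hs⟩ := hS.exists_bound
  obtain ⟨P, hP1, hP2⟩ := exists_isBackwardIntegral hT (C := s)
    (F := fun t P => lyapunovRhs (A t) (C t) (S t) P) hK0
    (fun x hx => (hA.lyapunovRhs hC hS (EssBdd.of_continuousOn hx)).1)
    (hK.mono fun t ht x y => by rw [lyapunovRhs_sub, sub_self]; exact ht _)
    (hs.mono fun t ht => by simpa [lyapunovRhs] using ht) PT
  refine ⟨P, hP1, hP2, fun t ht => ?_⟩
  have h1 := (hP2.transpose hT).sub hP2 hT
  have h2 := h1.norm_le hT hK0 (by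
    filter_upwards [hK, hSs] with t h3 h4
    rw [transpose_lyapunovRhs, h4, lyapunovRhs_sub, sub_self]
    exact h3 _) t ht
  rw [hP1, hPT, sub_self, norm_zero, zero_mul] at h2
  exact sub_eq_zero.1 (norm_le_zero_iff.1 h2)

/-- Solutions of a Lyapunov equation with nonnegative source and terminal value are nonnegative. -/
theorem IsBackwardIntegral.posSemidef_of_lyapunov [DecidableEq ι] {P : ℝ → Matrix ι ι ℝ}
    (hT : 0 ≤ T) (hA : EssBdd T A) (hC : EssBdd T C)
    (h : IsBackwardIntegral T P (fun t => lyapunovRhs (A t) (C t) (S t) (P t)))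
    (hS : ∀ᵐ t ∂(timeMeasure T), ∀ v, 0 ≤ v ⬝ᵥ S t *ᵥ v)
    (hsymm : ∀ t ∈ Icc 0 T, (P t)ᵀ = P t) (hPT : (P T).PosSemidef) :
    ∀ t ∈ Icc 0 T, (P t).PosSemidef := by
  obtain ⟨a, ha0, ha⟩ := hA.exists_bound
  obtain ⟨c, hc0, hc⟩ := (hC.transpose.mul hC).exists_bound
  refine h.posSemidef hT hsymm hPT (c := 2 * (Fintype.card ι * a) + Fintype.card ι * c) ?_
  filter_upwards [ha, hc, hS, ae_timeMeasure_mem_Icc] with t h1 h2 h3 ht v f hf hlow hv hvv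
  rw [dotProduct_lyapunovRhs (hsymm t ht), hv, dotProduct_smul, dotProduct_comm, smul_eq_mul]
  have h4 := hlow (C t *ᵥ v)
  have h5 := (abs_le.1 (abs_dotProduct_mulVec_self_le (A t) v)).2
  have h6 := (abs_le.1 (abs_dotProduct_mulVec_self_le ((C t)ᵀ * C t) v)).2
  rw [← mulVec_mulVec, dotProduct_mulVec_transpose] at h6
  rw [hvv, mul_one] at h5 h6
  have h7 : v ⬝ᵥ A t *ᵥ v ≤ Fintype.card ι * a := h5.trans (by gcongr)
  have h8 : (C t *ᵥ v) ⬝ᵥ C t *ᵥ v ≤ Fintype.card ι * c := h6.trans (by gcongr)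
  have h9 := mul_le_mul_of_nonneg_left h7 hf.le
  have h10 := mul_le_mul_of_nonneg_left h8 hf.le
  have := h3 v
  linarith

end Lyapunov

/-! ### Existence for the Riccati equation -/

section UniformlyBounded

variable {E : Type*} [NormedAddCommGroup E] {T : ℝ}

/-- A sequence of functions with a common essential bound on `[0,T]`. -/
def UnifBdd (T : ℝ) (f : ℕ → ℝ → E) : Prop :=
  ∃ C, ∀ k, ∀ᵐ t ∂(timeMeasure T), ‖f k t‖ ≤ C

theorem EssBdd.unifBdd {f : ℝ → E} (hf : EssBdd T f) : UnifBdd T fun _ => f :=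
  hf.2.imp fun _ hC _ => hC

theorem UnifBdd.add {f g : ℕ → ℝ → E} (hf : UnifBdd T f) (hg : UnifBdd T g) :
    UnifBdd T fun k t => f k t + g k t := by
  obtain ⟨C, hC⟩ := hf
  obtain ⟨D, hD⟩ := hg
  refine ⟨C + D, fun k => ?_⟩
  filter_upwards [hC k, hD k] with t h1 h2
  exact (norm_add_le _ _).trans (add_le_add h1 h2)

theorem UnifBdd.neg {f : ℕ → ℝ → E} (hf : UnifBdd T f) : UnifBdd T fun k t => -f k t :=
  hf.imp fun _ hC k => (hC k).mono fun t ht => by rwa [norm_neg]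

variable {ι κ τ : Type*} [Fintype ι] [Fintype κ] [Fintype τ]

theorem UnifBdd.mul {f : ℕ → ℝ → Matrix ι κ ℝ} {g : ℕ → ℝ → Matrix κ τ ℝ} (hf : UnifBdd T f)
    (hg : UnifBdd T g) : UnifBdd T fun k t => f k t * g k t := by
  obtain ⟨C, hC⟩ := hf
  obtain ⟨D, hD⟩ := hg
  refine ⟨|C| * |D|, fun k => ?_⟩
  filter_upwards [hC k, hD k] with t h1 h2
  exact (linfty_opNorm_mul _ _).trans (mul_le_mul (h1.trans (le_abs_self C))
    (h2.trans (le_abs_self D)) (norm_nonneg _) (abs_nonneg _))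

theorem UnifBdd.transpose {f : ℕ → ℝ → Matrix ι κ ℝ} (hf : UnifBdd T f) :
    UnifBdd T fun k t => (f k t)ᵀ := by
  obtain ⟨C, hC⟩ := hf
  refine ⟨Fintype.card ι * |C|, fun k => (hC k).mono fun t ht => ?_⟩
  exact norm_le_of_abs_apply_le (abs_nonneg C) fun a b =>
    (abs_apply_le_norm (f k t) b a).trans (ht.trans (le_abs_self C))

end UniformlyBounded

/-- Coefficients of the stochastic linear quadratic problem with state equation
`dX = (A X + B u) dt + (C X + D u) dB` and running cost `⟨X, Q X⟩ + ⟨u, R u⟩`. -/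
structure LQ (ι κ : Type*) where
  A : ℝ → Matrix ι ι ℝ
  B : ℝ → Matrix ι κ ℝ
  C : ℝ → Matrix ι ι ℝ
  D : ℝ → Matrix ι κ ℝ
  Q : ℝ → Matrix ι ι ℝ
  R : ℝ → Matrix κ κ ℝ

namespace LQ

variable {ι κ : Type*} [Fintype ι] [Fintype κ]

section Defs

variable (q : LQ ι κ)

/-- `R + Dᵀ P D`. -/
def M₁ (t : ℝ) (P : Matrix ι ι ℝ) : Matrix κ κ ℝ := q.R t + (q.D t)ᵀ * P * q.D t

/-- `Bᵀ P + Dᵀ P C`. -/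
def M₂ (t : ℝ) (P : Matrix ι ι ℝ) : Matrix κ ι ℝ := (q.B t)ᵀ * P + (q.D t)ᵀ * P * q.C t

/-- The right-hand side of the Lyapunov equation for the cost of the feedback `u = Θ X`. -/
def feedbackRhs (t : ℝ) (Θ : Matrix κ ι ℝ) (P : Matrix ι ι ℝ) : Matrix ι ι ℝ :=
  lyapunovRhs (q.A t + q.B t * Θ) (q.C t + q.D t * Θ) (q.Q t + Θᵀ * q.R t * Θ) P

/-- The right-hand side `P A + Aᵀ P + Cᵀ P C + Q - M₂ᵀ M₁⁻¹ M₂` of the Riccati equation. -/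
noncomputable def riccatiRhs [DecidableEq κ] (t : ℝ) (P : Matrix ι ι ℝ) : Matrix ι ι ℝ :=
  P * q.A t + (q.A t)ᵀ * P + (q.C t)ᵀ * P * q.C t + q.Q t
    - (q.M₂ t P)ᵀ * (q.M₁ t P)⁻¹ * q.M₂ t P

/-- The optimal feedback for the value `P`. -/
noncomputable def optFeedback [DecidableEq κ] (t : ℝ) (P : Matrix ι ι ℝ) : Matrix κ ι ℝ :=
  -((q.M₁ t P)⁻¹ * q.M₂ t P)

/-- Essentially bounded coefficients and positive semidefinite weights. -/
structure Regular (T : ℝ) : Prop where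
  A : EssBdd T q.A
  B : EssBdd T q.B
  C : EssBdd T q.C
  D : EssBdd T q.D
  Q : EssBdd T q.Q
  R : EssBdd T q.R
  Q_psd : ∀ᵐ t ∂(timeMeasure T), (q.Q t).PosSemidef
  R_psd : ∀ᵐ t ∂(timeMeasure T), (q.R t).PosSemidef

end Defs

variable {q : LQ ι κ} {T : ℝ}

omit [Fintype κ] in
theorem transpose_M₁ {t : ℝ} {P : Matrix ι ι ℝ} (hR : (q.R t)ᵀ = q.R t) (hP : Pᵀ = P) :
    (q.M₁ t P)ᵀ = q.M₁ t P := by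
  simp only [M₁, transpose_add, transpose_mul, transpose_transpose, hR, hP, Matrix.mul_assoc]

/-- Completing the square in the feedback. -/
theorem feedbackRhs_eq [DecidableEq κ] {t : ℝ} {P : Matrix ι ι ℝ} (hR : (q.R t)ᵀ = q.R t)
    (hP : Pᵀ = P) (hM : IsUnit (q.M₁ t P)) (Θ : Matrix κ ι ℝ) :
    q.feedbackRhs t Θ P = q.riccatiRhs t P +
      (Θ - q.optFeedback t P)ᵀ * q.M₁ t P * (Θ - q.optFeedback t P) := by
  have hdet := (isUnit_iff_isUnit_det _).1 hM
  have hMs := transpose_M₁ (q := q) hR hP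
  set M := q.M₁ t P with hMdef
  have h1 : M * (Θ - q.optFeedback t P) = M * Θ + q.M₂ t P := by
    rw [optFeedback, sub_neg_eq_add, Matrix.mul_add, mul_nonsing_inv_cancel_left _ _ hdet]
  have h2 : (q.optFeedback t P)ᵀ * M = -(q.M₂ t P)ᵀ := by
    have : M * q.optFeedback t P = -q.M₂ t P := by
      rw [optFeedback, Matrix.mul_neg, mul_nonsing_inv_cancel_left _ _ hdet]
    rw [← transpose_neg, ← this, transpose_mul, hMs]
  have h3 : (q.optFeedback t P)ᵀ * (M * Θ + q.M₂ t P) =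
      -((q.M₂ t P)ᵀ * Θ) - (q.M₂ t P)ᵀ * M⁻¹ * q.M₂ t P := by
    rw [Matrix.mul_add, ← Matrix.mul_assoc, h2, Matrix.neg_mul, sub_eq_add_neg]
    congr 1
    rw [optFeedback, transpose_neg, transpose_mul, transpose_nonsing_inv, hMs, Matrix.neg_mul]
  rw [Matrix.mul_assoc, h1, transpose_sub, Matrix.sub_mul, h3]
  rw [riccatiRhs, ← hMdef, hMdef]
  simp only [feedbackRhs, lyapunovRhs, M₁, M₂, transpose_add, transpose_mul, transpose_transpose,
    Matrix.mul_add, Matrix.add_mul, hP, Matrix.mul_assoc]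
  abel

theorem feedbackRhs_optFeedback [DecidableEq κ] {t : ℝ} {P : Matrix ι ι ℝ}
    (hR : (q.R t)ᵀ = q.R t) (hP : Pᵀ = P) (hM : IsUnit (q.M₁ t P)) :
    q.feedbackRhs t (q.optFeedback t P) P = q.riccatiRhs t P := by
  rw [feedbackRhs_eq hR hP hM]
  simp

theorem Regular.M₁ (hq : q.Regular T) {P : ℝ → Matrix ι ι ℝ} (hP : EssBdd T P) :
    EssBdd T fun t => q.M₁ t (P t) :=
  hq.R.add ((hq.D.transpose.mul hP).mul hq.D)

theorem Regular.M₂ (hq : q.Regular T) {P : ℝ → Matrix ι ι ℝ} (hP : EssBdd T P) :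
    EssBdd T fun t => q.M₂ t (P t) :=
  (hq.B.transpose.mul hP).add ((hq.D.transpose.mul hP).mul hq.C)

theorem dotProduct_M₁ (t : ℝ) (P : Matrix ι ι ℝ) (w : κ → ℝ) :
    w ⬝ᵥ q.M₁ t P *ᵥ w = w ⬝ᵥ q.R t *ᵥ w + (q.D t *ᵥ w) ⬝ᵥ P *ᵥ (q.D t *ᵥ w) := by
  simp only [LQ.M₁, add_mulVec, dotProduct_add, ← mulVec_mulVec, dotProduct_mulVec_transpose]

/-- The structural condition on a linear quadratic problem under which multiples `p I` with
`p' = l p`, `p ≤ δ`, are subsolutions of the Lyapunov equation of every feedback. -/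
def Coercive (q : LQ ι κ) (T δ l : ℝ) : Prop :=
  ∀ᵐ t ∂(timeMeasure T), ∀ (v : ι → ℝ) (w : κ → ℝ) (p : ℝ), 0 ≤ p → p ≤ δ →
    0 ≤ 2 * p * (v ⬝ᵥ (q.A t *ᵥ v + q.B t *ᵥ w))
      + p * ((q.C t *ᵥ v + q.D t *ᵥ w) ⬝ᵥ (q.C t *ᵥ v + q.D t *ᵥ w))
      + w ⬝ᵥ q.R t *ᵥ w + l * p * (v ⬝ᵥ v)

/-- The penalty `R + p Dᵀ D` on the control is uniformly positive for every `p > 0`. -/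
def ControlCoercive (q : LQ ι κ) (T : ℝ) : Prop :=
  ∀ p > 0, ∃ μ > 0, ∀ᵐ t ∂(timeMeasure T), ∀ w : κ → ℝ,
    μ * (w ⬝ᵥ w) ≤ w ⬝ᵥ q.R t *ᵥ w + p * ((q.D t *ᵥ w) ⬝ᵥ (q.D t *ᵥ w))

variable [DecidableEq ι]

theorem isBackwardIntegral_exp_smul_one (hT : 0 ≤ T) (δ l : ℝ) :
    IsBackwardIntegral T (fun t => (δ * Real.exp (-(l * (T - t)))) • (1 : Matrix ι ι ℝ))
      (fun t => (-(l * (δ * Real.exp (-(l * (T - t)))))) • (1 : Matrix ι ι ℝ)) := by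
  have hscal : IsBackwardIntegral T (fun t => δ * Real.exp (-(l * (T - t))))
      (fun t => -(l * (δ * Real.exp (-(l * (T - t)))))) := by
    refine ⟨EssBdd.of_continuousOn (by fun_prop), fun t _ => ?_⟩
    have hd : ∀ s ∈ uIcc t T, HasDerivAt (fun s => -(δ * Real.exp (-(l * (T - s)))))
        (-(l * (δ * Real.exp (-(l * (T - s)))))) s := by
      intro s _
      have h1 := ((((hasDerivAt_id s).const_sub T).const_mul l).neg.exp.const_mul δ).neg
      refine h1.congr_deriv ?_
      simp
      ring
    rw [intervalIntegral.integral_eq_sub_of_hasDerivAt hd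
      (Continuous.intervalIntegrable (by fun_prop) _ _)]
    simp
  exact hscal.map hT (LinearMap.toSpanSingleton ℝ (Matrix ι ι ℝ) 1)

/-- The cost of every feedback is bounded below, uniformly in the feedback. -/
theorem feedback_lower_bound (hq : q.Regular T) (hT : 0 ≤ T) {δ l : ℝ} (hδ : 0 ≤ δ) (hl : 0 ≤ l)
    (hcoer : q.Coercive T δ l) {P : ℝ → Matrix ι ι ℝ} {Θ : ℝ → Matrix κ ι ℝ} (hΘ : EssBdd T Θ)
    (hP : IsBackwardIntegral T P fun t => q.feedbackRhs t (Θ t) (P t))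
    (hPs : ∀ t ∈ Icc 0 T, (P t)ᵀ = P t) (hPT : ∀ v, δ * (v ⬝ᵥ v) ≤ v ⬝ᵥ P T *ᵥ v) :
    ∀ t ∈ Icc 0 T, ∀ v, δ * Real.exp (-(l * T)) * (v ⬝ᵥ v) ≤ v ⬝ᵥ P t *ᵥ v := by
  have hTm : T ∈ Icc 0 T := ⟨hT, le_rfl⟩
  set p : ℝ → ℝ := fun t => δ * Real.exp (-(l * (T - t))) with hp
  have hp0 : ∀ t, 0 ≤ p t := fun t => by positivity
  have hpδ : ∀ t ∈ Icc 0 T, p t ≤ δ := fun t ht => by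
    have h1 : Real.exp (-(l * (T - t))) ≤ 1 := Real.exp_le_one_iff.2 (by
      have := mul_nonneg hl (sub_nonneg.2 ht.2); linarith)
    calc p t ≤ δ * 1 := mul_le_mul_of_nonneg_left h1 hδ
      _ = δ := mul_one δ
  have hps : ∀ t, (p t • (1 : Matrix ι ι ℝ))ᵀ = p t • 1 := fun t => by simp
  have hA := hq.A.add (hq.B.mul hΘ)
  have hC := hq.C.add (hq.D.mul hΘ)
  have hE := hP.sub (isBackwardIntegral_exp_smul_one hT δ l) hT
  have hE' : IsBackwardIntegral T (fun t => P t - p t • (1 : Matrix ι ι ℝ)) fun t =>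
      lyapunovRhs (q.A t + q.B t * Θ t) (q.C t + q.D t * Θ t)
        (q.feedbackRhs t (Θ t) (p t • 1) + (l * p t) • 1) (P t - p t • 1) := by
    refine hE.congr_ae hT (.of_forall fun t => ?_)
    simp only [feedbackRhs, lyapunovRhs, hp, neg_smul, sub_neg_eq_add]
    noncomm_ring
  have hpsd := IsBackwardIntegral.posSemidef_of_lyapunov hT hA hC hE' (by
    filter_upwards [hcoer, hq.Q_psd, ae_timeMeasure_mem_Icc] with t h1 h2 ht v
    have h3 := h1 v (Θ t *ᵥ v) (p t) (hp0 t) (hpδ t ht)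
    have h4 := (posSemidef_iff_real.1 h2).2 v
    rw [add_mulVec, dotProduct_add, feedbackRhs, dotProduct_lyapunovRhs (hps t)]
    simp only [smul_mulVec, one_mulVec, dotProduct_smul, smul_eq_mul, add_mulVec,
      ← mulVec_mulVec, dotProduct_add, dotProduct_mulVec_transpose, add_dotProduct] at h3 ⊢
    have e1 := dotProduct_comm (q.A t *ᵥ v) v
    have e2 := dotProduct_comm (q.B t *ᵥ Θ t *ᵥ v) v
    rw [e1, e2]
    linarith) (fun t ht => by rw [transpose_sub, hPs t ht, hps]) (by
    refine posSemidef_iff_real.2 ⟨by rw [transpose_sub, hPs T hTm, hps], fun v => ?_⟩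
    have h1 := hPT v
    have h2 : p T = δ := by simp [hp]
    simp only [h2, sub_mulVec, dotProduct_sub, smul_mulVec, one_mulVec, dotProduct_smul,
      smul_eq_mul]
    linarith)
  intro t ht v
  have h1 := (posSemidef_iff_real.1 (hpsd t ht)).2 v
  simp only [sub_mulVec, dotProduct_sub, smul_mulVec, one_mulVec, dotProduct_smul,
      smul_eq_mul] at h1
  have h2 : δ * Real.exp (-(l * T)) ≤ p t := by
    have : l * (T - t) ≤ l * T := mul_le_mul_of_nonneg_left (by linarith [ht.1]) hl
    simp only [hp]
    gcongr
  have h3 := mul_le_mul_of_nonneg_right h2 (dotProduct_self_nonneg' v)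
  linarith

end LQ

/-- A decreasing sequence of symmetric matrices with nonnegative quadratic forms converges. -/
theorem exists_tendsto_of_antitone {ι : Type*} [Fintype ι] [DecidableEq ι]
    {P : ℕ → Matrix ι ι ℝ} (hs : ∀ k, (P k)ᵀ = P k)
    (h0 : ∀ k v, 0 ≤ v ⬝ᵥ P k *ᵥ v) (hanti : ∀ k v, v ⬝ᵥ P (k + 1) *ᵥ v ≤ v ⬝ᵥ P k *ᵥ v) :
    ∃ L, Tendsto P atTop (𝓝 L) := by
  have hconv : ∀ v, ∃ l, Tendsto (fun k => v ⬝ᵥ P k *ᵥ v) atTop (𝓝 l) := fun v =>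
    ⟨_, tendsto_atTop_ciInf (antitone_nat_of_succ_le fun k => hanti k v)
      ⟨0, by rintro _ ⟨k, rfl⟩; exact h0 k v⟩⟩
  choose l hl using hconv
  refine ⟨fun a b => (l (Pi.single a 1 + Pi.single b 1) - l (Pi.single a 1)
    - l (Pi.single b 1)) / 2, tendsto_pi_nhds.2 fun a => tendsto_pi_nhds.2 fun b => ?_⟩
  refine ((((hl (Pi.single a 1 + Pi.single b 1)).sub (hl (Pi.single a 1))).sub
    (hl (Pi.single b 1))).div_const 2).congr fun k => ?_
  have hab : P k b a = P k a b := by conv_lhs => rw [← hs k, transpose_apply]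
  simp [mulVec_add, add_dotProduct, hab]
  ring

namespace LQ

variable {ι κ : Type*} [Fintype ι] [Fintype κ] [DecidableEq ι] [DecidableEq κ]
  {q : LQ ι κ} {T : ℝ}

/-- A stage of policy iteration: an admissible feedback and the value of its cost. -/
structure PolicyStage (q : LQ ι κ) (T : ℝ) (PT : Matrix ι ι ℝ) where
  P : ℝ → Matrix ι ι ℝ
  Θ : ℝ → Matrix κ ι ℝ
  terminal : P T = PT
  Θ_essBdd : EssBdd T Θ
  eqn : IsBackwardIntegral T P fun t => q.feedbackRhs t (Θ t) (P t)
  symm : ∀ t ∈ Icc 0 T, (P t)ᵀ = P t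

omit [DecidableEq ι] [DecidableEq κ] in
theorem exists_policyStage (hq : q.Regular T) (hT : 0 ≤ T) {PT : Matrix ι ι ℝ} (hPT : PTᵀ = PT)
    {Θ : ℝ → Matrix κ ι ℝ} (hΘ : EssBdd T Θ) : ∃ x : PolicyStage q T PT, x.Θ = Θ := by
  obtain ⟨P, h1, h2, h3⟩ := exists_lyapunov_solution hT (hq.A.add (hq.B.mul hΘ))
    (hq.C.add (hq.D.mul hΘ)) (hq.Q.add ((hΘ.transpose.mul hq.R).mul hΘ)) (by
      filter_upwards [hq.Q_psd, hq.R_psd] with t h1 h2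
      simp only [transpose_add, transpose_mul, transpose_transpose, Matrix.mul_assoc,
        (posSemidef_iff_real.1 h1).1, (posSemidef_iff_real.1 h2).1]) hPT
  exact ⟨⟨P, Θ, h1, hΘ, h2, h3⟩, rfl⟩

omit [DecidableEq ι] in
theorem Regular.unifBdd_optFeedback (hq : q.Regular T) {P : ℕ → ℝ → Matrix ι ι ℝ}
    (hP : UnifBdd T P) (hM : UnifBdd T fun k t => (q.M₁ t (P k t))⁻¹) :
    UnifBdd T fun k t => q.optFeedback t (P k t) :=
  (hM.mul ((hq.B.unifBdd.transpose.mul hP).add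
    ((hq.D.unifBdd.transpose.mul hP).mul hq.C.unifBdd))).neg

omit [DecidableEq ι] [DecidableEq κ] in
theorem Regular.unifBdd_feedbackRhs (hq : q.Regular T) {P : ℕ → ℝ → Matrix ι ι ℝ}
    {Θ : ℕ → ℝ → Matrix κ ι ℝ} (hP : UnifBdd T P) (hΘ : UnifBdd T Θ) :
    UnifBdd T fun k t => q.feedbackRhs t (Θ k t) (P k t) :=
  have hA' := hq.A.unifBdd.add (hq.B.unifBdd.mul hΘ)
  have hC' := hq.C.unifBdd.add (hq.D.unifBdd.mul hΘ)
  (((hP.mul hA').add (hA'.transpose.mul hP)).add ((hC'.transpose.mul hP).mul hC')).add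
    (hq.Q.unifBdd.add ((hΘ.transpose.mul hq.R.unifBdd).mul hΘ))

omit [DecidableEq ι] in
theorem tendsto_optFeedback {t : ℝ} {P : Matrix ι ι ℝ} {Pk : ℕ → Matrix ι ι ℝ}
    (hPk : Tendsto Pk atTop (𝓝 P)) (hu : IsUnit (q.M₁ t P)) :
    Tendsto (fun k => q.optFeedback t (Pk k)) atTop (𝓝 (q.optFeedback t P)) := by
  have hinv : Tendsto (fun k => (q.M₁ t (Pk k))⁻¹) atTop (𝓝 (q.M₁ t P)⁻¹) := by
    have hc : ContinuousAt (Inv.inv : Matrix κ κ ℝ → Matrix κ κ ℝ) (q.M₁ t P) := by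
      refine continuousAt_matrix_inv _ ?_
      rw [Ring.inverse_eq_inv']
      exact continuousAt_inv₀ ((isUnit_iff_isUnit_det _).1 hu).ne_zero
    refine hc.tendsto.comp ?_
    exact ((by unfold LQ.M₁; fun_prop : Continuous fun M => q.M₁ t M).tendsto _).comp hPk
  have hM2 : Tendsto (fun k => q.M₂ t (Pk k)) atTop (𝓝 (q.M₂ t P)) :=
    ((by unfold LQ.M₂; fun_prop : Continuous fun M => q.M₂ t M).tendsto _).comp hPk
  have hmul : Continuous fun z : Matrix κ κ ℝ × Matrix κ ι ℝ => -(z.1 * z.2) := by fun_prop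
  have h := (hmul.tendsto ((q.M₁ t P)⁻¹, q.M₂ t P)).comp (hinv.prodMk_nhds hM2)
  exact h

omit [DecidableEq ι] [DecidableEq κ] in
theorem tendsto_feedbackRhs {t : ℝ} {P : Matrix ι ι ℝ} {Pk : ℕ → Matrix ι ι ℝ}
    {Θ : Matrix κ ι ℝ} {Θk : ℕ → Matrix κ ι ℝ} (hP : Tendsto Pk atTop (𝓝 P))
    (hΘ : Tendsto Θk atTop (𝓝 Θ)) :
    Tendsto (fun k => q.feedbackRhs t (Θk k) (Pk k)) atTop (𝓝 (q.feedbackRhs t Θ P)) := by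
  have hφ : Continuous fun z : Matrix κ ι ℝ × Matrix ι ι ℝ => q.feedbackRhs t z.1 z.2 := by
    unfold feedbackRhs lyapunovRhs; fun_prop
  have h := (hφ.tendsto (Θ, P)).comp (hΘ.prodMk_nhds hP)
  exact h

/-- The Riccati equation has a solution on the whole interval, with an explicit lower bound. It is
the limit of policy iteration: each stage solves a linear equation, the values decrease from stage
to stage by completing the square, and the lower bound, which is the same for all feedbacks, keeps
`R + Dᵀ P D` uniformly invertible. -/
theorem exists_riccati_solution (hq : q.Regular T) (hT : 0 ≤ T) {δ l : ℝ} (hδ : 0 < δ)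
    (hl : 0 ≤ l) (hcoer : q.Coercive T δ l) (hctrl : q.ControlCoercive T) {PT : Matrix ι ι ℝ}
    (hPTs : PTᵀ = PT) (hPT : ∀ v, δ * (v ⬝ᵥ v) ≤ v ⬝ᵥ PT *ᵥ v) :
    ∃ P : ℝ → Matrix ι ι ℝ, P T = PT ∧ IsBackwardIntegral T P (fun t => q.riccatiRhs t (P t)) ∧
      (∀ t ∈ Icc 0 T, (P t)ᵀ = P t) ∧
      ∀ t ∈ Icc 0 T, ∀ v, δ * Real.exp (-(l * T)) * (v ⬝ᵥ v) ≤ v ⬝ᵥ P t *ᵥ v := by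
  have hTm : T ∈ Icc 0 T := ⟨hT, le_rfl⟩
  set p := δ * Real.exp (-(l * T)) with hp
  have hp0 : 0 < p := by positivity
  obtain ⟨μ, hμ0, hμ⟩ := hctrl p hp0
  have hlow : ∀ x : PolicyStage q T PT, ∀ t ∈ Icc 0 T, ∀ v, p * (v ⬝ᵥ v) ≤ v ⬝ᵥ x.P t *ᵥ v :=
    fun x => feedback_lower_bound hq hT hδ.le hl hcoer x.Θ_essBdd x.eqn x.symm
      (by rw [x.terminal]; exact hPT)
  -- Invertibility of `M₁` at any symmetric matrix above `p I`.
  have hM : ∀ᵐ t ∂(timeMeasure T), ∀ P : Matrix ι ι ℝ, (∀ v, p * (v ⬝ᵥ v) ≤ v ⬝ᵥ P *ᵥ v) →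
      (∀ w, μ * (w ⬝ᵥ w) ≤ w ⬝ᵥ q.M₁ t P *ᵥ w) ∧ IsUnit (q.M₁ t P) ∧
        ‖(q.M₁ t P)⁻¹‖ ≤ Fintype.card κ / μ := by
    filter_upwards [hμ] with t h1 P hP
    have h2 : ∀ w, μ * (w ⬝ᵥ w) ≤ w ⬝ᵥ q.M₁ t P *ᵥ w := fun w => by
      rw [dotProduct_M₁]
      exact (h1 w).trans (by gcongr; exact hP _)
    exact ⟨h2, isUnit_and_norm_inv_le_of_coercive hμ0 h2⟩
  have hPb : ∀ x : PolicyStage q T PT, EssBdd T x.P := fun x =>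
    EssBdd.of_continuousOn (x.eqn.continuousOn hT)
  have hnext : ∀ x : PolicyStage q T PT, ∃ y : PolicyStage q T PT,
      y.Θ = fun t => q.optFeedback t (x.P t) := by
    intro x
    refine exists_policyStage hq hT hPTs (EssBdd.neg (EssBdd.mul
      (EssBdd.inv (hq.M₁ (hPb x)) (C := Fintype.card κ / μ) ?_) (hq.M₂ (hPb x))))
    filter_upwards [hM, ae_timeMeasure_mem_Icc] with t h1 ht
    exact (h1 _ (hlow x t ht)).2.2
  choose next hnext using hnext
  obtain ⟨x0, -⟩ := exists_policyStage hq hT hPTs (Θ := fun _ => 0) (EssBdd.const 0)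
  set x : ℕ → PolicyStage q T PT := fun k => next^[k] x0 with hx
  have hxs : ∀ k, (x (k + 1)).Θ = fun t => q.optFeedback t ((x k).P t) := fun k => by
    rw [← hnext]
    simp only [hx, Function.iterate_succ_apply']
  -- The values decrease.
  have hanti : ∀ k, ∀ t ∈ Icc 0 T, ∀ v,
      v ⬝ᵥ (x (k + 1)).P t *ᵥ v ≤ v ⬝ᵥ (x k).P t *ᵥ v := by
    intro k
    set y := x k
    set z := x (k + 1) with hz
    have hzΘ : ∀ t, z.Θ t = q.optFeedback t (y.P t) := fun t => congrFun (hxs k) t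
    have hdiff : IsBackwardIntegral T (fun t => y.P t - z.P t) fun t =>
        lyapunovRhs (q.A t + q.B t * z.Θ t) (q.C t + q.D t * z.Θ t)
          ((y.Θ t - z.Θ t)ᵀ * q.M₁ t (y.P t) * (y.Θ t - z.Θ t)) (y.P t - z.P t) := by
      refine (y.eqn.sub z.eqn hT).congr_ae hT ?_
      filter_upwards [hM, hq.R_psd, ae_timeMeasure_mem_Icc] with t h1 h2 ht
      have hRs := (posSemidef_iff_real.1 h2).1
      have hu := (h1 _ (hlow y t ht)).2.1
      rw [feedbackRhs_eq hRs (y.symm t ht) hu, ← feedbackRhs_optFeedback hRs (y.symm t ht) hu,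
        ← hzΘ, feedbackRhs, feedbackRhs]
      simp only [lyapunovRhs]
      noncomm_ring
    have hpsd := IsBackwardIntegral.posSemidef_of_lyapunov hT (hq.A.add (hq.B.mul z.Θ_essBdd))
      (hq.C.add (hq.D.mul z.Θ_essBdd)) hdiff (by
        filter_upwards [hM, ae_timeMeasure_mem_Icc] with t h1 ht v
        simp only [← mulVec_mulVec, dotProduct_mulVec_transpose]
        exact (mul_nonneg hμ0.le (dotProduct_self_nonneg' _)).trans
          ((h1 _ (hlow y t ht)).1 _))
      (fun t ht => by rw [transpose_sub, y.symm t ht, z.symm t ht])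
      (by rw [y.terminal, z.terminal, sub_self]; exact PosSemidef.zero)
    intro t ht v
    have := (posSemidef_iff_real.1 (hpsd t ht)).2 v
    rw [sub_mulVec, dotProduct_sub] at this
    linarith
  have hpos : ∀ k, ∀ t ∈ Icc 0 T, ∀ v, 0 ≤ v ⬝ᵥ (x k).P t *ᵥ v := fun k t ht v =>
    (mul_nonneg hp0.le (dotProduct_self_nonneg' v)).trans (hlow _ t ht v)
  have hconv : ∀ t, ∃ L, t ∈ Icc 0 T → Tendsto (fun k => (x k).P t) atTop (𝓝 L) := by
    intro t
    by_cases ht : t ∈ Icc 0 T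
    · obtain ⟨L, hL⟩ := exists_tendsto_of_antitone (fun k => (x k).symm t ht)
        (fun k => hpos k t ht) fun k => hanti k t ht
      exact ⟨L, fun _ => hL⟩
    · exact ⟨0, fun h => absurd h ht⟩
  choose P hP using hconv
  have hPs : ∀ t ∈ Icc 0 T, (P t)ᵀ = P t := fun t ht =>
    tendsto_nhds_unique ((((by fun_prop : Continuous fun M : Matrix ι ι ℝ => Mᵀ).tendsto _).comp
      (hP t ht)).congr fun k => (x k).symm t ht) (hP t ht)
  have hPlow : ∀ t ∈ Icc 0 T, ∀ v, p * (v ⬝ᵥ v) ≤ v ⬝ᵥ P t *ᵥ v := fun t ht v =>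
    ge_of_tendsto (((by unfold dotProduct mulVec dotProduct; fun_prop :
      Continuous fun M : Matrix ι ι ℝ => v ⬝ᵥ M *ᵥ v).tendsto _).comp (hP t ht))
      (.of_forall fun k => hlow (x k) t ht v)
  -- Uniform bounds, for dominated convergence.
  have hPunif : UnifBdd T fun k => (x k).P := by
    obtain ⟨C, hC0, hC⟩ := (hPb (x 0)).exists_bound
    refine ⟨Fintype.card ι * |Fintype.card ι * C|, fun k => ?_⟩
    filter_upwards [hC, ae_timeMeasure_mem_Icc] with t h1 ht
    refine norm_le_of_posSemidef (posSemidef_iff_real.2 ⟨(x k).symm t ht, hpos k t ht⟩) fun v => ?_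
    have h2 : v ⬝ᵥ (x k).P t *ᵥ v ≤ v ⬝ᵥ (x 0).P t *ᵥ v :=
      antitone_nat_of_succ_le (f := fun k => v ⬝ᵥ (x k).P t *ᵥ v)
        (fun k => hanti k t ht v) (Nat.zero_le k)
    have h3 := (abs_le.1 (abs_dotProduct_mulVec_self_le ((x 0).P t) v)).2
    have := dotProduct_self_nonneg' v
    exact h2.trans (h3.trans (by gcongr))
  have hΘunif : UnifBdd T fun k => (x (k + 1)).Θ := by
    simp only [hxs]
    refine hq.unifBdd_optFeedback hPunif ⟨Fintype.card κ / μ, fun k => ?_⟩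
    filter_upwards [hM, ae_timeMeasure_mem_Icc] with t h1 ht
    exact (h1 _ (hlow (x k) t ht)).2.2
  have hgunif : UnifBdd T fun k t => q.feedbackRhs t ((x (k + 1)).Θ t) ((x (k + 1)).P t) :=
    hq.unifBdd_feedbackRhs (hPunif.imp fun C h k => h (k + 1)) hΘunif
  obtain ⟨C, hC⟩ := hgunif
  refine ⟨P, ?_, ?_, hPs, hPlow⟩
  · exact tendsto_nhds_unique (hP T hTm)
      (tendsto_const_nhds.congr fun k => (x k).terminal.symm)
  · refine IsBackwardIntegral.of_tendsto hT (fun k => (x (k + 1)).eqn) hC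
      (fun t ht => (tendsto_add_atTop_iff_nat 1).2 (hP t ht)) ?_
    filter_upwards [hM, hq.R_psd, ae_timeMeasure_mem_Icc] with t h1 h2 ht
    have hRs := (posSemidef_iff_real.1 h2).1
    have hu := (h1 _ (hPlow t ht)).2.1
    rw [← feedbackRhs_optFeedback hRs (hPs t ht) hu]
    refine tendsto_feedbackRhs ((tendsto_add_atTop_iff_nat 1).2 (hP t ht)) ?_
    simp only [hxs]
    exact tendsto_optFeedback (hP t ht) hu

end LQ

/-! ### The partial Legendre transform of a Riccati solution -/

section Transform

variable {n m : ℕ}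

/-- The matrix `[[P₁, P₂ᵀ], [P₂, -P₃]]`. Its graph is obtained from the graph `(p, q) = P (x, y)` of
`P` by exchanging `y` and `-q`, that is, `(p, y) = Q (x, -q)`. -/
noncomputable def transformQ (P : Matrix (Fin n ⊕ Fin m) (Fin n ⊕ Fin m) ℝ) :
    Matrix (Fin n ⊕ Fin m) (Fin n ⊕ Fin m) ℝ :=
  fromBlocks (P₁ P) (P₂ P)ᵀ (P₂ P) (-(P₃ P))

/-- The projection onto the first block. -/
def proj₁ : Matrix (Fin n ⊕ Fin m) (Fin n ⊕ Fin m) ℝ := fromBlocks 1 0 0 0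

/-- The projection onto the second block. -/
def proj₂ : Matrix (Fin n ⊕ Fin m) (Fin n ⊕ Fin m) ℝ := fromBlocks 0 0 0 1

variable {P P' : Matrix (Fin n ⊕ Fin m) (Fin n ⊕ Fin m) ℝ}

theorem transpose_toBlocks₂₁ (hP : Pᵀ = P) : P.toBlocks₂₁ᵀ = P.toBlocks₁₂ := by
  ext a b
  exact congrFun (congrFun hP _) _

theorem transpose_toBlocks₂₂ (hP : Pᵀ = P) : P.toBlocks₂₂ᵀ = P.toBlocks₂₂ := by
  ext a b
  exact congrFun (congrFun hP _) _

theorem transpose_toBlocks₁₁ (hP : Pᵀ = P) : P.toBlocks₁₁ᵀ = P.toBlocks₁₁ := by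
  ext a b
  exact congrFun (congrFun hP _) _

theorem transpose_P₁ (hP : Pᵀ = P) : (P₁ P)ᵀ = P₁ P := by
  simp only [P₁, transpose_sub, transpose_mul, transpose_transpose, transpose_nonsing_inv,
    transpose_toBlocks₁₁ hP, transpose_toBlocks₂₂ hP, Matrix.mul_assoc]

theorem proj₁_sub_proj₂_mul (P : Matrix (Fin n ⊕ Fin m) (Fin n ⊕ Fin m) ℝ) :
    proj₁ - proj₂ * P = fromBlocks 1 0 (-P.toBlocks₂₁) (-P.toBlocks₂₂) := by
  conv_lhs => rw [← fromBlocks_toBlocks P]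
  rw [proj₁, proj₂, fromBlocks_multiply, sub_eq_add_neg, fromBlocks_neg, fromBlocks_add]
  simp

theorem proj₁_mul_add_proj₂ (P : Matrix (Fin n ⊕ Fin m) (Fin n ⊕ Fin m) ℝ) :
    proj₁ * P + proj₂ = fromBlocks P.toBlocks₁₁ P.toBlocks₁₂ 0 1 := by
  conv_lhs => rw [← fromBlocks_toBlocks P]
  rw [proj₁, proj₂, fromBlocks_multiply, fromBlocks_add]
  simp

theorem transformQ_mul (hP : Pᵀ = P) (hu : IsUnit P.toBlocks₂₂) :
    transformQ P * (proj₁ - proj₂ * P) = proj₁ * P + proj₂ := by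
  have hdet := (isUnit_iff_isUnit_det _).1 hu
  rw [proj₁_sub_proj₂_mul, proj₁_mul_add_proj₂, transformQ, fromBlocks_multiply, P₁, P₂, P₃]
  simp only [transpose_neg, transpose_mul, transpose_nonsing_inv, transpose_toBlocks₂₂ hP,
    transpose_toBlocks₂₁ hP]
  congr 1 <;> simp [Matrix.mul_assoc, nonsing_inv_mul _ hdet]

theorem mul_proj₁_add (hu : IsUnit P.toBlocks₂₂) :
    (proj₁ - proj₂ * P) * (proj₁ + proj₂ * transformQ P) = 1 := by
  have hdet := (isUnit_iff_isUnit_det _).1 hu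
  have h : proj₁ + proj₂ * transformQ P = fromBlocks 1 0 (P₂ P) (-(P₃ P)) := by
    rw [proj₁, proj₂, transformQ, fromBlocks_multiply, fromBlocks_add]
    simp
  rw [proj₁_sub_proj₂_mul, h, fromBlocks_multiply, ← fromBlocks_one, P₂, P₃]
  congr 1 <;> simp [mul_nonsing_inv_cancel_left _ _ hdet, mul_nonsing_inv _ hdet]

/-- The difference formula for the transform, from which it inherits Lipschitz bounds and
derivatives. -/
theorem transformQ_sub_transformQ (hP : Pᵀ = P) (hu : IsUnit P.toBlocks₂₂) (hP' : P'ᵀ = P')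
    (hu' : IsUnit P'.toBlocks₂₂) :
    transformQ P' - transformQ P =
      (proj₁ + transformQ P * proj₂) * (P' - P) * (proj₁ + proj₂ * transformQ P') := by
  have h1 := transformQ_mul hP hu
  have h2 := transformQ_mul hP' hu'
  have h3 : (transformQ P' - transformQ P) * (proj₁ - proj₂ * P') =
      (proj₁ + transformQ P * proj₂) * (P' - P) := by
    have : transformQ P * (proj₁ - proj₂ * P') =
        transformQ P * (proj₁ - proj₂ * P) - transformQ P * proj₂ * (P' - P) := by noncomm_ring
    rw [Matrix.sub_mul, h2, this, h1]
    noncomm_ring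
  rw [← h3, Matrix.mul_assoc, mul_proj₁_add hu', Matrix.mul_one]

theorem proj₁_mulVec (a : Fin n → ℝ) (b : Fin m → ℝ) :
    proj₁ *ᵥ Sum.elim a b = Sum.elim a (0 : Fin m → ℝ) := by
  simp [proj₁, fromBlocks_mulVec]

theorem proj₂_mulVec (a : Fin n → ℝ) (b : Fin m → ℝ) :
    proj₂ *ᵥ Sum.elim a b = Sum.elim (0 : Fin n → ℝ) b := by
  simp [proj₂, fromBlocks_mulVec]

theorem elim_add {α β : Type*} (a a' : α → ℝ) (b b' : β → ℝ) :
    Sum.elim a b + Sum.elim a' b' = Sum.elim (a + a') (b + b') := by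
  ext (i | i) <;> rfl

theorem elim_sub {α β : Type*} (a a' : α → ℝ) (b b' : β → ℝ) :
    Sum.elim a b - Sum.elim a' b' = Sum.elim (a - a') (b - b') := by
  ext (i | i) <;> rfl

theorem elim_dotProduct_elim {α β : Type*} [Fintype α] [Fintype β] (a a' : α → ℝ)
    (b b' : β → ℝ) : Sum.elim a b ⬝ᵥ Sum.elim a' b' = a ⬝ᵥ a' + b ⬝ᵥ b' := by
  simp [dotProduct, Fintype.sum_sum_type]

theorem exists_eq_elim {α β : Type*} (v : α ⊕ β → ℝ) : ∃ a b, v = Sum.elim a b :=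
  ⟨v ∘ Sum.inl, v ∘ Sum.inr, (Sum.elim_comp_inl_inr v).symm⟩

theorem transformQ_mulVec (hP : Pᵀ = P) (hu : IsUnit P.toBlocks₂₂) {x p : Fin n → ℝ}
    {y q : Fin m → ℝ} (h : P *ᵥ Sum.elim x y = Sum.elim p q) :
    transformQ P *ᵥ Sum.elim x (-q) = Sum.elim p y := by
  have h1 := congrArg (· *ᵥ Sum.elim x y) (transformQ_mul hP hu)
  simp only [← mulVec_mulVec, sub_mulVec, add_mulVec, h, proj₁_mulVec, proj₂_mulVec, elim_sub,
    elim_add, sub_zero, zero_sub, add_zero, zero_add] at h1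
  exact h1

theorem mulVec_of_transformQ_mulVec (hP : Pᵀ = P) (hu : IsUnit P.toBlocks₂₂) {x p : Fin n → ℝ}
    {y q : Fin m → ℝ} (h : transformQ P *ᵥ Sum.elim x (-q) = Sum.elim p y) :
    P *ᵥ Sum.elim x y = Sum.elim p q := by
  have h1 := congrArg (· *ᵥ Sum.elim x (-q)) (mul_proj₁_add (P := P) hu)
  obtain ⟨p', q', hpq⟩ := exists_eq_elim (P *ᵥ Sum.elim x y)
  simp only [← mulVec_mulVec, sub_mulVec, add_mulVec, h, hpq, proj₁_mulVec, proj₂_mulVec, elim_sub,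
    elim_add, one_mulVec, add_zero, zero_add, zero_sub, sub_zero] at h1
  have h2 : q' = q := by
    ext i
    simpa using congrFun h1 (Sum.inr i)
  have h3 := transformQ_mulVec hP hu hpq
  rw [h2, h] at h3
  have h4 : p = p' := by
    ext i
    simpa using congrFun h3 (Sum.inl i)
  rw [hpq, h2, h4]

end Transform

section TransformEquation

variable {n m k : ℕ} (d : Data n m k)

/-- The transform carries the Riccati equation into the equation for `Q`. With `η = P ξ`, the
optimal control `w = -M₁⁻¹ M₂ ξ` and `ζ = P (C̃ ξ + D̃ w)`, the first-order condition
`R̃ w + B̃ᵀ η + D̃ᵀ ζ = 0` says that, in the exchanged variables, `ζ` satisfies the linear equation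
that defines `K`. -/
theorem transform_riccatiRhs {t : ℝ} {P : Matrix (Fin n ⊕ Fin m) (Fin n ⊕ Fin m) ℝ} (hP : Pᵀ = P)
    (hu : IsUnit P.toBlocks₂₂) (hD : IsUnit (d.D₄ t)) (hM : IsUnit (d.M₁ t P))
    (hK : IsUnit (1 - transformQ P * d.tC₂ t)) :
    (proj₁ + transformQ P * proj₂) * d.riccatiRhs t P =
      d.qRhs t (transformQ P) * (proj₁ - proj₂ * P) := by
  have hMdet := (isUnit_iff_isUnit_det _).1 hM
  have hDdet := (isUnit_iff_isUnit_det _).1 hD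
  have hKdet := (isUnit_iff_isUnit_det _).1 hK
  set Q := transformQ P with hQ
  refine mulVec_injective (funext fun ξ => ?_)
  obtain ⟨x, y, rfl⟩ := exists_eq_elim ξ
  obtain ⟨p, q, hpq⟩ := exists_eq_elim (P *ᵥ Sum.elim x y)
  obtain ⟨u, z, huz⟩ := exists_eq_elim (-((d.M₁ t P)⁻¹ * d.M₂ t P) *ᵥ Sum.elim x y)
  obtain ⟨c₁, c₂, hc⟩ := exists_eq_elim
    (d.rC t *ᵥ Sum.elim x y + d.rD t *ᵥ Sum.elim u z)
  obtain ⟨ζp, ζq, hζ⟩ := exists_eq_elim (P *ᵥ Sum.elim c₁ c₂)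
  obtain ⟨a₁, a₂, ha⟩ := exists_eq_elim
    (d.rA t *ᵥ Sum.elim x y + d.rB t *ᵥ Sum.elim u z)
  obtain ⟨π₁, π₂, hπ⟩ := exists_eq_elim (P *ᵥ Sum.elim a₁ a₂)
  obtain ⟨r₁, r₂, hr⟩ := exists_eq_elim ((d.rA t)ᵀ *ᵥ Sum.elim p q + (d.rC t)ᵀ *ᵥ Sum.elim ζp ζq
    + d.rQ t *ᵥ Sum.elim x y)
  -- The first-order condition.
  have hopt : d.rR t *ᵥ Sum.elim u z + (d.rD t)ᵀ *ᵥ Sum.elim ζp ζq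
      + (d.rB t)ᵀ *ᵥ Sum.elim p q = 0 := by
    have h1 : d.M₁ t P *ᵥ Sum.elim u z + d.M₂ t P *ᵥ Sum.elim x y = 0 := by
      rw [← huz, mulVec_mulVec, Matrix.mul_neg, mul_nonsing_inv_cancel_left _ _ hMdet, neg_mulVec,
        neg_add_cancel]
    rw [← h1, ← hζ, ← hc, ← hpq]
    simp only [Data.M₁, Data.M₂, add_mulVec, mulVec_add, ← mulVec_mulVec]
    abel
  have hric : d.riccatiRhs t P *ᵥ Sum.elim x y = Sum.elim (π₁ + r₁) (π₂ + r₂) := by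
    have h1 : d.riccatiRhs t P *ᵥ Sum.elim x y = P *ᵥ d.rA t *ᵥ Sum.elim x y
        + (d.rA t)ᵀ *ᵥ Sum.elim p q + (d.rC t)ᵀ *ᵥ P *ᵥ d.rC t *ᵥ Sum.elim x y
        + d.rQ t *ᵥ Sum.elim x y + (d.M₂ t P)ᵀ *ᵥ Sum.elim u z := by
      rw [← huz, ← hpq, Data.riccatiRhs, sub_mulVec, neg_mulVec, mulVec_neg, ← sub_eq_add_neg]
      simp only [add_mulVec, ← mulVec_mulVec]
    rw [h1, ← elim_add, ← hπ, ← ha, ← hr, ← hζ, ← hc]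
    simp only [Data.M₂, transpose_add, transpose_mul, transpose_transpose, hP, add_mulVec,
      mulVec_add, ← mulVec_mulVec]
    abel
  have hc₂ : c₂ = z := by
    ext i
    have := congrFun hc (Sum.inr i)
    simpa [Data.rC, Data.rD, fromBlocks_mulVec] using this.symm
  subst hc₂
  have g₁ := transformQ_mulVec hP hu hpq
  have g₂ := transformQ_mulVec hP hu hζ
  have g₃ := transformQ_mulVec hP hu hπ
  rw [← hQ] at g₁ g₂ g₃
  have hu' : u = -((d.D₄ t)⁻¹ *ᵥ ((d.D₁ t)ᵀ *ᵥ p - (d.D₃ t)ᵀ *ᵥ q + (d.D₂ t)ᵀ *ᵥ ζp)) := by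
    have h1 : d.D₄ t *ᵥ u = -((d.D₁ t)ᵀ *ᵥ p - (d.D₃ t)ᵀ *ᵥ q + (d.D₂ t)ᵀ *ᵥ ζp) := by
      ext i
      have := congrFun hopt (Sum.inl i)
      simp [Data.rR, Data.rD, Data.rB, fromBlocks_mulVec, fromBlocks_transpose, neg_mulVec] at this
      simp only [Pi.neg_apply, Pi.add_apply, Pi.sub_apply]
      linarith
    rw [← mulVec_neg, ← h1, mulVec_mulVec, nonsing_inv_mul _ hDdet, one_mulVec]
  have hζq : -ζq = d.C₄ t *ᵥ c₂ + (d.C₁ t)ᵀ *ᵥ p - (d.C₃ t)ᵀ *ᵥ q + (d.C₂ t)ᵀ *ᵥ ζp := by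
    ext i
    have := congrFun hopt (Sum.inr i)
    simp [Data.rR, Data.rD, Data.rB, fromBlocks_mulVec, fromBlocks_transpose, neg_mulVec] at this
    simp only [Pi.neg_apply, Pi.add_apply, Pi.sub_apply]
    linarith
  have hc₁ : c₁ = d.A₂ t *ᵥ x + d.B₂ t *ᵥ y + d.D₂ t *ᵥ u + d.C₂ t *ᵥ c₂ := by
    ext i
    have := congrFun hc (Sum.inl i)
    simp [Data.rC, Data.rD, fromBlocks_mulVec] at this
    simp only [Pi.add_apply]
    linarith
  have ha₁ : a₁ = d.A₁ t *ᵥ x + d.B₁ t *ᵥ y + d.D₁ t *ᵥ u + d.C₁ t *ᵥ c₂ := by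
    ext i
    have := congrFun ha (Sum.inl i)
    simp [Data.rA, Data.rB, fromBlocks_mulVec] at this
    simp only [Pi.add_apply]
    linarith
  have ha₂ : -a₂ = d.A₃ t *ᵥ x + d.B₃ t *ᵥ y + d.D₃ t *ᵥ u + d.C₃ t *ᵥ c₂ := by
    ext i
    have := congrFun ha (Sum.inr i)
    simp [Data.rA, Data.rB, fromBlocks_mulVec, neg_mulVec] at this
    simp only [Pi.add_apply, Pi.neg_apply]
    linarith
  have hr₁ : r₁ = (d.A₁ t)ᵀ *ᵥ p - (d.A₃ t)ᵀ *ᵥ q + (d.A₂ t)ᵀ *ᵥ ζp + d.A₄ t *ᵥ x := by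
    ext i
    have := congrFun hr (Sum.inl i)
    simp [Data.rA, Data.rC, Data.rQ, fromBlocks_mulVec, fromBlocks_transpose, neg_mulVec] at this
    simp only [Pi.add_apply, Pi.sub_apply]
    linarith
  have hr₂ : r₂ = (d.B₁ t)ᵀ *ᵥ p - (d.B₃ t)ᵀ *ᵥ q + (d.B₂ t)ᵀ *ᵥ ζp + d.B₄ t *ᵥ y := by
    ext i
    have := congrFun hr (Sum.inr i)
    simp [Data.rA, Data.rC, Data.rQ, fromBlocks_mulVec, fromBlocks_transpose, neg_mulVec] at this
    simp only [Pi.add_apply, Pi.sub_apply]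
    linarith
  -- The diffusion, the drift and the adjoint drift in the exchanged variables.
  have k₂ : d.tA₂ t *ᵥ Sum.elim x (-q) + d.tB₂ t *ᵥ Sum.elim p y + d.tC₂ t *ᵥ Sum.elim ζp c₂ =
      Sum.elim c₁ (-ζq) := by
    rw [hζq, hc₁, hu']
    simp only [Data.tA₂, Data.tB₂, Data.tC₂, fromBlocks_mulVec, Sum.elim_comp_inl,
      Sum.elim_comp_inr, elim_add, mulVec_neg, neg_mulVec, mulVec_add, ← mulVec_mulVec,
      zero_mulVec, neg_neg, neg_add, sub_eq_add_neg]
    congr 1 <;> abel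
  have k₁ : d.tA₁ t *ᵥ Sum.elim x (-q) + d.tB₁ t *ᵥ Sum.elim p y + d.tC₁ t *ᵥ Sum.elim ζp c₂ =
      Sum.elim a₁ r₂ := by
    rw [ha₁, hr₂, hu']
    simp only [Data.tA₁, Data.tB₁, Data.tC₁, fromBlocks_mulVec, Sum.elim_comp_inl,
      Sum.elim_comp_inr, elim_add, mulVec_neg, neg_mulVec, mulVec_add, ← mulVec_mulVec,
      zero_mulVec, neg_neg, neg_add, sub_eq_add_neg]
    congr 1 <;> abel
  have k₃ : d.tA₃ t *ᵥ Sum.elim x (-q) + d.tB₃ t *ᵥ Sum.elim p y + d.tC₃ t *ᵥ Sum.elim ζp c₂ =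
      Sum.elim r₁ (-a₂) := by
    rw [ha₂, hr₁, hu']
    simp only [Data.tA₃, Data.tB₃, Data.tC₃, fromBlocks_mulVec, Sum.elim_comp_inl,
      Sum.elim_comp_inr, elim_add, mulVec_neg, neg_mulVec, mulVec_add, ← mulVec_mulVec,
      zero_mulVec, neg_neg, neg_add, sub_eq_add_neg]
    congr 1 <;> abel
  have hKv : d.K t Q *ᵥ Sum.elim x (-q) = Sum.elim ζp c₂ := by
    have h1 : (1 - Q * d.tC₂ t) *ᵥ Sum.elim ζp c₂ =
        (Q * d.tA₂ t + Q * d.tB₂ t * Q) *ᵥ Sum.elim x (-q) := by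
      simp only [sub_mulVec, add_mulVec, one_mulVec, ← mulVec_mulVec, g₁]
      rw [sub_eq_iff_eq_add, ← mulVec_add, ← mulVec_add, k₂, g₂]
    rw [Data.K, ← mulVec_mulVec, ← h1, mulVec_mulVec, nonsing_inv_mul _ hKdet, one_mulVec]
  have hW : (proj₁ - proj₂ * P) *ᵥ Sum.elim x y = Sum.elim x (-q) := by
    rw [sub_mulVec, ← mulVec_mulVec, hpq, proj₁_mulVec, proj₂_mulVec, elim_sub, sub_zero, zero_sub]
  have hqv : d.qRhs t Q *ᵥ Sum.elim x (-q) = Q *ᵥ Sum.elim a₁ r₂ + Sum.elim r₁ (-a₂) := by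
    rw [← k₁, ← k₃]
    simp only [Data.qRhs, add_mulVec, ← mulVec_mulVec, hKv, g₁, mulVec_add]
    abel
  rw [← mulVec_mulVec, ← mulVec_mulVec, hric, hW, hqv, add_mulVec, ← mulVec_mulVec, proj₁_mulVec,
    proj₂_mulVec]
  have e₁ : (Sum.elim (π₁ + r₁) (0 : Fin m → ℝ)) = Sum.elim π₁ a₂ + Sum.elim r₁ (-a₂) := by
    rw [elim_add, add_neg_cancel]
  have e₂ : (Sum.elim (0 : Fin n → ℝ) (π₂ + r₂)) =
      Sum.elim a₁ r₂ - Sum.elim a₁ (-π₂) := by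
    rw [elim_sub, sub_self, sub_neg_eq_add, add_comm]
  rw [e₁, e₂, mulVec_sub, g₃]
  abel

end TransformEquation

/-! ### Invertibility of `I - Q C̃₂` -/

section Invertibility

variable {n m k : ℕ} (d : Data n m k)

/-- `I - Q C'`, where `C' = [[0, C₂], [C₂ᵀ, C₄]]` is the part of `C̃₂` that does not involve `D₂`,
and `Q = transformQ P`. -/
noncomputable def baseMat (t : ℝ) (P : Matrix (Fin n ⊕ Fin m) (Fin n ⊕ Fin m) ℝ) :
    Matrix (Fin n ⊕ Fin m) (Fin n ⊕ Fin m) ℝ :=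
  1 - transformQ P * fromBlocks 0 (d.C₂ t) (d.C₂ t)ᵀ (d.C₄ t)

/-- The block inverse of `I - Q C'`: its lower right block is `L₁`, with Schur complement `L₂`. -/
noncomputable def baseInv (t : ℝ) (P : Matrix (Fin n ⊕ Fin m) (Fin n ⊕ Fin m) ℝ) :
    Matrix (Fin n ⊕ Fin m) (Fin n ⊕ Fin m) ℝ :=
  fromBlocks 1 0 (-((d.L₁ t P)⁻¹ * (P₃ P * (d.C₂ t)ᵀ))) 1 *
    fromBlocks (d.L₂ t P)⁻¹ 0 0 (d.L₁ t P)⁻¹ *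
    fromBlocks 1 ((P₁ P * d.C₂ t + (P₂ P)ᵀ * d.C₄ t) * (d.L₁ t P)⁻¹) 0 1

variable {d} {t : ℝ} {P : Matrix (Fin n ⊕ Fin m) (Fin n ⊕ Fin m) ℝ}

theorem baseInv_mul_baseMat (h₁ : IsUnit (d.L₁ t P)) (h₂ : IsUnit (d.L₂ t P)) :
    baseInv d t P * baseMat d t P = 1 := by
  have hd₁ := (isUnit_iff_isUnit_det _).1 h₁
  have hd₂ := (isUnit_iff_isUnit_det _).1 h₂
  set U := P₁ P * d.C₂ t + (P₂ P)ᵀ * d.C₄ t with hU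
  set X := P₃ P * (d.C₂ t)ᵀ with hX
  have hbase : baseMat d t P =
      fromBlocks (1 - (P₂ P)ᵀ * (d.C₂ t)ᵀ) (-U) X (d.L₁ t P) := by
    rw [baseMat, transformQ, fromBlocks_multiply, ← fromBlocks_one, sub_eq_add_neg,
      fromBlocks_neg, fromBlocks_add, hU, hX, Data.L₁]
    congr 1 <;> simp [sub_eq_add_neg, add_comm, add_assoc]
  have hL₂ : d.L₂ t P = 1 - (P₂ P)ᵀ * (d.C₂ t)ᵀ + U * (d.L₁ t P)⁻¹ * X := by
    rw [Data.L₂, hX, Matrix.mul_assoc (U * _)]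
  have e₁ : fromBlocks 1 (U * (d.L₁ t P)⁻¹) 0 1 * baseMat d t P =
      fromBlocks (d.L₂ t P) 0 X (d.L₁ t P) := by
    rw [hbase, fromBlocks_multiply, hL₂]
    congr 1 <;> simp [Matrix.mul_assoc, nonsing_inv_mul _ hd₁]
  rw [baseInv, Matrix.mul_assoc, e₁, Matrix.mul_assoc, fromBlocks_multiply, fromBlocks_multiply,
    ← fromBlocks_one, ← hX]
  congr 1 <;> simp [nonsing_inv_mul _ hd₁, nonsing_inv_mul _ hd₂]

/-- The upper left block of `(I - Q C')⁻¹ Q`. -/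
noncomputable def gramBlock (d : Data n m k) (t : ℝ)
    (P : Matrix (Fin n ⊕ Fin m) (Fin n ⊕ Fin m) ℝ) : Matrix (Fin n) (Fin n) ℝ :=
  (baseInv d t P * transformQ P).toBlocks₁₁

/-- The quadratic form of `gramBlock` at `e` is `⟨ξ, P ξ⟩ + ⟨y, C₄ y⟩` for a suitable
`ξ = (x, y)`. -/
theorem gramBlock_nonneg (hP : Pᵀ = P) (hu : IsUnit P.toBlocks₂₂) (hpos : ∀ ξ, 0 ≤ ξ ⬝ᵥ P *ᵥ ξ)
    (hC : (d.C₄ t).PosSemidef) (h₁ : IsUnit (d.L₁ t P)) (h₂ : IsUnit (d.L₂ t P))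
    (e : Fin n → ℝ) : 0 ≤ e ⬝ᵥ gramBlock d t P *ᵥ e := by
  obtain ⟨p, y, hpy⟩ := exists_eq_elim ((baseInv d t P * transformQ P) *ᵥ Sum.elim e 0)
  have hp : gramBlock d t P *ᵥ e = p := by
    rw [gramBlock]
    ext i
    have h3 := congrFun hpy (Sum.inl i)
    rw [← fromBlocks_toBlocks (baseInv d t P * transformQ P), fromBlocks_mulVec] at h3
    simpa using h3
  have hbi : baseMat d t P * baseInv d t P = 1 := mul_eq_one_comm.1 (baseInv_mul_baseMat h₁ h₂)
  have h4 : baseMat d t P *ᵥ Sum.elim p y = transformQ P *ᵥ Sum.elim e 0 := by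
    rw [← hpy, mulVec_mulVec, ← Matrix.mul_assoc, hbi, Matrix.one_mul]
  have h5 : transformQ P *ᵥ Sum.elim (e + d.C₂ t *ᵥ y) (-(-((d.C₂ t)ᵀ *ᵥ p + d.C₄ t *ᵥ y))) =
      Sum.elim p y := by
    rw [baseMat, sub_mulVec, one_mulVec, ← mulVec_mulVec, fromBlocks_mulVec, sub_eq_iff_eq_add,
      ← mulVec_add] at h4
    rw [h4]
    simp [elim_add]
  have h6 := mulVec_of_transformQ_mulVec hP hu h5
  have h7 := hpos (Sum.elim (e + d.C₂ t *ᵥ y) y)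
  rw [h6, elim_dotProduct_elim] at h7
  simp only [add_dotProduct, dotProduct_neg, dotProduct_add] at h7
  rw [dotProduct_mulVec_transpose] at h7
  have h8 := (posSemidef_iff_real.1 hC).2 y
  rw [hp]
  linarith

/-- The matrix `D₄ + D₂ᵀ V D₂` with `V = gramBlock`. -/
noncomputable def controlGram (d : Data n m k) (t : ℝ)
    (P : Matrix (Fin n ⊕ Fin m) (Fin n ⊕ Fin m) ℝ) : Matrix (Fin k) (Fin k) ℝ :=
  d.D₄ t + (d.D₂ t)ᵀ * gramBlock d t P * d.D₂ t

theorem controlGram_coercive (hV : ∀ e, 0 ≤ e ⬝ᵥ gramBlock d t P *ᵥ e) {δ : ℝ}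
    (hD : ∀ u, δ * (u ⬝ᵥ u) ≤ u ⬝ᵥ d.D₄ t *ᵥ u) (u : Fin k → ℝ) :
    δ * (u ⬝ᵥ u) ≤ u ⬝ᵥ controlGram d t P *ᵥ u := by
  have h1 := hD u
  have h2 := hV (d.D₂ t *ᵥ u)
  simp only [controlGram, add_mulVec, dotProduct_add, ← mulVec_mulVec, dotProduct_mulVec_transpose]
  linarith

/-- The inverse of `I + V D₂ D₄⁻¹ D₂ᵀ`, by the Woodbury identity. -/
noncomputable def woodburyInv (d : Data n m k) (t : ℝ)
    (P : Matrix (Fin n ⊕ Fin m) (Fin n ⊕ Fin m) ℝ) : Matrix (Fin n) (Fin n) ℝ :=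
  1 - gramBlock d t P * d.D₂ t * (controlGram d t P)⁻¹ * (d.D₂ t)ᵀ

theorem woodburyInv_mul (hD : IsUnit (d.D₄ t)) (hG : IsUnit (controlGram d t P)) :
    woodburyInv d t P * (1 + gramBlock d t P * (d.D₂ t * (d.D₄ t)⁻¹ * (d.D₂ t)ᵀ)) = 1 := by
  have hd := (isUnit_iff_isUnit_det _).1 hD
  have hg := (isUnit_iff_isUnit_det _).1 hG
  set V := gramBlock d t P
  set G := controlGram d t P with hGdef
  have h1 : G⁻¹ * ((d.D₂ t)ᵀ * V * d.D₂ t) * (d.D₄ t)⁻¹ = (d.D₄ t)⁻¹ - G⁻¹ := by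
    have : (d.D₂ t)ᵀ * V * d.D₂ t = G - d.D₄ t := by rw [hGdef, controlGram, add_sub_cancel_left]
    rw [this, Matrix.mul_sub, nonsing_inv_mul _ hg, Matrix.sub_mul, Matrix.one_mul,
      Matrix.mul_assoc, mul_nonsing_inv _ hd, Matrix.mul_one]
  have h2 : V * d.D₂ t * G⁻¹ * (d.D₂ t)ᵀ * (V * (d.D₂ t * (d.D₄ t)⁻¹ * (d.D₂ t)ᵀ)) =
      V * d.D₂ t * (G⁻¹ * ((d.D₂ t)ᵀ * V * d.D₂ t) * (d.D₄ t)⁻¹) * (d.D₂ t)ᵀ := by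
    simp only [Matrix.mul_assoc]
  rw [woodburyInv, Matrix.sub_mul, Matrix.one_mul, Matrix.mul_add, Matrix.mul_one, h2, h1]
  simp only [Matrix.mul_sub, Matrix.sub_mul, Matrix.mul_assoc]
  abel

/-- The inverse of `I - Q C̃₂`. -/
noncomputable def fullInv (d : Data n m k) (t : ℝ)
    (P : Matrix (Fin n ⊕ Fin m) (Fin n ⊕ Fin m) ℝ) : Matrix (Fin n ⊕ Fin m) (Fin n ⊕ Fin m) ℝ :=
  fromBlocks (woodburyInv d t P) 0
    (-((baseInv d t P * transformQ P).toBlocks₂₁ * (d.D₂ t * (d.D₄ t)⁻¹ * (d.D₂ t)ᵀ)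
      * woodburyInv d t P)) 1 * baseInv d t P

theorem fullInv_mul (h₁ : IsUnit (d.L₁ t P)) (h₂ : IsUnit (d.L₂ t P)) (hD : IsUnit (d.D₄ t))
    (hG : IsUnit (controlGram d t P)) :
    fullInv d t P * (1 - transformQ P * d.tC₂ t) = 1 := by
  set S := d.D₂ t * (d.D₄ t)⁻¹ * (d.D₂ t)ᵀ with hS
  have h3 : d.tC₂ t = fromBlocks 0 (d.C₂ t) (d.C₂ t)ᵀ (d.C₄ t) - fromBlocks S 0 0 0 := by
    rw [Data.tC₂, sub_eq_add_neg, fromBlocks_neg, fromBlocks_add, hS]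
    simp
  have h4 : baseInv d t P * (1 - transformQ P * d.tC₂ t) =
      1 + baseInv d t P * transformQ P * fromBlocks S 0 0 0 := by
    have h := baseInv_mul_baseMat h₁ h₂
    rw [baseMat] at h
    rw [h3, Matrix.mul_sub (transformQ P), ← sub_add, Matrix.mul_add, h, Matrix.mul_assoc]
  set N := baseInv d t P * transformQ P with hN
  have h5 : 1 + N * fromBlocks S 0 0 0 =
      fromBlocks (1 + gramBlock d t P * S) 0 (N.toBlocks₂₁ * S) 1 := by
    rw [gramBlock, ← hN]
    conv_lhs => rw [← fromBlocks_toBlocks N, fromBlocks_multiply, ← fromBlocks_one, fromBlocks_add]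
    simp
  have h6 := woodburyInv_mul hD hG
  rw [← hS] at h6
  rw [fullInv, Matrix.mul_assoc, h4, h5, fromBlocks_multiply, ← fromBlocks_one, ← hN, ← hS, h6,
    Matrix.neg_mul, Matrix.mul_assoc (N.toBlocks₂₁ * S), h6]
  congr 1 <;> simp

end Invertibility

/-! ### The auxiliary Riccati equations -/

section Auxiliary

variable {n m k : ℕ} {d : Data n m k} {T : ℝ}

/-- The forward problem with state `(X, Y)` and control `(u, Z)`. -/
def Data.lq (d : Data n m k) : LQ (Fin n ⊕ Fin m) (Fin k ⊕ Fin m) :=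
  ⟨d.rA, d.rB, d.rC, d.rD, d.rQ, d.rR⟩

theorem posSemidef_fromBlocks_diagonal {α β : Type*} [Fintype α] [Fintype β] {A : Matrix α α ℝ}
    {B : Matrix β β ℝ} (hA : A.PosSemidef) (hB : B.PosSemidef) :
    (fromBlocks A 0 0 B).PosSemidef := by
  obtain ⟨hA1, hA2⟩ := posSemidef_iff_real.1 hA
  obtain ⟨hB1, hB2⟩ := posSemidef_iff_real.1 hB
  refine posSemidef_iff_real.2 ⟨by simp [fromBlocks_transpose, hA1, hB1], fun v => ?_⟩
  obtain ⟨a, b, rfl⟩ := exists_eq_elim v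
  rw [fromBlocks_mulVec, elim_dotProduct_elim]
  simpa using add_nonneg (hA2 a) (hB2 b)

theorem Data.Bounded.regular (hb : d.Bounded T) (hs : d.StateWeightsPos T)
    (hc : d.ControlWeightsPos T) : d.lq.Regular T where
  A := hb.A₁.essBdd.fromBlocks hb.B₁.essBdd hb.A₃.essBdd.neg hb.B₃.essBdd.neg
  B := hb.D₁.essBdd.fromBlocks hb.C₁.essBdd hb.D₃.essBdd.neg hb.C₃.essBdd.neg
  C := hb.A₂.essBdd.fromBlocks hb.B₂.essBdd (EssBdd.const 0) (EssBdd.const 0)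
  D := hb.D₂.essBdd.fromBlocks hb.C₂.essBdd (EssBdd.const 0) (EssBdd.const 1)
  Q := hb.A₄.essBdd.fromBlocks (EssBdd.const 0) (EssBdd.const 0) hb.B₄.essBdd
  R := hb.D₄.essBdd.fromBlocks (EssBdd.const 0) (EssBdd.const 0) hb.C₄.essBdd
  Q_psd := by
    filter_upwards [hs.A₄, hs.B₄] with t h1 h2
    exact posSemidef_fromBlocks_diagonal h1 h2
  R_psd := by
    filter_upwards [hc.D₄, hc.C₄] with t h1 h2
    exact posSemidef_fromBlocks_diagonal h1.posSemidef h2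

theorem Data.ControlWeightsPos.exists_coercive (hc : d.ControlWeightsPos T) :
    ∃ δ > 0, ∀ᵐ t ∂(timeMeasure T), ∀ u, δ * (u ⬝ᵥ u) ≤ u ⬝ᵥ d.D₄ t *ᵥ u := by
  obtain ⟨C, hC0, hC⟩ := hc.D₄_inv.essBdd.exists_bound
  refine ⟨((k : ℝ) * C + 1)⁻¹, by positivity, ?_⟩
  filter_upwards [hC, hc.D₄] with t h1 h2
  refine PosDef.coercive_of_inv_le h2 (by positivity) fun u => ?_
  have h3 := (abs_le.1 (abs_dotProduct_mulVec_self_le (d.D₄ t)⁻¹ u)).2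
  rw [Fintype.card_fin] at h3
  have h4 := dotProduct_self_nonneg' u
  have h5 : (k : ℝ) * ‖(d.D₄ t)⁻¹‖ * (u ⬝ᵥ u) ≤ k * C * (u ⬝ᵥ u) := by gcongr
  linarith

theorem two_mul_dotProduct_le {ι : Type*} [Fintype ι] (x y : ι → ℝ) {ε : ℝ} (hε : 0 < ε) :
    -(ε * (x ⬝ᵥ x) + ε⁻¹ * (y ⬝ᵥ y)) ≤ 2 * (x ⬝ᵥ y) := by
  have h := dotProduct_self_nonneg' (ε • x + y)
  simp only [add_dotProduct, dotProduct_add, smul_dotProduct, dotProduct_smul, smul_eq_mul] at h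
  rw [dotProduct_comm y x] at h
  have h1 := mul_nonneg (inv_nonneg.2 hε.le) h
  have h2 : ε⁻¹ * (ε * (ε * x ⬝ᵥ x) + ε * x ⬝ᵥ y + (ε * x ⬝ᵥ y + y ⬝ᵥ y)) =
      ε * (x ⬝ᵥ x) + 2 * (x ⬝ᵥ y) + ε⁻¹ * (y ⬝ᵥ y) := by
    field_simp
    ring
  linarith

theorem Data.lq_controlCoercive (hc : d.ControlWeightsPos T) : d.lq.ControlCoercive T := by
  intro p hp
  obtain ⟨δ, hδ, hD⟩ := hc.exists_coercive
  refine ⟨min δ p, lt_min hδ hp, ?_⟩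
  filter_upwards [hD, hc.C₄] with t h1 h2 w
  obtain ⟨u, z, rfl⟩ := exists_eq_elim w
  have h3 := h1 u
  have h4 := (posSemidef_iff_real.1 h2).2 z
  have h5 := dotProduct_self_nonneg' (d.D₂ t *ᵥ u + d.C₂ t *ᵥ z)
  have h6 := dotProduct_self_nonneg' u
  have h7 := dotProduct_self_nonneg' z
  simp only [Data.lq, Data.rR, Data.rD, fromBlocks_mulVec, elim_dotProduct_elim,
    Sum.elim_comp_inl, Sum.elim_comp_inr, zero_mulVec, add_zero, zero_add, one_mulVec]
  have h8 : min δ p * (u ⬝ᵥ u) ≤ δ * (u ⬝ᵥ u) := by gcongr; exact min_le_left _ _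
  have h9 : min δ p * (z ⬝ᵥ z) ≤ p * (z ⬝ᵥ z) := by gcongr; exact min_le_right _ _
  have := mul_nonneg hp.le h5
  linarith

/-- The noise acts on `Y` through the control `Z` alone and the control `u` has a uniformly positive
weight, so that both absorb the control terms in the drift. -/
theorem Data.lq_coercive (hb : d.Bounded T) (hs : d.StateWeightsPos T)
    (hc : d.ControlWeightsPos T) {δ : ℝ} (hδ : 0 < δ) :
    ∃ l, 0 ≤ l ∧ d.lq.Coercive T δ l := by
  obtain ⟨ε, hε, hD⟩ := hc.exists_coercive
  have hreg := hb.regular hs hc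
  obtain ⟨a, ha0, ha⟩ := hreg.A.exists_bound
  obtain ⟨b, hb0, hb'⟩ := (hreg.B.mul hreg.B.transpose).exists_bound
  set N : ℝ := (Fintype.card (Fin n ⊕ Fin m) : ℝ) with hN
  have hN0 : 0 ≤ N := by positivity
  refine ⟨2 * (N * a) + (1 + δ * ε⁻¹) * (N * b), by positivity, ?_⟩
  filter_upwards [hD, hc.C₄, ha, hb'] with t h1 h2 h3 h4 v w p hp0 hpδ
  obtain ⟨u, z, rfl⟩ := exists_eq_elim w
  obtain ⟨b₁, b₂, hbv⟩ := exists_eq_elim ((d.lq.B t)ᵀ *ᵥ v)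
  have e1 : v ⬝ᵥ d.lq.B t *ᵥ Sum.elim u z = u ⬝ᵥ b₁ + z ⬝ᵥ b₂ := by
    rw [dotProduct_comm, ← dotProduct_mulVec_transpose, hbv, elim_dotProduct_elim]
  have hvv := dotProduct_self_nonneg' v
  have f1 : -(N * a * (v ⬝ᵥ v)) ≤ v ⬝ᵥ d.lq.A t *ᵥ v := by
    have h5 := (abs_le.1 (abs_dotProduct_mulVec_self_le (d.lq.A t) v)).1
    have h6 : N * ‖d.lq.A t‖ * (v ⬝ᵥ v) ≤ N * a * (v ⬝ᵥ v) := by gcongr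
    rw [← hN] at h5
    linarith
  have f2 : b₁ ⬝ᵥ b₁ + b₂ ⬝ᵥ b₂ ≤ N * b * (v ⬝ᵥ v) := by
    have h5 := (abs_le.1 (abs_dotProduct_mulVec_self_le (d.lq.B t * (d.lq.B t)ᵀ) v)).2
    rw [← mulVec_mulVec, hbv, ← hN] at h5
    have h6 : v ⬝ᵥ d.lq.B t *ᵥ Sum.elim b₁ b₂ = b₁ ⬝ᵥ b₁ + b₂ ⬝ᵥ b₂ := by
      rw [dotProduct_comm, ← dotProduct_mulVec_transpose, hbv, elim_dotProduct_elim]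
    have h7 : N * ‖d.lq.B t * (d.lq.B t)ᵀ‖ * (v ⬝ᵥ v) ≤ N * b * (v ⬝ᵥ v) := by gcongr
    linarith
  have f3 := two_mul_dotProduct_le u (p • b₁) hε
  have f4 := two_mul_dotProduct_le z b₂ one_pos
  simp only [smul_dotProduct, dotProduct_smul, smul_eq_mul, one_mul, inv_one] at f3 f4
  have f5 := mul_le_mul_of_nonneg_left f4 hp0
  have f6 : z ⬝ᵥ z ≤ (d.lq.C t *ᵥ v + d.lq.D t *ᵥ Sum.elim u z) ⬝ᵥ
      (d.lq.C t *ᵥ v + d.lq.D t *ᵥ Sum.elim u z) := by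
    obtain ⟨x, y, rfl⟩ := exists_eq_elim v
    simp only [Data.lq, Data.rC, Data.rD, fromBlocks_mulVec, elim_dotProduct_elim, elim_add,
      Sum.elim_comp_inl, Sum.elim_comp_inr, zero_mulVec, add_zero, zero_add, one_mulVec]
    exact le_add_of_nonneg_left (dotProduct_self_nonneg' _)
  have f7 : ε * (u ⬝ᵥ u) ≤ Sum.elim u z ⬝ᵥ d.lq.R t *ᵥ Sum.elim u z := by
    simp only [Data.lq, Data.rR, fromBlocks_mulVec, elim_dotProduct_elim,
      Sum.elim_comp_inl, Sum.elim_comp_inr, zero_mulVec, add_zero, zero_add]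
    exact (h1 u).trans (le_add_of_nonneg_right ((posSemidef_iff_real.1 h2).2 z))
  have f8 := mul_le_mul_of_nonneg_left f6 hp0
  have hb1 := dotProduct_self_nonneg' b₁
  have hb2 := dotProduct_self_nonneg' b₂
  have f9 : ε⁻¹ * (p * (p * (b₁ ⬝ᵥ b₁))) ≤ p * (δ * ε⁻¹ * (b₁ ⬝ᵥ b₁)) := by
    calc ε⁻¹ * (p * (p * (b₁ ⬝ᵥ b₁))) ≤ ε⁻¹ * (p * (δ * (b₁ ⬝ᵥ b₁))) := by gcongr
      _ = _ := by ring
  have f10 : p * (b₂ ⬝ᵥ b₂ + δ * ε⁻¹ * (b₁ ⬝ᵥ b₁)) ≤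
      p * ((1 + δ * ε⁻¹) * (N * b * (v ⬝ᵥ v))) := by
    have g : 0 ≤ δ * ε⁻¹ := by positivity
    have : (1 + δ * ε⁻¹) * (b₁ ⬝ᵥ b₁ + b₂ ⬝ᵥ b₂) ≤ (1 + δ * ε⁻¹) * (N * b * (v ⬝ᵥ v)) := by
      gcongr
    have := mul_nonneg g hb2
    gcongr
    linarith
  have f11 := mul_le_mul_of_nonneg_left f1 hp0
  rw [dotProduct_add, e1]
  linarith

/-- The penalized terminal values are coercive, uniformly in the penalty `i ≥ 1`. -/
theorem exists_coercive_riccatiTerminal (hG : d.G.PosDef) :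
    ∃ δ > 0, ∀ i : ℕ, 1 ≤ i → ∀ v, δ * (v ⬝ᵥ v) ≤ v ⬝ᵥ d.riccatiTerminal i *ᵥ v := by
  obtain ⟨g, hg, hG⟩ := PosDef.exists_coercive hG
  set f : ℝ := n * ‖d.Fᵀ * d.F‖ with hf
  have hf0 : 0 ≤ f := by positivity
  refine ⟨min (g / (1 + 2 * f)) (1 / 2), lt_min (by positivity) (by norm_num), fun i hi v => ?_⟩
  set δ := min (g / (1 + 2 * f)) (1 / 2) with hδ
  have hδ0 : 0 < δ := lt_min (by positivity) (by norm_num)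
  have hδ1 : δ * (1 + 2 * f) ≤ g := by
    rw [← le_div_iff₀ (by positivity)]; exact min_le_left _ _
  have hδ2 : δ ≤ 1 / 2 := min_le_right _ _
  obtain ⟨x, y, rfl⟩ := exists_eq_elim v
  set r := d.F *ᵥ x - y with hr
  have hy : y = d.F *ᵥ x - r := by rw [hr]; abel
  have hquad : Sum.elim x y ⬝ᵥ d.riccatiTerminal i *ᵥ Sum.elim x y =
      x ⬝ᵥ d.G *ᵥ x + i * (r ⬝ᵥ r) := by
    simp only [Data.riccatiTerminal, fromBlocks_mulVec, elim_dotProduct_elim, Sum.elim_comp_inl,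
      Sum.elim_comp_inr, add_mulVec, neg_mulVec, smul_mulVec, one_mulVec, ← mulVec_mulVec,
      dotProduct_add, dotProduct_neg, dotProduct_smul, dotProduct_mulVec_transpose, smul_eq_mul,
      hr, sub_dotProduct, dotProduct_sub]
    rw [dotProduct_comm y (d.F *ᵥ x)]
    ring
  have hFx : (d.F *ᵥ x) ⬝ᵥ (d.F *ᵥ x) ≤ f * (x ⬝ᵥ x) := by
    have h := (abs_le.1 (abs_dotProduct_mulVec_self_le (d.Fᵀ * d.F) x)).2
    rwa [← mulVec_mulVec, dotProduct_mulVec_transpose, Fintype.card_fin, ← hf] at h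
  have hyy : y ⬝ᵥ y ≤ 2 * ((d.F *ᵥ x) ⬝ᵥ (d.F *ᵥ x)) + 2 * (r ⬝ᵥ r) := by
    have h := dotProduct_self_nonneg' (d.F *ᵥ x + r)
    rw [hy]
    simp only [add_dotProduct, dotProduct_add, sub_dotProduct, dotProduct_sub] at h ⊢
    linarith
  have hrr := dotProduct_self_nonneg' r
  have hxx := dotProduct_self_nonneg' x
  have hi' : (1 : ℝ) ≤ i := by exact_mod_cast hi
  rw [hquad, elim_dotProduct_elim]
  have g1 := hG x
  have g2 := mul_le_mul_of_nonneg_right hδ1 hxx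
  have g3 := mul_le_mul_of_nonneg_right hδ2 hrr
  have g4 := mul_le_mul_of_nonneg_right hi' hrr
  have g5 := mul_le_mul_of_nonneg_left (hyy.trans (add_le_add_left
    (mul_le_mul_of_nonneg_left hFx zero_le_two) _)) hδ0.le
  linarith

theorem transpose_riccatiTerminal (hG : d.G.IsSymm) (i : ℕ) :
    (d.riccatiTerminal i)ᵀ = d.riccatiTerminal i := by
  simp [Data.riccatiTerminal, fromBlocks_transpose, hG.eq]

theorem IsBackwardIntegral.apply {ι κ : Type*} [Fintype ι] [Fintype κ] {P g : ℝ → Matrix ι κ ℝ}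
    (h : IsBackwardIntegral T P g) (hT : 0 ≤ T) (a : ι) (b : κ) :
    IsBackwardIntegral T (fun t => P t a b) (fun t => g t a b) :=
  h.map hT (Matrix.entryLinearMap ℝ ℝ a b)

/-- The auxiliary Riccati equations have solutions with a lower bound that is uniform in `i`. -/
theorem exists_isRiccatiSolution (hT : 0 < T) (hb : d.Bounded T) (hs : d.StateWeightsPos T)
    (hc : d.ControlWeightsPos T) :
    ∃ δ > 0, ∀ i : ℕ, 1 ≤ i → ∃ P, d.IsRiccatiSolution T i P ∧ P T = d.riccatiTerminal i ∧
      IsBackwardIntegral T P (fun t => d.riccatiRhs t (P t)) ∧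
      (∀ t ∈ Icc 0 T, (P t)ᵀ = P t) ∧
      ∀ t ∈ Icc 0 T, ∀ v, δ * (v ⬝ᵥ v) ≤ v ⬝ᵥ P t *ᵥ v := by
  have hTm : T ∈ Icc 0 T := ⟨hT.le, le_rfl⟩
  have h0m : (0 : ℝ) ∈ Icc 0 T := ⟨le_rfl, hT.le⟩
  obtain ⟨δ, hδ, hterm⟩ := exists_coercive_riccatiTerminal hs.G
  obtain ⟨l, hl, hcoer⟩ := Data.lq_coercive hb hs hc hδ
  have hreg := hb.regular hs hc
  refine ⟨δ * Real.exp (-(l * T)), by positivity, fun i hi => ?_⟩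
  obtain ⟨P, hPT, hP, hPs, hPlow⟩ := LQ.exists_riccati_solution hreg hT.le hδ hl hcoer
    (Data.lq_controlCoercive hc) (transpose_riccatiTerminal hb.G_symm i) (hterm i hi)
  have hp0 : 0 < δ * Real.exp (-(l * T)) := by positivity
  have hPpos : ∀ t ∈ Icc 0 T, (P t).PosDef := fun t ht => posDef_iff_real.2 ⟨hPs t ht, fun v hv =>
    (mul_pos hp0 ((dotProduct_self_nonneg' v).lt_of_ne'
      (fun h => hv (dotProduct_self_eq_zero.1 h)))).trans_le (hPlow t ht v)⟩
  refine ⟨P, ⟨hP.continuousOn hT.le, hPpos, ?_, fun a b => ?_, fun t ht a b => ?_⟩, hPT, hP, hPs,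
    hPlow⟩
  · obtain ⟨μ, hμ, h⟩ := Data.lq_controlCoercive hc _ hp0
    filter_upwards [h, hreg.R_psd, ae_timeMeasure_mem_Icc] with t h1 h2 ht
    refine posDef_iff_real.2
      ⟨LQ.transpose_M₁ (q := d.lq) (posSemidef_iff_real.1 h2).1 (hPs t ht), fun w hw => ?_⟩
    have h3 := LQ.dotProduct_M₁ (q := d.lq) t (P t) w
    have h4 := h1 w
    have h5 := hPlow t ht (d.lq.D t *ᵥ w)
    have h6 : 0 < μ * (w ⬝ᵥ w) := mul_pos hμ ((dotProduct_self_nonneg' w).lt_of_ne'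
      (fun h => hw (dotProduct_self_eq_zero.1 h)))
    change 0 < w ⬝ᵥ d.lq.M₁ t (P t) *ᵥ w
    linarith
  · exact (hP.apply hT.le a b).essBdd.intervalIntegrable h0m hTm
  · rw [← hPT]
    exact (hP.apply hT.le a b).eqn t ht

end Auxiliary

/-! ### Bounds and equation for the transformed solutions -/

section Bounds

variable {n m k : ℕ} {d : Data n m k} {T : ℝ}

theorem abs_apply_le_matNorm {p q : Type*} [Fintype p] [Fintype q] (M : Matrix p q ℝ) (a : p)
    (b : q) : |M a b| ≤ matNorm M := by
  refine Real.le_sqrt_of_sq_le ?_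
  rw [trace, sq_abs, sq]
  simp only [diag_apply, mul_apply, transpose_apply]
  exact (Finset.single_le_sum (f := fun b => M a b * M a b) (fun _ _ => mul_self_nonneg _)
    (Finset.mem_univ b)).trans
    (Finset.single_le_sum (f := fun a => ∑ b, M a b * M a b)
      (fun _ _ => Finset.sum_nonneg fun _ _ => mul_self_nonneg _) (Finset.mem_univ a))

theorem norm_le_of_matNorm_le {p q : Type*} [Fintype p] [Fintype q] {M : Matrix p q ℝ} {c : ℝ}
    (h : matNorm M ≤ c) : ‖M‖ ≤ Fintype.card q * c :=
  norm_le_of_abs_apply_le ((Real.sqrt_nonneg _).trans h) fun a b =>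
    (abs_apply_le_matNorm M a b).trans h

theorem norm_transpose_le {p q : Type*} [Fintype p] [Fintype q] (M : Matrix p q ℝ) :
    ‖Mᵀ‖ ≤ Fintype.card p * ‖M‖ :=
  norm_le_of_abs_apply_le (norm_nonneg M) fun a b => abs_apply_le_norm M b a

theorem norm_fromBlocks_le {α β γ ε : Type*} [Fintype α] [Fintype β] [Fintype γ] [Fintype ε]
    {A : Matrix α γ ℝ} {B : Matrix α ε ℝ} {C : Matrix β γ ℝ} {D : Matrix β ε ℝ} {r : ℝ}
    (hr : 0 ≤ r) (hA : ‖A‖ ≤ r) (hB : ‖B‖ ≤ r) (hC : ‖C‖ ≤ r) (hD : ‖D‖ ≤ r) :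
    ‖fromBlocks A B C D‖ ≤ Fintype.card (γ ⊕ ε) * r := by
  refine norm_le_of_abs_apply_le hr ?_
  rintro (a | a) (b | b)
  exacts [(abs_apply_le_norm A a b).trans hA, (abs_apply_le_norm B a b).trans hB,
    (abs_apply_le_norm C a b).trans hC, (abs_apply_le_norm D a b).trans hD]

theorem UnifBdd.fromBlocks {α β γ ε : Type*} [Fintype α] [Fintype β] [Fintype γ] [Fintype ε]
    {A : ℕ → ℝ → Matrix α γ ℝ} {B : ℕ → ℝ → Matrix α ε ℝ} {C : ℕ → ℝ → Matrix β γ ℝ}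
    {D : ℕ → ℝ → Matrix β ε ℝ} (hA : UnifBdd T A) (hB : UnifBdd T B) (hC : UnifBdd T C)
    (hD : UnifBdd T D) :
    UnifBdd T fun i t => Matrix.fromBlocks (A i t) (B i t) (C i t) (D i t) := by
  obtain ⟨a, ha⟩ := hA
  obtain ⟨b, hb⟩ := hB
  obtain ⟨c, hc⟩ := hC
  obtain ⟨e, he⟩ := hD
  refine ⟨Fintype.card (γ ⊕ ε) * (|a| + |b| + |c| + |e|), fun i => ?_⟩
  filter_upwards [ha i, hb i, hc i, he i] with t h1 h2 h3 h4
  have := abs_nonneg a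
  have := abs_nonneg b
  have := abs_nonneg c
  have := abs_nonneg e
  have := le_abs_self a
  have := le_abs_self b
  have := le_abs_self c
  have := le_abs_self e
  refine norm_fromBlocks_le (by positivity) ?_ ?_ ?_ ?_ <;> linarith

theorem UnifBdd.submatrix {α β γ ε : Type*} [Fintype α] [Fintype β] [Fintype γ] [Fintype ε]
    {A : ℕ → ℝ → Matrix α β ℝ} (hA : UnifBdd T A) (f : γ → α) (g : ε → β) :
    UnifBdd T fun i t => (A i t).submatrix f g := by
  obtain ⟨a, ha⟩ := hA
  refine ⟨Fintype.card ε * |a|, fun i => (ha i).mono fun t ht => ?_⟩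
  exact norm_le_of_abs_apply_le (abs_nonneg a) fun x y =>
    (abs_apply_le_norm (A i t) (f x) (g y)).trans (ht.trans (le_abs_self a))

theorem UnifBdd.sub {E : Type*} [NormedAddCommGroup E] {f g : ℕ → ℝ → E} (hf : UnifBdd T f)
    (hg : UnifBdd T g) : UnifBdd T fun i t => f i t - g i t := by
  simpa [sub_eq_add_neg] using hf.add hg.neg

variable {P : Matrix (Fin n ⊕ Fin m) (Fin n ⊕ Fin m) ℝ}

theorem isUnit_toBlocks₂₂_and_norm_P₃_le {δ : ℝ} (hδ : 0 < δ)
    (hlow : ∀ v, δ * (v ⬝ᵥ v) ≤ v ⬝ᵥ P *ᵥ v) : IsUnit P.toBlocks₂₂ ∧ ‖P₃ P‖ ≤ m / δ := by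
  have h : ∀ y, δ * (y ⬝ᵥ y) ≤ y ⬝ᵥ P.toBlocks₂₂ *ᵥ y := fun y => by
    have := hlow (Sum.elim 0 y)
    rw [← fromBlocks_toBlocks P, fromBlocks_mulVec, elim_dotProduct_elim,
      elim_dotProduct_elim] at this
    simpa using this
  simpa [P₃] using isUnit_and_norm_inv_le_of_coercive hδ h

/-- The quadratic form of `P₁` at `x` is that of `P` at `(x, P₂ x)`. -/
theorem P₁_posSemidef (hP : Pᵀ = P) (hu : IsUnit P.toBlocks₂₂) (hpos : ∀ v, 0 ≤ v ⬝ᵥ P *ᵥ v) :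
    (P₁ P).PosSemidef := by
  refine posSemidef_iff_real.2 ⟨transpose_P₁ hP, fun x => ?_⟩
  have h : transformQ P *ᵥ Sum.elim x (-0) = Sum.elim (P₁ P *ᵥ x) (P₂ P *ᵥ x) := by
    simp [transformQ, fromBlocks_mulVec]
  have h1 := hpos (Sum.elim x (P₂ P *ᵥ x))
  rw [mulVec_of_transformQ_mulVec hP hu h, elim_dotProduct_elim] at h1
  simpa using h1

theorem norm_P₁_le (hP : Pᵀ = P) (hu : IsUnit P.toBlocks₂₂) (hpos : ∀ v, 0 ≤ v ⬝ᵥ P *ᵥ v) {c : ℝ}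
    (hc : (c • (1 : Matrix (Fin n) (Fin n) ℝ) - P₁ P).PosSemidef) : ‖P₁ P‖ ≤ n * |c| := by
  have h := norm_le_of_posSemidef (P₁_posSemidef hP hu hpos) (c := c) fun x => by
    have := (posSemidef_iff_real.1 hc).2 x
    rw [sub_mulVec, dotProduct_sub, smul_mulVec, one_mulVec, dotProduct_smul, smul_eq_mul] at this
    linarith
  simpa using h

/-- If the blocks of the transforms and `L₁⁻¹, L₂⁻¹` are uniformly bounded, so are the inverses of
`I - Q C̃₂`. -/
theorem unifBdd_fullInv (hb : d.Bounded T) {Pi : ℕ → ℝ → Matrix (Fin n ⊕ Fin m) (Fin n ⊕ Fin m) ℝ}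
    (hDinv : EssBdd T fun t => (d.D₄ t)⁻¹)
    (h₁ : UnifBdd T fun i t => P₁ (Pi i t)) (h₂ : UnifBdd T fun i t => P₂ (Pi i t))
    (h₃ : UnifBdd T fun i t => P₃ (Pi i t)) (hL₁ : UnifBdd T fun i t => (d.L₁ t (Pi i t))⁻¹)
    (hL₂ : UnifBdd T fun i t => (d.L₂ t (Pi i t))⁻¹)
    (hG : UnifBdd T fun i t => (controlGram d t (Pi i t))⁻¹) :
    UnifBdd T fun i t => fullInv d t (Pi i t) := by
  have c0 : ∀ {a b : ℕ}, UnifBdd T fun (_ : ℕ) (_ : ℝ) => (0 : Matrix (Fin a) (Fin b) ℝ) :=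
    fun {a b} => (EssBdd.const 0).unifBdd
  have c1 : ∀ {a : ℕ}, UnifBdd T fun (_ : ℕ) (_ : ℝ) => (1 : Matrix (Fin a) (Fin a) ℝ) :=
    fun {a} => (EssBdd.const 1).unifBdd
  have hC₂ := hb.C₂.essBdd.unifBdd
  have hC₄ := hb.C₄.essBdd.unifBdd
  have hD₂ := hb.D₂.essBdd.unifBdd
  have hJ : UnifBdd T fun i t => baseInv d t (Pi i t) :=
    ((c1.fromBlocks c0 (hL₁.mul (h₃.mul hC₂.transpose)).neg c1).mul
      (hL₂.fromBlocks c0 c0 hL₁)).mul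
      (c1.fromBlocks (((h₁.mul hC₂).add (h₂.transpose.mul hC₄)).mul hL₁) c0 c1)
  have hQ : UnifBdd T fun i t => transformQ (Pi i t) := h₁.fromBlocks h₂.transpose h₂ h₃.neg
  have hN := hJ.mul hQ
  have hV : UnifBdd T fun i t => gramBlock d t (Pi i t) := hN.submatrix Sum.inl Sum.inl
  have hN₂₁ : UnifBdd T fun i t => (baseInv d t (Pi i t) * transformQ (Pi i t)).toBlocks₂₁ :=
    hN.submatrix Sum.inr Sum.inl
  have hW : UnifBdd T fun i t => woodburyInv d t (Pi i t) :=
    c1.sub (((hV.mul hD₂).mul hG).mul hD₂.transpose)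
  exact (hW.fromBlocks c0
    ((hN₂₁.mul ((hD₂.mul hDinv.unifBdd).mul hD₂.transpose)).mul hW).neg c1).mul hJ

end Bounds

section Equation

variable {n m k : ℕ} {d : Data n m k} {T : ℝ}
  {P : ℝ → Matrix (Fin n ⊕ Fin m) (Fin n ⊕ Fin m) ℝ}

/-- The transform of a Riccati solution solves the equation for `Q`. -/
theorem isBackwardIntegral_transformQ (hT : 0 ≤ T)
    (hP : IsBackwardIntegral T P fun t => d.riccatiRhs t (P t))
    (hPs : ∀ t ∈ Icc 0 T, (P t)ᵀ = P t) (hu : ∀ t ∈ Icc 0 T, IsUnit (P t).toBlocks₂₂) {R : ℝ}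
    (hR : ∀ t ∈ Icc 0 T, ‖transformQ (P t)‖ ≤ R)
    (hD : ∀ᵐ t ∂(timeMeasure T), IsUnit (d.D₄ t))
    (hM : ∀ᵐ t ∂(timeMeasure T), IsUnit (d.M₁ t (P t)))
    (hK : ∀ᵐ t ∂(timeMeasure T), IsUnit (1 - transformQ (P t) * d.tC₂ t)) :
    IsBackwardIntegral T (fun t => transformQ (P t)) fun t => d.qRhs t (transformQ (P t)) := by
  have hsub : ∀ s ∈ Icc 0 T, ∀ t ∈ Icc 0 T, transformQ (P s) - transformQ (P t) =
      (proj₁ + transformQ (P t) * proj₂) * (P s - P t) * (proj₁ + proj₂ * transformQ (P s)) :=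
    fun s hs t ht => transformQ_sub_transformQ (hPs t ht) (hu t ht) (hPs s hs) (hu s hs)
  obtain ⟨K, hK'⟩ := hP.exists_lipschitz hT
  set b₁ : ℝ := ‖(proj₁ : Matrix (Fin n ⊕ Fin m) (Fin n ⊕ Fin m) ℝ)‖
  set b₂ : ℝ := ‖(proj₂ : Matrix (Fin n ⊕ Fin m) (Fin n ⊕ Fin m) ℝ)‖
  have hb₁ : 0 ≤ b₁ := norm_nonneg _
  have hb₂ : 0 ≤ b₂ := norm_nonneg _
  set M : ℝ := b₁ + |R| * b₂ with hMdef
  have hM0 : 0 ≤ M := by positivity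
  have hl : ∀ t ∈ Icc 0 T, ‖proj₁ + transformQ (P t) * proj₂‖ ≤ M := fun t ht => by
    refine (norm_add_le _ _).trans (add_le_add_right ((norm_mul_le _ _).trans ?_) _)
    have := (hR t ht).trans (le_abs_self R)
    gcongr
  have hr : ∀ t ∈ Icc 0 T, ‖proj₁ + proj₂ * transformQ (P t)‖ ≤ M := fun t ht => by
    refine (norm_add_le _ _).trans (add_le_add_right ((norm_mul_le _ _).trans ?_) _)
    have := (hR t ht).trans (le_abs_self R)
    rw [mul_comm |R|]
    gcongr
  -- The difference formula makes the transform Lipschitz in time, so that it suffices to identify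
  -- its derivative almost everywhere.
  have hlip : LipschitzOnWith (M * K * M).toNNReal (fun t => transformQ (P t)) (Icc 0 T) := by
    refine LipschitzOnWith.of_dist_le_mul fun s hs t ht => ?_
    have h1 := hK'.dist_le_mul s hs t ht
    rw [dist_eq_norm] at h1
    rw [dist_eq_norm, hsub s hs t ht, Real.coe_toNNReal _ (by positivity)]
    calc _ ≤ ‖proj₁ + transformQ (P t) * proj₂‖ * ‖P s - P t‖ *
            ‖proj₁ + proj₂ * transformQ (P s)‖ :=
          (norm_mul_le _ _).trans (mul_le_mul_of_nonneg_right (norm_mul_le _ _) (norm_nonneg _))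
      _ ≤ M * (K * dist s t) * M := by
          have := hl t ht
          have := hr s hs
          gcongr
      _ = _ := by ring
  have hQc := hlip.continuousOn
  have hQb : EssBdd T fun t => transformQ (P t) := EssBdd.of_continuousOn hQc
  have hg : (fun t => (proj₁ + transformQ (P t) * proj₂) * d.riccatiRhs t (P t) *
      (proj₁ + proj₂ * transformQ (P t))) =ᵐ[timeMeasure T]
      fun t => d.qRhs t (transformQ (P t)) := by
    filter_upwards [hD, hM, hK, ae_timeMeasure_mem_Icc] with t h1 h2 h3 ht
    rw [transform_riccatiRhs d (hPs t ht) (hu t ht) h1 h2 h3, Matrix.mul_assoc,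
      mul_proj₁_add (hu t ht), Matrix.mul_one]
  refine IsBackwardIntegral.congr_ae (IsBackwardIntegral.of_ae_hasDerivAt hT hlip ?_ ?_) hT hg
  · exact (((EssBdd.const proj₁).add (hQb.mul (EssBdd.const proj₂))).mul hP.essBdd).mul
      ((EssBdd.const proj₁).add ((EssBdd.const proj₂).mul hQb))
  · filter_upwards [hP.ae_hasDerivAt hT, ae_timeMeasure_mem_Ioo] with t h1 ht
    have htI := Ioo_subset_Icc_self ht
    -- The difference formula, divided by `s - t`.
    rw [hasDerivAt_iff_tendsto_slope] at h1 ⊢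
    have hc : Tendsto (fun s => transformQ (P s)) (𝓝[≠] t) (𝓝 (transformQ (P t))) :=
      ((hQc.continuousAt (Icc_mem_nhds ht.1 ht.2)).tendsto).mono_left nhdsWithin_le_nhds
    have h2 := ((tendsto_const_nhds (x := proj₁ + transformQ (P t) * proj₂)).mul h1).mul
      ((tendsto_const_nhds (x := proj₁)).add ((tendsto_const_nhds (x := proj₂)).mul hc))
    rw [Matrix.mul_neg, Matrix.neg_mul] at h2
    refine h2.congr' ?_
    filter_upwards [nhdsWithin_le_nhds (Icc_mem_nhds ht.1 ht.2)] with s hs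
    simp only [slope, vsub_eq_sub]
    rw [hsub s hs t htI, Matrix.mul_smul, Matrix.smul_mul]

end Equation

/-! ### Lipschitz continuity of the right-hand side -/

section UniformlyLipschitz

variable {ι : Type*} [Fintype ι] [DecidableEq ι] {T : ℝ} {S : ℝ → Set (Matrix ι ι ℝ)}
  {f g : ℝ → Matrix ι ι ℝ → Matrix ι ι ℝ}

/-- For almost every `t ∈ [0,T]` the map `f t` is bounded and Lipschitz continuous on `S t`, with a
constant that does not depend on `t`. -/
def UnifLip (T : ℝ) (S : ℝ → Set (Matrix ι ι ℝ)) (f : ℝ → Matrix ι ι ℝ → Matrix ι ι ℝ) : Prop :=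
  ∃ K, 0 ≤ K ∧ ∀ᵐ t ∂(timeMeasure T), ∀ Q ∈ S t, ∀ Q' ∈ S t,
    ‖f t Q‖ ≤ K ∧ ‖f t Q - f t Q'‖ ≤ K * ‖Q - Q'‖

theorem EssBdd.unifLip {A : ℝ → Matrix ι ι ℝ} (hA : EssBdd T A) : UnifLip T S fun t _ => A t := by
  obtain ⟨C, hC0, hC⟩ := hA.exists_bound
  refine ⟨C, hC0, hC.mono fun t ht Q _ Q' _ => ⟨ht, ?_⟩⟩
  rw [sub_self, norm_zero]
  positivity

theorem UnifLip.add (hf : UnifLip T S f) (hg : UnifLip T S g) :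
    UnifLip T S fun t Q => f t Q + g t Q := by
  obtain ⟨K, hK0, hK⟩ := hf
  obtain ⟨L, hL0, hL⟩ := hg
  refine ⟨K + L, by positivity, ?_⟩
  filter_upwards [hK, hL] with t h1 h2 Q hQ Q' hQ'
  obtain ⟨a1, a2⟩ := h1 Q hQ Q' hQ'
  obtain ⟨b1, b2⟩ := h2 Q hQ Q' hQ'
  refine ⟨(norm_add_le _ _).trans (add_le_add a1 b1), ?_⟩
  rw [add_sub_add_comm, add_mul]
  exact (norm_add_le _ _).trans (add_le_add a2 b2)

theorem UnifLip.mul (hf : UnifLip T S f) (hg : UnifLip T S g) :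
    UnifLip T S fun t Q => f t Q * g t Q := by
  obtain ⟨K, hK0, hK⟩ := hf
  obtain ⟨L, hL0, hL⟩ := hg
  refine ⟨2 * (K * L), by positivity, ?_⟩
  filter_upwards [hK, hL] with t h1 h2 Q hQ Q' hQ'
  obtain ⟨a1, a2⟩ := h1 Q hQ Q' hQ'
  obtain ⟨b1, b2⟩ := h2 Q hQ Q' hQ'
  have a1' := (h1 Q' hQ' Q hQ).1
  have hKL : 0 ≤ K * L := by positivity
  constructor
  · calc ‖f t Q * g t Q‖ ≤ K * L :=
          (norm_mul_le _ _).trans (mul_le_mul a1 b1 (norm_nonneg _) hK0)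
      _ ≤ _ := by linarith
  · calc ‖f t Q * g t Q - f t Q' * g t Q'‖
        = ‖(f t Q - f t Q') * g t Q + f t Q' * (g t Q - g t Q')‖ := by
          congr 1; noncomm_ring
      _ ≤ K * ‖Q - Q'‖ * L + K * (L * ‖Q - Q'‖) := by
          refine (norm_add_le _ _).trans (add_le_add ?_ ?_)
          · exact (norm_mul_le _ _).trans (mul_le_mul a2 b1 (norm_nonneg _) (by positivity))
          · exact (norm_mul_le _ _).trans (mul_le_mul a1' b2 (norm_nonneg _) hK0)
      _ = _ := by ring

theorem UnifLip.inv (hf : UnifLip T S f) {R : ℝ}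
    (hu : ∀ᵐ t ∂(timeMeasure T), ∀ Q ∈ S t, IsUnit (f t Q) ∧ ‖(f t Q)⁻¹‖ ≤ R) :
    UnifLip T S fun t Q => (f t Q)⁻¹ := by
  obtain ⟨K, hK0, hK⟩ := hf
  refine ⟨|R| + |R| * K * |R|, by positivity, ?_⟩
  filter_upwards [hK, hu] with t h1 h2 Q hQ Q' hQ'
  obtain ⟨u, hR⟩ := h2 Q hQ
  obtain ⟨u', hR'⟩ := h2 Q' hQ'
  have hR := hR.trans (le_abs_self R)
  have hR' := hR'.trans (le_abs_self R)
  refine ⟨hR.trans (le_add_of_nonneg_right (by positivity)), ?_⟩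
  have e : (f t Q)⁻¹ - (f t Q')⁻¹ = (f t Q)⁻¹ * (f t Q' - f t Q) * (f t Q')⁻¹ := by
    rw [Matrix.mul_sub, Matrix.sub_mul, nonsing_inv_mul _ ((isUnit_iff_isUnit_det _).1 u),
      Matrix.mul_assoc, mul_nonsing_inv _ ((isUnit_iff_isUnit_det _).1 u'), Matrix.one_mul,
      Matrix.mul_one]
  have h3 := (h1 Q' hQ' Q hQ).2
  rw [norm_sub_rev Q'] at h3
  calc ‖(f t Q)⁻¹ - (f t Q')⁻¹‖ ≤ ‖(f t Q)⁻¹‖ * ‖f t Q' - f t Q‖ * ‖(f t Q')⁻¹‖ := by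
        rw [e]
        exact (norm_mul_le _ _).trans (mul_le_mul_of_nonneg_right (norm_mul_le _ _) (norm_nonneg _))
    _ ≤ |R| * (K * ‖Q - Q'‖) * |R| := by gcongr
    _ ≤ _ := by nlinarith [mul_nonneg (abs_nonneg R) (norm_nonneg (Q - Q'))]

end UniformlyLipschitz

section RightHandSide

variable {n m k : ℕ} {d : Data n m k} {T R : ℝ}

/-- The matrices `Q` with `‖Q‖ ≤ R` for which `I - Q C̃₂(t)` is bounded below by `1 / R`, that is,
invertible with an inverse of norm at most `R`. -/
def admissible (d : Data n m k) (R t : ℝ) : Set (Matrix (Fin n ⊕ Fin m) (Fin n ⊕ Fin m) ℝ) :=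
  {Q | ‖Q‖ ≤ R ∧ ∀ x, ‖x‖ ≤ R * ‖(1 - Q * d.tC₂ t) *ᵥ x‖}

theorem isUnit_and_norm_inv_le_of_mem_admissible {t : ℝ}
    {Q : Matrix (Fin n ⊕ Fin m) (Fin n ⊕ Fin m) ℝ} (h : Q ∈ admissible d R t) :
    IsUnit (1 - Q * d.tC₂ t) ∧ ‖(1 - Q * d.tC₂ t)⁻¹‖ ≤ R :=
  isUnit_and_norm_inv_le ((norm_nonneg _).trans h.1) h.2

theorem admissible_mono {R' t : ℝ} (h : R ≤ R') : admissible d R t ⊆ admissible d R' t :=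
  fun _ hQ => ⟨hQ.1.trans h, fun x => (hQ.2 x).trans (by gcongr)⟩

theorem isClosed_admissible (d : Data n m k) (R t : ℝ) : IsClosed (admissible d R t) := by
  have h : admissible d R t = {Q | ‖Q‖ ≤ R} ∩ ⋂ x, {Q | ‖x‖ ≤ R * ‖(1 - Q * d.tC₂ t) *ᵥ x‖} := by
    ext Q
    simp [admissible]
  rw [h]
  exact (isClosed_le continuous_norm continuous_const).inter
    (isClosed_iInter fun x => isClosed_le continuous_const (by fun_prop))

theorem mem_admissible_of_norm_sub_le {t b ε : ℝ}
    {Q Q' : Matrix (Fin n ⊕ Fin m) (Fin n ⊕ Fin m) ℝ} (hQ : Q ∈ admissible d R t)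
    (hb : ‖d.tC₂ t‖ ≤ b) (h : ‖Q' - Q‖ ≤ ε) (hε : ε ≤ 1) (hεb : R * (ε * b) ≤ 1 / 2) :
    Q' ∈ admissible d (2 * R + 1) t := by
  have hR : 0 ≤ R := (norm_nonneg _).trans hQ.1
  have hε0 : 0 ≤ ε := (norm_nonneg _).trans h
  constructor
  · have := norm_add_le Q (Q' - Q)
    rw [add_sub_cancel] at this
    have := hQ.1
    linarith
  · intro x
    have e : (1 - Q * d.tC₂ t) *ᵥ x = (1 - Q' * d.tC₂ t) *ᵥ x + ((Q' - Q) * d.tC₂ t) *ᵥ x := by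
      rw [← add_mulVec]
      congr 1
      noncomm_ring
    have h1 : ‖((Q' - Q) * d.tC₂ t) *ᵥ x‖ ≤ ε * b * ‖x‖ := by
      refine (linfty_opNorm_mulVec _ _).trans ?_
      gcongr
      exact (norm_mul_le _ _).trans (mul_le_mul h hb (norm_nonneg _) hε0)
    have h2 := hQ.2 x
    have h3 : ‖(1 - Q * d.tC₂ t) *ᵥ x‖ ≤ ‖(1 - Q' * d.tC₂ t) *ᵥ x‖ + ε * b * ‖x‖ := by
      rw [e]
      exact (norm_add_le _ _).trans (by gcongr)
    have h4 := mul_le_mul_of_nonneg_left h3 hR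
    have h5 := mul_le_mul_of_nonneg_right hεb (norm_nonneg x)
    have h6 := norm_nonneg ((1 - Q' * d.tC₂ t) *ᵥ x)
    linarith

theorem Data.Bounded.essBdd_tC₂ (hb : d.Bounded T) (hc : d.ControlWeightsPos T) :
    EssBdd T d.tC₂ :=
  ((hb.D₂.essBdd.mul hc.D₄_inv.essBdd).mul hb.D₂.essBdd.transpose).neg.fromBlocks hb.C₂.essBdd
    hb.C₂.essBdd.transpose hb.C₄.essBdd

theorem unifLip_qRhs (hb : d.Bounded T) (hc : d.ControlWeightsPos T) (R : ℝ) :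
    UnifLip T (admissible d R) d.qRhs := by
  have hI := hc.D₄_inv.essBdd
  have c0 : ∀ {a b : ℕ}, EssBdd T fun _ : ℝ => (0 : Matrix (Fin a) (Fin b) ℝ) := EssBdd.const 0
  have hD₁ := hb.D₁.essBdd
  have hD₂ := hb.D₂.essBdd
  have hD₃ := hb.D₃.essBdd
  have hA₁ : EssBdd T d.tA₁ :=
    hb.A₁.essBdd.fromBlocks ((hD₁.mul hI).mul hD₃.transpose).neg c0 hb.B₃.essBdd.transpose
  have hB₁ : EssBdd T d.tB₁ := ((hD₁.mul hI).mul hD₁.transpose).neg.fromBlocks hb.B₁.essBdd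
    hb.B₁.essBdd.transpose hb.B₄.essBdd
  have hC₁ : EssBdd T d.tC₁ := ((hD₁.mul hI).mul hD₂.transpose).neg.fromBlocks hb.C₁.essBdd
    hb.B₂.essBdd.transpose c0
  have hA₂ : EssBdd T d.tA₂ :=
    hb.A₂.essBdd.fromBlocks ((hD₂.mul hI).mul hD₃.transpose).neg c0 hb.C₃.essBdd.transpose
  have hB₂ : EssBdd T d.tB₂ := ((hD₂.mul hI).mul hD₁.transpose).neg.fromBlocks hb.B₂.essBdd
    hb.C₁.essBdd.transpose c0
  have hA₃ : EssBdd T d.tA₃ := hb.A₄.essBdd.fromBlocks hb.A₃.essBdd.transpose hb.A₃.essBdd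
    ((hD₃.mul hI).mul hD₃.transpose).neg
  have hB₃ : EssBdd T d.tB₃ := hb.A₁.essBdd.transpose.fromBlocks c0
    ((hD₃.mul hI).mul hD₁.transpose).neg hb.B₃.essBdd
  have hC₃ : EssBdd T d.tC₃ := hb.A₂.essBdd.transpose.fromBlocks c0
    ((hD₃.mul hI).mul hD₂.transpose).neg hb.C₃.essBdd
  have hid : UnifLip T (admissible d R) fun _ Q => Q :=
    ⟨|R| + 1, by positivity, .of_forall fun t Q hQ Q' _ => ⟨by
      have := hQ.1
      have := le_abs_self R
      linarith, le_mul_of_one_le_left (norm_nonneg _) (by linarith [abs_nonneg R])⟩⟩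
  have hC₂ : UnifLip T (admissible d R) fun t Q => 1 - Q * d.tC₂ t := by
    have h := (EssBdd.const (T := T) (1 : Matrix (Fin n ⊕ Fin m) (Fin n ⊕ Fin m) ℝ)).unifLip.add
      (hid.mul (hb.essBdd_tC₂ hc).neg.unifLip)
    simpa only [Matrix.mul_neg, ← sub_eq_add_neg] using h
  have hK : UnifLip T (admissible d R) d.K :=
    (hC₂.inv (.of_forall fun t Q hQ => isUnit_and_norm_inv_le_of_mem_admissible hQ)).mul
      ((hid.mul hA₂.unifLip).add ((hid.mul hB₂.unifLip).mul hid))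
  exact (((((hid.mul hA₁.unifLip).add ((hid.mul hB₁.unifLip).mul hid)).add
    ((hid.mul hC₁.unifLip).mul hK)).add hA₃.unifLip).add (hB₃.unifLip.mul hid)).add
    (hC₃.unifLip.mul hK)

end RightHandSide

/-! ### Passage to the limit and uniqueness -/

section Limit

variable {n m k : ℕ} {d : Data n m k} {T R : ℝ}

theorem exists_isQSolution_of_tendsto (hT : 0 < T) (hb : d.Bounded T)
    (hc : d.ControlWeightsPos T) {Q : ℕ → ℝ → Matrix (Fin n ⊕ Fin m) (Fin n ⊕ Fin m) ℝ}
    (hQ : ∀ i, IsBackwardIntegral T (Q i) fun t => d.qRhs t (Q i t))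
    (hadm : ∀ i, ∀ᵐ t ∂(timeMeasure T), Q i t ∈ admissible d R t)
    (hlim : Tendsto (fun i => Q i T) atTop (𝓝 d.tF)) :
    ∃ Q', d.IsQSolution T Q' ∧ ∀ᵐ t ∂(timeMeasure T), Q' t ∈ admissible d R t := by
  have hTm : T ∈ Icc 0 T := ⟨hT.le, le_rfl⟩
  have h0m : (0 : ℝ) ∈ Icc 0 T := ⟨le_rfl, hT.le⟩
  obtain ⟨K, hK0, hK⟩ := unifLip_qRhs hb hc R
  have hadm' := ae_all_iff.2 hadm
  have hdiff : ∀ i j, ∀ t ∈ Icc 0 T,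
      ‖Q i t - Q j t‖ ≤ ‖Q i T - Q j T‖ * Real.exp (K * T) := fun i j =>
    ((hQ i).sub (hQ j) hT.le).norm_le hT.le hK0 (by
      filter_upwards [hK, hadm'] with t h1 h2
      exact (h1 _ (h2 i) _ (h2 j)).2)
  have hcauchy : ∀ t ∈ Icc 0 T, CauchySeq fun i => Q i t := fun t ht => by
    refine Metric.cauchySeq_iff.2 fun ε hε => ?_
    obtain ⟨N, hN⟩ := Metric.cauchySeq_iff.1 hlim.cauchySeq (ε / Real.exp (K * T)) (by positivity)
    refine ⟨N, fun i hi j hj => ?_⟩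
    have h := hN i hi j hj
    rw [dist_eq_norm, lt_div_iff₀ (Real.exp_pos _)] at h
    rw [dist_eq_norm]
    exact (hdiff i j t ht).trans_lt h
  choose! L hL using fun t ht => cauchySeq_tendsto_of_complete (hcauchy t ht)
  have hLadm : ∀ᵐ t ∂(timeMeasure T), L t ∈ admissible d R t := by
    filter_upwards [hadm', ae_timeMeasure_mem_Icc] with t h1 ht
    exact (isClosed_admissible d R t).mem_of_tendsto (hL t ht) (.of_forall h1)
  have hLI : IsBackwardIntegral T L fun t => d.qRhs t (L t) := by
    refine IsBackwardIntegral.of_tendsto hT.le hQ (C := K) (fun i => ?_) hL ?_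
    · filter_upwards [hK, hadm i] with t h1 h2
      exact (h1 _ h2 _ h2).1
    · filter_upwards [hK, hadm', hLadm, ae_timeMeasure_mem_Icc] with t h1 h2 h3 ht
      refine tendsto_iff_norm_sub_tendsto_zero.2 ?_
      refine squeeze_zero (fun _ => norm_nonneg _) (fun i => (h1 _ (h2 i) _ h3).2) ?_
      simpa using (tendsto_iff_norm_sub_tendsto_zero.1 (hL t ht)).const_mul K
  have hLT : L T = d.tF := tendsto_nhds_unique (hL T hTm) hlim
  refine ⟨L, ⟨hLI.continuousOn hT.le, ?_, fun a b => ?_, fun t ht a b => ?_⟩, hLadm⟩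
  · exact hLadm.mono fun t ht => (isUnit_and_norm_inv_le_of_mem_admissible ht).1
  · exact (hLI.apply hT.le a b).essBdd.intervalIntegrable h0m hTm
  · rw [← hLT]
    exact (hLI.apply hT.le a b).eqn t ht

/-- A solution that is close to an admissible one on `[a,T]` coincides with it there. -/
theorem eqOn_of_norm_sub_le (hb : d.Bounded T) (hc : d.ControlWeightsPos T)
    {Q Q' : ℝ → Matrix (Fin n ⊕ Fin m) (Fin n ⊕ Fin m) ℝ} (hQ : d.IsQSolution T Q)
    (hQ' : d.IsQSolution T Q') (hadm : ∀ᵐ t ∂(timeMeasure T), Q t ∈ admissible d R t)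
    {b ε : ℝ} (hC : ∀ᵐ t ∂(timeMeasure T), ‖d.tC₂ t‖ ≤ b) (hε : ε ≤ 1)
    (hεb : R * (ε * b) ≤ 1 / 2) {a : ℝ} (ha : a ∈ Icc 0 T)
    (hclose : ∀ t ∈ Icc a T, ‖Q' t - Q t‖ ≤ ε) : EqOn Q' Q (Icc a T) := by
  have hTm : T ∈ Icc 0 T := ⟨ha.1.trans ha.2, le_rfl⟩
  have h0m : (0 : ℝ) ∈ Icc 0 T := ⟨le_rfl, hTm.1⟩
  obtain ⟨K, hK0, hK⟩ := unifLip_qRhs hb hc (2 * R + 1)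
  have hsub : Icc a T ⊆ Icc 0 T := Icc_subset_Icc_left ha.1
  have hcont : ContinuousOn (fun t => ‖Q' t - Q t‖) (Icc 0 T) :=
    (hQ'.continuousOn.sub hQ.continuousOn).norm
  set N : ℝ := (Fintype.card (Fin n ⊕ Fin m) : ℝ)
  have hN0 : 0 ≤ N := by positivity
  have hle : ∀ t ∈ Icc a T, ‖Q' t - Q t‖ ≤ 0 + N * K * ∫ s in t..T, ‖Q' s - Q s‖ := by
    intro t ht
    have ht0 := hsub ht
    have hi : 0 ≤ ∫ s in t..T, ‖Q' s - Q s‖ :=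
      intervalIntegral.integral_nonneg ht.2 fun _ _ => norm_nonneg _
    rw [zero_add, mul_assoc]
    refine norm_le_of_abs_apply_le (by positivity) fun i j => ?_
    have hint : ∀ {Q : ℝ → Matrix (Fin n ⊕ Fin m) (Fin n ⊕ Fin m) ℝ}, d.IsQSolution T Q →
        IntervalIntegrable (fun s => d.qRhs s (Q s) i j) volume t T := fun h =>
      (h.integrable i j).mono_set (by
        rw [uIcc_of_le ht.2, uIcc_of_le hTm.1]; exact Icc_subset_Icc_left ht0.1)
    rw [Matrix.sub_apply, hQ'.eqn t ht0 i j, hQ.eqn t ht0 i j, add_sub_add_left_eq_sub,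
      ← intervalIntegral.integral_sub (hint hQ') (hint hQ), ← intervalIntegral.integral_const_mul,
      ← Real.norm_eq_abs]
    refine intervalIntegral.norm_integral_le_of_norm_le ht.2 ?_ ?_
    · have h := ae_of_ae_timeMeasure (hK.and (hadm.and hC)) ht0 hTm
      rw [uIoc_of_le ht.2] at h
      filter_upwards [h] with s hs hsm
      obtain ⟨h1, h2, h3⟩ := hs hsm
      have h4 := hclose s ⟨ht.1.trans hsm.1.le, hsm.2⟩
      have hR : 0 ≤ R := (norm_nonneg _).trans h2.1
      exact (abs_apply_le_norm (d.qRhs s (Q' s) - d.qRhs s (Q s)) i j).trans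
        (h1 _ (mem_admissible_of_norm_sub_le h2 h3 h4 hε hεb) _
          (admissible_mono (by linarith) h2)).2
    · refine ContinuousOn.intervalIntegrable ?_
      rw [uIcc_of_le ht.2]
      exact continuousOn_const.mul (hcont.mono (Icc_subset_Icc_left ht0.1))
  intro t ht
  have h := le_mul_exp_of_le_add_integral (by positivity) (hcont.mono hsub) hle t ht
  rw [zero_mul] at h
  exact sub_eq_zero.1 (norm_le_zero_iff.1 h)

/-- No bound on `(I - Q' C̃₂)⁻¹` is part of the notion of solution; it holds near `Q`, so that the
two solutions agree on one step of fixed length after another, backward from `T`. -/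
theorem isQSolution_eqOn (hT : 0 < T) (hb : d.Bounded T) (hc : d.ControlWeightsPos T)
    {Q Q' : ℝ → Matrix (Fin n ⊕ Fin m) (Fin n ⊕ Fin m) ℝ} (hQ : d.IsQSolution T Q)
    (hQ' : d.IsQSolution T Q') (hadm : ∀ᵐ t ∂(timeMeasure T), Q t ∈ admissible d R t) :
    EqOn Q' Q (Icc 0 T) := by
  have hTm : T ∈ Icc 0 T := ⟨hT.le, le_rfl⟩
  obtain ⟨b, hb0, hC⟩ := (hb.essBdd_tC₂ hc).exists_bound
  -- A matrix within `ε` of `Q t` satisfies a bound on the inverse that depends on `R` alone.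
  set ε : ℝ := min 1 (1 / (2 * (|R| * b + 1))) with hεdef
  have hε0 : 0 < ε := lt_min one_pos (by positivity)
  have hεb : R * (ε * b) ≤ 1 / 2 := by
    have h1 : ε ≤ 1 / (2 * (|R| * b + 1)) := min_le_right _ _
    rw [le_div_iff₀ (by positivity)] at h1
    have h2 : R * (ε * b) ≤ |R| * (ε * b) := by gcongr; exact le_abs_self R
    linarith
  have huc := isCompact_Icc.uniformContinuousOn_of_continuous
    (hQ'.continuousOn.sub hQ.continuousOn)
  obtain ⟨η, hη, hη'⟩ := Metric.uniformContinuousOn_iff.1 huc ε hε0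
  -- Where equality holds to the right of a time, `Q'` stays within `ε` of `Q` for a further time
  -- `η`.
  have hstep : ∀ j : ℕ, ∀ t ∈ Icc 0 T, T - j * (η / 2) ≤ t → Q' t = Q t := by
    intro j
    induction j with
    | zero =>
      intro t ht h
      have : t = T := le_antisymm ht.2 (by simpa using h)
      subst this
      ext a b
      rw [hQ'.eqn t hTm, hQ.eqn t hTm]
      simp
    | succ j ih =>
      intro a ha h
      refine eqOn_of_norm_sub_le hb hc hQ hQ' hadm hC (min_le_left _ _) hεb ha
        (fun t ht => ?_) ⟨le_rfl, ha.2⟩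
      have ht0 : t ∈ Icc 0 T := ⟨ha.1.trans ht.1, ht.2⟩
      rcases le_or_gt (T - j * (η / 2)) t with h1 | h1
      · rw [ih t ht0 h1, sub_self, norm_zero]
        exact hε0.le
      · have hs : T - j * (η / 2) ∈ Icc 0 T :=
          ⟨ht0.1.trans h1.le, sub_le_self _ (by positivity)⟩
        have h2 := hη' t ht0 _ hs (by
          rw [Real.dist_eq, abs_sub_comm, abs_of_pos (sub_pos.2 h1)]
          push_cast at h
          have := ht.1
          linarith)
        simp only [Pi.sub_apply] at h2
        rw [ih _ hs le_rfl, sub_self, dist_zero_right] at h2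
        exact h2.le
  intro t ht
  obtain ⟨j, hj⟩ := exists_nat_ge (T / (η / 2))
  rw [div_le_iff₀ (by positivity)] at hj
  exact hstep j t ht (by linarith [ht.1])

theorem transformQ_riccatiTerminal {i : ℕ} (hi : i ≠ 0) :
    transformQ (d.riccatiTerminal i) = d.tF + (i : ℝ)⁻¹ • fromBlocks 0 0 0 (-1) := by
  have hi' : (i : ℝ) ≠ 0 := Nat.cast_ne_zero.2 hi
  have hinv : ((i : ℝ) • (1 : Matrix (Fin m) (Fin m) ℝ))⁻¹ = (i : ℝ)⁻¹ • 1 :=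
    inv_eq_left_inv (by simp [smul_smul, hi'])
  rw [transformQ, P₁, P₂, P₃, Data.riccatiTerminal, Data.tF, toBlocks_fromBlocks₁₁,
    toBlocks_fromBlocks₂₁, toBlocks_fromBlocks₂₂, hinv, fromBlocks_smul, fromBlocks_add]
  congr 1 <;> simp [smul_smul, hi']

/-- The transformed Riccati solutions solve the equation for `Q` with terminal values that tend to
`F̃`, and stay in a fixed admissible set. -/
theorem exists_approximation (hT : 0 < T) (hb : d.Bounded T) (hs : d.StateWeightsPos T)
    (hc : d.ControlWeightsPos T) (hunif : d.UniformBounds T) :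
    ∃ (R : ℝ) (Q : ℕ → ℝ → Matrix (Fin n ⊕ Fin m) (Fin n ⊕ Fin m) ℝ),
      (∀ i, IsBackwardIntegral T (Q i) fun t => d.qRhs t (Q i t)) ∧
      (∀ i, ∀ᵐ t ∂(timeMeasure T), Q i t ∈ admissible d R t) ∧
      Tendsto (fun i => Q i T) atTop (𝓝 d.tF) := by
  obtain ⟨δ, hδ, hex⟩ := exists_isRiccatiSolution hT hb hs hc
  choose P hsol hPT hP hPs hPlow using fun i : ℕ => hex (i + 1) (Nat.le_add_left 1 i)
  obtain ⟨c, hcb⟩ := hunif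
  have hcb' := fun i => hcb (i + 1) (Nat.le_add_left 1 i) (P i) (hsol i)
  have hpos : ∀ i, ∀ t ∈ Icc 0 T, ∀ v, 0 ≤ v ⬝ᵥ P i t *ᵥ v := fun i t ht v =>
    (mul_nonneg hδ.le (dotProduct_self_nonneg' v)).trans (hPlow i t ht v)
  have h₂₂ := fun i t ht => isUnit_toBlocks₂₂_and_norm_P₃_le hδ (hPlow i t ht)
  have b₁ : ∀ i, ∀ t ∈ Icc 0 T, ‖P₁ (P i t)‖ ≤ n * |c| := fun i t ht =>
    norm_P₁_le (hPs i t ht) (h₂₂ i t ht).1 (hpos i t ht) ((hcb' i).1 t ht).1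
  have b₂ : ∀ i, ∀ t ∈ Icc 0 T, ‖P₂ (P i t)‖ ≤ n * c := fun i t ht => by
    simpa using norm_le_of_matNorm_le ((hcb' i).1 t ht).2
  have b₃ : ∀ i, ∀ t ∈ Icc 0 T, ‖P₃ (P i t)‖ ≤ m / δ := fun i t ht => (h₂₂ i t ht).2
  have ae_of : ∀ {p : ℝ → Prop}, (∀ t ∈ Icc 0 T, p t) → ∀ᵐ t ∂(timeMeasure T), p t := fun h =>
    ae_timeMeasure_mem_Icc.mono h
  have u₁ : UnifBdd T fun i t => P₁ (P i t) := ⟨_, fun i => ae_of (b₁ i)⟩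
  have u₂ : UnifBdd T fun i t => P₂ (P i t) := ⟨_, fun i => ae_of (b₂ i)⟩
  have u₃ : UnifBdd T fun i t => P₃ (P i t) := ⟨_, fun i => ae_of (b₃ i)⟩
  have uL₁ : UnifBdd T fun i t => (d.L₁ t (P i t))⁻¹ :=
    ⟨_, fun i => (hcb' i).2.mono fun t ht => norm_le_of_matNorm_le ht.2.1⟩
  have uL₂ : UnifBdd T fun i t => (d.L₂ t (P i t))⁻¹ :=
    ⟨_, fun i => (hcb' i).2.mono fun t ht => norm_le_of_matNorm_le ht.2.2.2⟩
  obtain ⟨μ, hμ, hD⟩ := hc.exists_coercive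
  have hgram : ∀ i, ∀ᵐ t ∂(timeMeasure T), IsUnit (controlGram d t (P i t)) ∧
      ‖(controlGram d t (P i t))⁻¹‖ ≤ Fintype.card (Fin k) / μ := fun i => by
    filter_upwards [hD, hc.C₄, (hcb' i).2, ae_timeMeasure_mem_Icc] with t h1 h2 h3 ht
    exact isUnit_and_norm_inv_le_of_coercive hμ (controlGram_coercive
      (gramBlock_nonneg (hPs i t ht) (h₂₂ i t ht).1 (hpos i t ht) h2 h3.1 h3.2.2.1) h1)
  obtain ⟨r, hr⟩ := unifBdd_fullInv hb hc.D₄_inv.essBdd u₁ u₂ u₃ uL₁ uL₂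
    ⟨_, fun i => (hgram i).mono fun t ht => ht.2⟩
  obtain ⟨q, hq⟩ : ∃ q, ∀ i, ∀ t ∈ Icc 0 T, ‖transformQ (P i t)‖ ≤ q := by
    refine ⟨Fintype.card (Fin n ⊕ Fin m) * (n * |c| + n * |c| + m * (n * |c|) + m / δ),
      fun i t ht => ?_⟩
    have e1 := b₁ i t ht
    have e2 := (b₂ i t ht).trans (mul_le_mul_of_nonneg_left (le_abs_self c) (Nat.cast_nonneg n))
    have e3 := b₃ i t ht
    have e4 : ‖(P₂ (P i t))ᵀ‖ ≤ m * (n * |c|) := by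
      have := norm_transpose_le (P₂ (P i t))
      rw [Fintype.card_fin] at this
      exact this.trans (mul_le_mul_of_nonneg_left e2 (Nat.cast_nonneg m))
    have p1 : 0 ≤ (n : ℝ) * |c| := by positivity
    have p2 : 0 ≤ (m : ℝ) * (n * |c|) := by positivity
    have p3 : 0 ≤ (m : ℝ) / δ := by positivity
    refine norm_fromBlocks_le (by positivity) ?_ ?_ ?_ ?_
    · linarith
    · linarith
    · linarith
    · rw [norm_neg]
      linarith
  have hinv : ∀ i, ∀ᵐ t ∂(timeMeasure T),
      fullInv d t (P i t) * (1 - transformQ (P i t) * d.tC₂ t) = 1 := fun i => by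
    filter_upwards [hgram i, (hcb' i).2, hc.D₄] with t h1 h2 h3
    exact fullInv_mul h2.1 h2.2.2.1 h3.isUnit h1.1
  refine ⟨max q r, fun i t => transformQ (P i t), fun i => ?_, fun i => ?_, ?_⟩
  · refine isBackwardIntegral_transformQ hT.le (hP i) (hPs i) (fun t ht => (h₂₂ i t ht).1)
      (hq i) (hc.D₄.mono fun t ht => ht.isUnit)
      ((hsol i).M₁_posDef.mono fun t ht => ht.isUnit) ((hinv i).mono fun t ht => ?_)
    exact IsUnit.of_mul_eq_one_right _ ht
  · filter_upwards [hinv i, hr i, ae_timeMeasure_mem_Icc] with t h1 h2 ht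
    refine ⟨(hq i t ht).trans (le_max_left _ _), fun x => ?_⟩
    calc ‖x‖ = ‖fullInv d t (P i t) *ᵥ ((1 - transformQ (P i t) * d.tC₂ t) *ᵥ x)‖ := by
          rw [mulVec_mulVec, h1, one_mulVec]
      _ ≤ ‖fullInv d t (P i t)‖ * ‖(1 - transformQ (P i t) * d.tC₂ t) *ᵥ x‖ :=
          linfty_opNorm_mulVec _ _
      _ ≤ _ := by
          gcongr
          exact h2.trans (le_max_right _ _)
  · simp only [hPT, transformQ_riccatiTerminal (Nat.succ_ne_zero _)]
    have h := ((tendsto_inv_atTop_zero.comp tendsto_natCast_atTop_atTop).comp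
      (tendsto_add_atTop_nat 1) : Tendsto (fun i : ℕ => ((i + 1 : ℕ) : ℝ)⁻¹) atTop (𝓝 0))
    simpa using (h.smul_const (fromBlocks 0 0 0 (-1) :
      Matrix (Fin n ⊕ Fin m) (Fin n ⊕ Fin m) ℝ)).const_add d.tF

end Limit

end FBLQ

theorem mainTheorem6 {n m k : ℕ} (d : FBLQ.Data n m k) (T : ℝ) (hT : 0 < T)
    (hbdd : d.Bounded T) (hstate : d.StateWeightsPos T) (hcontrol : d.ControlWeightsPos T)
    (hunif : d.UniformBounds T) :
    ∃ Q : ℝ → Matrix (Fin n ⊕ Fin m) (Fin n ⊕ Fin m) ℝ, d.IsQSolution T Q ∧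
      ∀ Q' : ℝ → Matrix (Fin n ⊕ Fin m) (Fin n ⊕ Fin m) ℝ, d.IsQSolution T Q' →
        Set.EqOn Q' Q (Set.Icc 0 T) := by
  obtain ⟨R, Qi, hQi, hadm, hlim⟩ := FBLQ.exists_approximation hT hbdd hstate hcontrol hunif
  obtain ⟨Q, hQ, hQadm⟩ := FBLQ.exists_isQSolution_of_tendsto hT hbdd hcontrol hQi hadm hlim
  exact ⟨Q, hQ, fun Q' hQ' => FBLQ.isQSolution_eqOn hT hbdd hcontrol hQ hQ' hQadm⟩
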